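/- Consider the move-to-front (MtF) list of $n$ objects with (random or deterministic) request rates $\mathbf w^{(n)}=(w^{(n)}_1,\dots,w^{(n)}_n)\in\mathbb R_+^n$: at time $0$ object $i$ is at position $i$; conditionally on $\mathbf w^{(n)}$, the objects are requested at the instants of independent Poisson processes of rates $p^{(n)}_i=w^{(n)}_i/\sum_j w^{(n)}_j$ (with $0/0:=0$), so that the total request rate is one; and a requested object is moved instantaneously to the front of the list, the relative order of the others being kept. The search-cost $S^{(n)}(t)$ is the position, in the list resulting from the requests in $[0,t)$, of the first object requested in $[t,\infty)$ (and $0$ if there is none). Let $P$ be a probability measure on $\mathbb R_+$ with mean $\mu\in(0,\infty)$. Condition LLN-$P$ says that there are positive random variables $Z_n$ such that the empirical measures $\frac1n\sum_{i=1}^n\delta_{Z_nw^{(n)}_i}$ converge in law to $P$ and the empirical means $\frac1n\sum_{i=1}^n Z_nw^{(n)}_i$ converge in law to $\mu$, as $n\to\infty$. Conditions LLN-$P$-ex, LLN-$P^-$ and LLN-$P^+$ say that LLN-$P$ holds and that for each $n$ the vector $\mathbf w^{(n)}$ is, respectively, exchangeable, almost surely decreasing (nonincreasing in the initial position), and almost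 surely increasing (nondecreasing in the initial position). For every $t>0$ there are probability laws on $\mathbb R$, depending only on $P$ and $t$, of random variables $S^{ex}(t)$, $S^+(t)$ and $S^-(t)$, the limiting transient search-costs, such that $$\frac{S^{(n)}(n\mu t)}{n}\longrightarrow S^{ex}(t),\quad S^{+}(t),\quad S^{-}(t)\qquad\text{in distribution as } n\to\infty$$ for every sequence $(\mathbf w^{(n)})_n$ satisfying LLN-$P$-ex, LLN-$P^+$, LLN-$P^-$, respectively, and they satisfy $$S^-(t)\preceq S^{ex}(t)\preceq S^+(t),$$ where $X\preceq Y$ means that $\mathbb P(X\le z)\ge\mathbb P(Y\le z)$ for all $z\in\mathbb R$. That is, of the three initial orders, decreasing popularity is the best and increasing popularity is the worst. -/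

import Mathlib

open MeasureTheory ProbabilityTheory Filter Topology Set
open scoped NNReal ENNReal BoundedContinuousFunction

universe u

noncomputable section

namespace MtF

/-! ### The move-to-front list and its search-cost, path by path -/

/-- `Y` is a standard (rate one) Poisson process on the probability space `(Ω, ν)`; `Y s` counts
the events in `[0, s]`. -/
structure IsStandardPoisson {Ω : Type u} [MeasurableSpace Ω] (ν : Measure Ω)
    (Y : ℝ≥0 → Ω → ℕ) : Prop where
  measurable : ∀ s, Measurable (Y s)
  zero : ∀ ω, Y 0 ω = 0
  mono : ∀ ω, Monotone fun s => Y s ω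
  right_continuous : ∀ ω s, ContinuousWithinAt (fun r => Y r ω) (Ici s) s
  law_increments : ∀ s t, s ≤ t → ν.map (fun ω => Y t ω - Y s ω) = poissonMeasure (t - s)
  indep_increments : HasIndepIncrements Y ν

/-- The popularity `w i / ∑ j, w j` of object `i` (with the convention `0 / 0 = 0`). -/
def popularity {n : ℕ} (w : Fin n → ℝ≥0) (i : Fin n) : ℝ≥0 :=
  w i / ∑ j, w j

/-- The number of requests of object `i` in `[0, s]`, in the time scale in which the total request
rate is one: the standard Poisson path `Y i` run at speed `popularity w i`. -/
def requestCount {n : ℕ} (w : Fin n → ℝ≥0) (Y : Fin n → ℝ≥0 → ℕ) (i : Fin n) (s : ℝ≥0) : ℕ :=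
  Y i (popularity w i * s)

/-- The total number `N_s` of requests in `[0, s]`; here and below `X i` is the request counting
path of object `i`. -/
def totalCount {n : ℕ} (X : Fin n → ℝ≥0 → ℕ) (s : ℝ≥0) : ℕ :=
  ∑ i, X i s

/-- The instant of the `k`-th request, `k ≥ 1` (it is `0` if there is no `k`-th request). -/
def requestInstant {n : ℕ} (X : Fin n → ℝ≥0 → ℕ) (k : ℕ) : ℝ≥0 :=
  sInf {s | k ≤ totalCount X s}

/-- The nondecreasing counting path `x` jumps at the instant `s > 0`. -/
def JumpsAt (x : ℝ≥0 → ℕ) (s : ℝ≥0) : Prop :=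
  0 < s ∧ ∀ r < s, x r < x s

open Classical in
/-- The `k`-th requested object `I_k`, `k ≥ 1`; `none` if there is no `k`-th request. (Almost surely
no two objects are requested at the same instant.) -/
def requestedObject {n : ℕ} (X : Fin n → ℝ≥0 → ℕ) (k : ℕ) : Option (Fin n) :=
  (List.finRange n).find? fun i => decide (JumpsAt (X i) (requestInstant X k))

/-- Move the object `i` to the front and keep the relative order of the others. -/
def moveToFront {n : ℕ} (i : Fin n) (l : List (Fin n)) : List (Fin n) :=
  i :: l.erase i

/-- The list after the first `k` requests, when object `i` starts at position `π i`. -/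
def listAfter {n : ℕ} (π : Equiv.Perm (Fin n)) (X : Fin n → ℝ≥0 → ℕ) : ℕ → List (Fin n)
  | 0 => (List.finRange n).map π.symm
  | k + 1 =>
    match requestedObject X (k + 1) with
    | some i => moveToFront i (listAfter π X k)
    | none => listAfter π X k

/-- The number `N_{t-}` of requests in `[0, t)`. -/
def countBefore {n : ℕ} (X : Fin n → ℝ≥0 → ℕ) (t : ℝ≥0) : ℕ :=
  Function.leftLim (totalCount X) t

/-- The position (`1, …, n`) of object `i` in the list at time `t`, i.e. after the requests in
`[0, t)`. -/
def position {n : ℕ} (π : Equiv.Perm (Fin n)) (X : Fin n → ℝ≥0 → ℕ) (t : ℝ≥0) (i : Fin n) : ℕ :=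
  (listAfter π X (countBefore X t)).idxOf i + 1

/-- The transient search-cost at time `t`: the position at time `t` of the first object requested
in `[t, ∞)`. -/
def searchCost {n : ℕ} (π : Equiv.Perm (Fin n)) (X : Fin n → ℝ≥0 → ℕ) (t : ℝ≥0) : ℕ :=
  ∑ i, if requestedObject X (countBefore X t + 1) = some i then position π X t i else 0

/-! ### Random request rates and request processes -/

/-- `w` is a random vector of request rates, and `Y` is a family of independent standard Poisson
processes that is independent of `w`. Conditionally on `w`, the processes
`requestCount (w ω) (fun i s => Y i s ω) i` are then independent Poisson processes whose rates are
the popularities. -/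
structure IsRequestScheme {Ω : Type u} [MeasurableSpace Ω] (ν : Measure Ω) {n : ℕ}
    (w : Ω → Fin n → ℝ≥0) (Y : Fin n → ℝ≥0 → Ω → ℕ) : Prop where
  measurable_rates : Measurable w
  poisson : ∀ i, IsStandardPoisson ν (Y i)
  indep : iIndepFun (fun i ω s => Y i s ω) ν
  indep_rates : IndepFun w (fun ω i s => Y i s ω) ν

/-- The search-cost at time `t` as a random variable, for request rates `w`, when object `i` starts
at position `i`. -/
def randomSearchCost {Ω : Type u} {n : ℕ} (w : Ω → Fin n → ℝ≥0) (Y : Fin n → ℝ≥0 → Ω → ℕ)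
    (t : ℝ≥0) (ω : Ω) : ℕ :=
  searchCost (Equiv.refl (Fin n)) (requestCount (w ω) fun i s => Y i s ω) t

/-! ### The law of large numbers condition and the three initial orders -/

/-- The empirical measure `n⁻¹ ∑ i, δ_{x i}` (a junk value if `n = 0`). -/
def empiricalMeasure {n : ℕ} (x : Fin n → ℝ≥0) : ProbabilityMeasure ℝ≥0 :=
  if h : n = 0 then ⟨Measure.dirac 0, inferInstance⟩
  else ⟨(n : ℝ≥0∞)⁻¹ • ∑ i, Measure.dirac (x i), ⟨by
    simp [ENNReal.inv_mul_cancel, h]⟩⟩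

/-- The random elements `X n` of `E` converge in law to the constant `c`. -/
def TendstoInLawConst {Ω : ℕ → Type u} [∀ n, MeasurableSpace (Ω n)] (ν : ∀ n, Measure (Ω n))
    {E : Type*} [TopologicalSpace E] (X : ∀ n, Ω n → E) (c : E) : Prop :=
  ∀ Ψ : E →ᵇ ℝ, Tendsto (fun n => ∫ ω, Ψ (X n ω) ∂(ν n)) atTop (𝓝 (Ψ c))

/-- The law of large numbers condition with limiting law `P`, where `μ` is the mean of `P`: for some
positive random scaling factors `Z n`, the empirical measures of the scaled rates converge in law
to `P`, and their means converge in law to `μ`. -/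
def LLN {Ω : ℕ → Type u} [∀ n, MeasurableSpace (Ω n)] (ν : ∀ n, Measure (Ω n))
    (w : ∀ n, Ω n → Fin n → ℝ≥0) (P : ProbabilityMeasure ℝ≥0) (μ : ℝ≥0) : Prop :=
  ∃ Z : ∀ n, Ω n → ℝ≥0, (∀ n, Measurable (Z n)) ∧ (∀ n, ∀ᵐ ω ∂(ν n), 0 < Z n ω) ∧
    TendstoInLawConst ν (fun n ω => empiricalMeasure fun i => Z n ω * w n ω i) P ∧
    TendstoInLawConst ν (fun n ω => (∑ i, Z n ω * w n ω i) / n) μ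

/-- The three kinds of information about the initial order of the list. -/
inductive InitialOrder
  | exchangeable
  | decreasing
  | increasing

/-- The vector of rates (listed in the initial order) is exchangeable, respectively almost surely
decreasing, respectively almost surely increasing. -/
def InitialOrder.Holds {Ω : Type u} [MeasurableSpace Ω] (ν : Measure Ω) {n : ℕ}
    (w : Ω → Fin n → ℝ≥0) : InitialOrder → Prop
  | exchangeable => ∀ σ : Equiv.Perm (Fin n), ν.map (fun ω i => w ω (σ i)) = ν.map w
  | decreasing => ∀ᵐ ω ∂ν, Antitone (w ω)
  | increasing => ∀ᵐ ω ∂ν, Monotone (w ω)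

/-- `L` is the law of the limiting transient search-cost `S(t)` under the law of large numbers
condition with limiting law `P` (of mean `μ`) and the initial order `o`: for every sequence of
rates satisfying these assumptions, the normalized search-cost at time `n μ t`, divided by `n`,
converges in distribution to `L`. -/
def IsLimitingSearchCostLaw (o : InitialOrder) (P : ProbabilityMeasure ℝ≥0) (μ t : ℝ≥0)
    (L : ProbabilityMeasure ℝ) : Prop :=
  ∀ (Ω : ℕ → Type u) [∀ n, MeasurableSpace (Ω n)] (ν : ∀ n, Measure (Ω n))
    [∀ n, IsProbabilityMeasure (ν n)] (w : ∀ n, Ω n → Fin n → ℝ≥0)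
    (Y : ∀ n, Fin n → ℝ≥0 → Ω n → ℕ),
    (∀ n, IsRequestScheme (ν n) (w n) (Y n)) → LLN ν w P μ → (∀ n, o.Holds (ν n) (w n)) →
    TendstoInDistribution
      (fun n ω => (randomSearchCost (w n) (Y n) (n * μ * t) ω : ℝ) / n) atTop
      (id : ℝ → ℝ) ν (L : Measure ℝ)

/-- The usual stochastic order `α ⪯ β` on laws of real random variables. -/
def StochLE (α β : ProbabilityMeasure ℝ) : Prop :=
  ∀ z : ℝ, (β : Measure ℝ) (Iic z) ≤ (α : Measure ℝ) (Iic z)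

end MtF

end

noncomputable section

namespace MtF

/-! ### Combinatorics of the move-to-front list -/

/-! The search-cost is compared with the size of random sets that occupy the head of the list. For a
time span `τ ≤ t`, take the objects requested during the last `n μ τ` units of time before `n μ t`;
for `t ≤ τ ≤ t + 1`, take all objects requested so far together with the first `⌈(τ - t) n⌉₊` of the
initial order. Such a front set is an initial segment of the list, so the cost is at most its
cardinality exactly when the next requested object belongs to it (`pathCost_le_card_iff`). The next
object is `i` with probability `p i`, by a race of exponential clocks, whether or not `i` was
requested before; hence the probability of this event is the sum of `p i` times the probability that
`i` is in front (`measureReal_pathCost_le`). The cardinality is a sum of independent indicators and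
concentrates at its mean (`measure_card_inFront_deviation_le`).

In terms of `x i = n μ (p i)`, the mean size divided by `n` and the probability of the event are the
same average over the objects, taken with weight `g = 1` and `g = x / μ` respectively. The law of
large numbers turns averages over all objects into integrals against `P` (`LLN.tendsto_average`).
Averages over the first objects become `partialLimit` (`LLN.tendsto_partial_average`): a
proportional share of the integral for an exchangeable order, the integral over the lower or upper
quantiles for a sorted one. This gives two deterministic functions of `τ`, namely `A = profile P o t
(fun _ => 1)` for the size and `B = profile P o t (fun x => x / μ)` for the probability. Since `A`
increases strictly and continuously from 0 to 1 on `[0, t + 1]`, squeezing between neighbouring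
spans shows that the limiting distribution function takes the value `B τ` at `A τ`
(`tendsto_measure_pathCost_div_le`). The limit law is thus the image under `A` of the measure with
distribution function `B`.

Up to the span `t` the profiles do not depend on the initial order. Beyond it, the comparison at
equal `A` concerns sets of equal mass for `exp (-t x) dP`, and asks which of them carries more of
the integral of `x`. The lower quantiles carry at most their proportional share, by Chebyshev's
inequality (`partialLimit_increasing_mul_le`), and the upper ones, being complementary, at least
theirs. -/

theorem idxOf_eq_countP {α : Type*} [DecidableEq α] (R : α → α → Prop) [DecidableRel R]
    (hR : ∀ a b, R a b → ¬ R b a) (l : List α) (hl : l.Pairwise R) {i : α} (hi : i ∈ l) :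
    l.idxOf i = l.countP fun j => decide (R j i) := by
  induction l with
  | nil => simp at hi
  | cons a l ih =>
    rw [List.pairwise_cons] at hl
    by_cases h : a = i
    · subst h
      have h0 : ¬ R a a := fun h => hR _ _ h h
      have : l.countP (fun j => decide (R j a)) = 0 := by
        rw [List.countP_eq_zero]
        intro j hj
        simpa using hR _ _ (hl.1 j hj)
      simp [this, h0]
    · have hi' : i ∈ l := by
        rcases List.mem_cons.1 hi with h' | h'
        · exact absurd h'.symm h
        · exact h'
      rw [List.idxOf_cons_ne _ h, ih hl.2 hi', List.countP_cons]
      simp [hl.1 i hi']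

/-- A counting path: it starts at zero, is nondecreasing and right-continuous. -/
structure IsCountingPath (x : ℝ≥0 → ℕ) : Prop where
  zero : x 0 = 0
  mono : Monotone x
  exists_gt_eq : ∀ s, ∃ u, s < u ∧ x u = x s

theorem isCountingPath_of_continuousWithinAt {x : ℝ≥0 → ℕ} (h0 : x 0 = 0) (hm : Monotone x)
    (hc : ∀ s, ContinuousWithinAt x (Ici s) s) : IsCountingPath x := by
  refine ⟨h0, hm, fun s => ?_⟩
  have h1 : ∀ᶠ u in 𝓝[≥] s, x u = x s := by
    have := hc s
    rw [ContinuousWithinAt, nhds_discrete, tendsto_pure] at this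
    exact this
  have h2 : ∀ᶠ u in 𝓝[>] s, x u = x s :=
    h1.filter_mono (nhdsWithin_mono _ Ioi_subset_Ici_self)
  obtain ⟨u, hu, hu'⟩ := (h2.and self_mem_nhdsWithin).exists
  exact ⟨u, hu', hu⟩

theorem IsCountingPath.comp_mul {x : ℝ≥0 → ℕ} (hx : IsCountingPath x) (p : ℝ≥0) :
    IsCountingPath fun s => x (p * s) := by
  refine ⟨by simp [hx.zero], fun a b hab => hx.mono (by gcongr), fun s => ?_⟩
  rcases eq_or_ne p 0 with rfl | hp
  · exact ⟨s + 1, by simp, by simp⟩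
  · obtain ⟨u, hu, hu'⟩ := hx.exists_gt_eq (p * s)
    refine ⟨u / p, ?_, ?_⟩
    · rw [lt_div_iff₀ (pos_iff_ne_zero.2 hp), mul_comm]
      exact hu
    · simp only [mul_div_cancel₀ _ hp, hu']

section Path

variable {n : ℕ} {X : Fin n → ℝ≥0 → ℕ}

theorem exists_gt_forall_eq (hX : ∀ i, IsCountingPath (X i)) (s : ℝ≥0) :
    ∃ u, s < u ∧ ∀ i, X i u = X i s := by
  choose u hu hu' using fun i => (hX i).exists_gt_eq s
  rcases isEmpty_or_nonempty (Fin n) with h | h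
  · exact ⟨s + 1, by simp, fun i => h.elim i⟩
  · refine ⟨Finset.univ.inf' Finset.univ_nonempty u, ?_, fun i => le_antisymm ?_ ?_⟩
    · rw [Finset.lt_inf'_iff]
      exact fun i _ => hu i
    · rw [← hu' i]
      exact (hX i).mono (Finset.inf'_le _ (Finset.mem_univ i))
    · refine (hX i).mono (le_of_lt ?_)
      rw [Finset.lt_inf'_iff]
      exact fun i _ => hu i

theorem isCountingPath_totalCount (hX : ∀ i, IsCountingPath (X i)) :
    IsCountingPath (totalCount X) := by
  refine ⟨by simp [totalCount, (hX _).zero], fun a b hab =>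
    Finset.sum_le_sum fun i _ => (hX i).mono hab, fun s => ?_⟩
  obtain ⟨u, hu, hu'⟩ := exists_gt_forall_eq hX s
  exact ⟨u, hu, by simp [totalCount, hu']⟩

theorem eq_of_totalCount_eq (hX : ∀ i, IsCountingPath (X i)) {r s : ℝ≥0} (hrs : r ≤ s)
    (h : totalCount X s ≤ totalCount X r) (i : Fin n) : X i r = X i s := by
  have h1 : ∀ i ∈ Finset.univ, X i r ≤ X i s := fun i _ => (hX i).mono hrs
  exact (Finset.sum_eq_sum_iff_of_le h1).1 (le_antisymm (Finset.sum_le_sum h1) h) i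
    (Finset.mem_univ i)

/-- Right-continuity makes the infimum defining the instant a minimum; the hypothesis `h` rules out
the default value of an empty infimum. -/
theorem le_totalCount_requestInstant (hX : ∀ i, IsCountingPath (X i)) {k : ℕ} {s : ℝ≥0}
    (h : k ≤ totalCount X s) : k ≤ totalCount X (requestInstant X k) := by
  obtain ⟨u, hu, hu'⟩ := (isCountingPath_totalCount hX).exists_gt_eq (requestInstant X k)
  obtain ⟨r, hr, hru⟩ := exists_lt_of_csInf_lt (s := {s | k ≤ totalCount X s}) ⟨s, h⟩ hu
  rw [← hu']
  exact le_trans hr ((isCountingPath_totalCount hX).mono hru.le)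

theorem requestInstant_le {k : ℕ} {s : ℝ≥0} (h : k ≤ totalCount X s) :
    requestInstant X k ≤ s :=
  csInf_le (OrderBot.bddBelow _) h

theorem totalCount_lt_of_lt_requestInstant {k : ℕ} {r : ℝ≥0} (h : r < requestInstant X k) :
    totalCount X r < k := by
  by_contra! h'
  exact absurd (requestInstant_le h') (not_le.2 h)

/-- If no path jumped at this instant, each would have reached its value there strictly earlier, and
at the latest of these finitely many earlier instants the total would already be `k + 1`. -/
theorem exists_jumpsAt_requestInstant (hX : ∀ i, IsCountingPath (X i)) {k : ℕ} {s : ℝ≥0}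
    (h : k + 1 ≤ totalCount X s) : ∃ i, JumpsAt (X i) (requestInstant X (k + 1)) := by
  have h1 := le_totalCount_requestInstant hX h
  set t := requestInstant X (k + 1) with ht
  have htpos : 0 < t := by
    rw [pos_iff_ne_zero]
    intro h0
    rw [h0, (isCountingPath_totalCount hX).zero] at h1
    omega
  by_contra! hcon
  have : ∀ i, ∃ r < t, X i t ≤ X i r := by
    intro i
    have := hcon i
    simp only [JumpsAt, htpos, true_and] at this
    push Not at this
    exact this
  choose r hr hr' using this
  have hR : Finset.univ.sup r < t := by
    rw [Finset.sup_lt_iff (by simpa using htpos)]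
    exact fun i _ => hr i
  have h2 := totalCount_lt_of_lt_requestInstant (X := X) (k := k + 1) (ht ▸ hR)
  have h3 : totalCount X t ≤ totalCount X (Finset.univ.sup r) :=
    Finset.sum_le_sum fun i _ => (hr' i).trans ((hX i).mono (Finset.le_sup (Finset.mem_univ i)))
  omega

/-- Without simultaneous jumps `find?` has at most one candidate, so the order in which it searches
is immaterial. -/
theorem requestedObject_eq_some_iff
    (hs : ∀ i j s, JumpsAt (X i) s → JumpsAt (X j) s → i = j) (k : ℕ) (i : Fin n) :
    requestedObject X k = some i ↔ JumpsAt (X i) (requestInstant X k) := by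
  unfold requestedObject
  constructor
  · intro h
    simpa using List.find?_some h
  · intro h
    have h1 : ((List.finRange n).find? fun i =>
        @decide (JumpsAt (X i) (requestInstant X k)) (Classical.propDecidable _)).isSome := by
      rw [List.find?_isSome]
      exact ⟨i, List.mem_finRange i, by simpa using h⟩
    obtain ⟨j, hj⟩ := Option.isSome_iff_exists.1 h1
    rw [hj]
    have h2 : JumpsAt (X j) (requestInstant X k) := by simpa using List.find?_some hj
    rw [hs j i _ h2 h]

/-- Object `j` precedes object `i` in the list at time `T`, for the initial order of `Fin n`. -/
def Precedes (X : Fin n → ℝ≥0 → ℕ) (T : ℝ≥0) (j i : Fin n) : Prop :=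
  (∃ r < T, X j r < X j T ∧ X i r = X i T) ∨ (X j T = 0 ∧ X i T = 0 ∧ j < i)

/-- Object `i` is the first one requested after time `T`. -/
def IsNext (X : Fin n → ℝ≥0 → ℕ) (T : ℝ≥0) (i : Fin n) : Prop :=
  ∃ s, T < s ∧ X i T < X i s ∧ ∀ j, j ≠ i → X j s = X j T

theorem Precedes.asymm (hX : ∀ i, IsCountingPath (X i)) {T : ℝ≥0} {j i : Fin n}
    (h : Precedes X T j i) : ¬ Precedes X T i j := by
  rintro h'
  rcases h with ⟨r, hr, h1, h2⟩ | ⟨h1, h2, h3⟩ <;> rcases h' with ⟨r', hr', h1', h2'⟩ | ⟨h1', h2', h3'⟩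
  · rcases le_total r r' with h | h
    · have := (hX i).mono h
      omega
    · have := (hX j).mono h
      omega
  · omega
  · omega
  · exact absurd h3 (not_lt.2 h3'.le)

theorem Precedes.of_eq {s T : ℝ≥0} {j i : Fin n}
    (hsT : s ≤ T) (hj : X j s = X j T) (hi : X i s = X i T) (h : Precedes X s j i) :
    Precedes X T j i := by
  rcases h with ⟨r, hr, h1, h2⟩ | ⟨h1, h2, h3⟩
  · exact Or.inl ⟨r, hr.trans_le hsT, hj ▸ h1, hi ▸ h2⟩
  · exact Or.inr ⟨hj ▸ h1, hi ▸ h2, h3⟩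

theorem listAfter_perm (π : Equiv.Perm (Fin n)) (X : Fin n → ℝ≥0 → ℕ) (k : ℕ) :
    (listAfter π X k).Nodup ∧ ∀ i, i ∈ listAfter π X k := by
  induction k with
  | zero =>
    refine ⟨(List.nodup_finRange n).map π.symm.injective, fun i => ?_⟩
    simpa [listAfter] using ⟨π i, by simp⟩
  | succ k ih =>
    simp only [listAfter]
    cases h : requestedObject X (k + 1) with
    | none => exact ih
    | some i =>
      simp only [moveToFront]
      refine ⟨List.nodup_cons.2 ⟨fun h => ?_, ih.1.erase i⟩, fun j => ?_⟩
      · exact absurd rfl (ih.1.mem_erase_iff.1 h).1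
      · by_cases hj : j = i
        · simp [hj]
        · simp [hj, ih.1.mem_erase_iff, ih.2 j]

/-- Induction over the requests. The requested object is the only one whose path changes between the
two instants: it now precedes all others, which were constant just before its jump, and the
relations among the others are inherited because their paths keep their values. -/
theorem pairwise_listAfter_requestInstant (hX : ∀ i, IsCountingPath (X i))
    (hs : ∀ i j s, JumpsAt (X i) s → JumpsAt (X j) s → i = j) (k : ℕ) {s : ℝ≥0}
    (hk : k ≤ totalCount X s) :
    (listAfter (Equiv.refl (Fin n)) X k).Pairwise (Precedes X (requestInstant X k)) := by
  induction k generalizing s with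
  | zero =>
    have h0 : requestInstant X 0 = 0 := by simp [requestInstant]
    rw [h0]
    simp only [listAfter, Equiv.refl_symm, Equiv.coe_refl, List.map_id]
    refine (List.pairwise_lt_finRange n).imp fun {j i} h => Or.inr ⟨(hX j).zero, (hX i).zero, h⟩
  | succ k ih =>
    have ih' := ih (s := s) (by omega)
    obtain ⟨i, hi⟩ := exists_jumpsAt_requestInstant hX hk
    have hreq := (requestedObject_eq_some_iff hs (k + 1) i).2 hi
    have hN1 := le_totalCount_requestInstant hX hk
    have hle : requestInstant X k ≤ requestInstant X (k + 1) := requestInstant_le (by omega)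
    have hNk := le_totalCount_requestInstant hX (k := k) (s := s) (by omega)
    set t := requestInstant X (k + 1) with ht
    set t' := requestInstant X k with ht'
    have hlt : ∀ j, j ≠ i → ∃ r < t, X j r = X j t := by
      intro j hj
      have : ¬ JumpsAt (X j) t := fun h => hj (hs j i t h hi)
      simp only [JumpsAt, hi.1, true_and] at this
      push Not at this
      obtain ⟨r, hr, hr'⟩ := this
      exact ⟨r, hr, le_antisymm ((hX j).mono hr.le) hr'⟩
    have hconst : ∀ j, j ≠ i → X j t' = X j t := by
      intro j hj
      -- The two instants may coincide: nothing here prevents a path from jumping by more than one.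
      rcases hle.eq_or_lt with h | h
      · rw [h]
      · obtain ⟨r, hr, hr'⟩ := hlt j hj
        have hm : max r t' < t := max_lt hr h
        have h1 : totalCount X (max r t') ≤ totalCount X t' := by
          have := totalCount_lt_of_lt_requestInstant (ht ▸ hm)
          omega
        rw [eq_of_totalCount_eq hX (le_max_right r t') h1 j]
        exact le_antisymm ((hX j).mono hm.le) (hr' ▸ (hX j).mono (le_max_left r t'))
    simp only [listAfter, hreq, moveToFront]
    have hnd := (listAfter_perm (Equiv.refl (Fin n)) X k).1
    refine List.pairwise_cons.2 ⟨fun j hj => ?_, ?_⟩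
    · obtain ⟨r, hr, hr'⟩ := hlt j (hnd.mem_erase_iff.1 hj).1
      exact Or.inl ⟨r, hr, hi.2 r hr, hr'⟩
    · refine (ih'.sublist List.erase_sublist).imp_of_mem fun {j l} hj hl h => ?_
      exact h.of_eq hle (hconst j (hnd.mem_erase_iff.1 hj).1) (hconst l (hnd.mem_erase_iff.1 hl).1)

open Classical in
/-- The search-cost in terms of the counting paths. -/
def pathCost (X : Fin n → ℝ≥0 → ℕ) (T : ℝ≥0) : ℕ :=
  ∑ i, if IsNext X T i then (Finset.univ.filter fun j => Precedes X T j i).card + 1 else 0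

open Classical in
-- The order known at the instant of the last request persists until `T`, since no path changes in
-- between. In a list sorted by an asymmetric relation, the index of an element counts its
-- predecessors. The hypothesis `hT` says that no request occurs at `T` itself.
theorem position_eq (hX : ∀ i, IsCountingPath (X i))
    (hs : ∀ i j s, JumpsAt (X i) s → JumpsAt (X j) s → i = j) {T : ℝ≥0}
    (hT : countBefore X T = totalCount X T) (i : Fin n) :
    position (Equiv.refl (Fin n)) X T i =
      (Finset.univ.filter fun j => Precedes X T j i).card + 1 := by
  unfold position
  rw [hT]
  set k := totalCount X T with hk
  have hle : requestInstant X k ≤ T := requestInstant_le le_rfl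
  have hc : ∀ j, X j (requestInstant X k) = X j T :=
    eq_of_totalCount_eq hX hle (le_totalCount_requestInstant hX le_rfl)
  have hp : (listAfter (Equiv.refl (Fin n)) X k).Pairwise (Precedes X T) :=
    (pairwise_listAfter_requestInstant hX hs k le_rfl).imp fun {j l} h =>
      h.of_eq hle (hc j) (hc l)
  obtain ⟨hnd, hmem⟩ := listAfter_perm (Equiv.refl (Fin n)) X k
  have hperm : (listAfter (Equiv.refl (Fin n)) X k).Perm (List.finRange n) :=
    (List.perm_ext_iff_of_nodup hnd (List.nodup_finRange n)).2 fun j => by simp [hmem]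
  rw [idxOf_eq_countP (Precedes X T) (fun a b h => h.asymm hX) _ hp (hmem i), hperm.countP_eq]
  congr 1
  rw [List.countP_eq_length_filter, ← List.toFinset_card_of_nodup
    ((List.nodup_finRange n).filter _)]
  congr 1
  ext j
  simp

/-- The next request instant is the first one after `T` at which any path changes. If only the path
of `i` has changed by some time `s > T`, the object that jumps at that instant can only be `i`. -/
theorem requestedObject_succ_iff_isNext (hX : ∀ i, IsCountingPath (X i))
    (hs : ∀ i j s, JumpsAt (X i) s → JumpsAt (X j) s → i = j) (T : ℝ≥0) (i : Fin n) :
    requestedObject X (totalCount X T + 1) = some i ↔ IsNext X T i := by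
  rw [requestedObject_eq_some_iff hs]
  set k := totalCount X T with hk
  set t := requestInstant X (k + 1) with ht
  have hbefore : ∀ r, T ≤ r → r < t → ∀ j, X j T = X j r := fun r hr hrt =>
    eq_of_totalCount_eq hX hr (Nat.lt_succ_iff.1 (totalCount_lt_of_lt_requestInstant hrt))
  have hT : ∀ s, k + 1 ≤ totalCount X s → T < t := by
    intro s h
    have hle := le_totalCount_requestInstant hX h
    rw [← ht] at hle
    by_contra! h'
    have := (isCountingPath_totalCount hX).mono h'
    omega
  constructor
  · intro h
    -- Without a further request the infimum of the empty set would be 0, and nothing jumps at 0.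
    have hreach : ∃ s, k + 1 ≤ totalCount X s := by
      by_contra! hcon
      have : t = 0 := by
        rw [ht, requestInstant]
        have : {s | k + 1 ≤ totalCount X s} = ∅ := by
          ext s
          simpa using hcon s
        rw [this, NNReal.sInf_empty]
      exact absurd h.1 (by simp [this])
    obtain ⟨s, hs1⟩ := hreach
    have hTt := hT s hs1
    refine ⟨t, hTt, h.2 T hTt, fun j hj => ?_⟩
    have : ¬ JumpsAt (X j) t := fun h' => hj (hs j i t h' h)
    simp only [JumpsAt, h.1, true_and] at this
    push Not at this
    obtain ⟨r, hr, hr'⟩ := this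
    have := hbefore (max r T) (le_max_right _ _) (max_lt hr hTt) j
    rw [this]
    exact le_antisymm (hr'.trans ((hX j).mono (le_max_left _ _))) ((hX j).mono (max_lt hr hTt).le)
  · rintro ⟨s, hTs, h1, h2⟩
    have hks : k + 1 ≤ totalCount X s := by
      have : totalCount X T < totalCount X s :=
        Finset.sum_lt_sum (fun j _ => (hX j).mono hTs.le) ⟨i, Finset.mem_univ i, h1⟩
      omega
    obtain ⟨l, hl⟩ := exists_jumpsAt_requestInstant hX hks
    have : l = i := by
      by_contra hli
      have h3 := hl.2 T (hT s hks)
      have h4 := (hX l).mono (requestInstant_le hks)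
      have h5 := h2 l hli
      simp only [← ht] at h3 h4
      omega
    exact this ▸ hl

theorem countBefore_eq (hX : ∀ i, IsCountingPath (X i)) {T : ℝ≥0}
    (h : ∃ r < T, ∀ i, X i r = X i T) : countBefore X T = totalCount X T := by
  obtain ⟨r, hr, h⟩ := h
  have hN := (isCountingPath_totalCount hX).mono
  have h1 : totalCount X r = totalCount X T := by simp [totalCount, h]
  refine le_antisymm (hN.leftLim_le le_rfl) ?_
  rw [← h1]
  exact hN.le_leftLim hr

theorem searchCost_eq_pathCost (hX : ∀ i, IsCountingPath (X i))
    (hs : ∀ i j s, JumpsAt (X i) s → JumpsAt (X j) s → i = j) {T : ℝ≥0}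
    (h : ∃ r < T, ∀ i, X i r = X i T) :
    searchCost (Equiv.refl (Fin n)) X T = pathCost X T := by
  classical
  have hT := countBefore_eq hX h
  unfold searchCost pathCost
  refine Finset.sum_congr rfl fun i _ => ?_
  rw [hT, position_eq hX hs hT]
  simp only [requestedObject_succ_iff_isNext hX hs]

theorem IsNext.unique {T : ℝ≥0} (hX : ∀ i, IsCountingPath (X i)) {i j : Fin n}
    (hi : IsNext X T i) (hj : IsNext X T j) : i = j := by
  obtain ⟨s, hs, h1, h2⟩ := hi
  obtain ⟨s', hs', h1', h2'⟩ := hj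
  by_contra hij
  rcases le_total s s' with h | h
  · have := (hX i).mono h
    have := h2' i hij
    omega
  · have := (hX j).mono h
    have := h2 j (Ne.symm hij)
    omega

theorem pathCost_eq_of_isNext (hX : ∀ i, IsCountingPath (X i)) {T : ℝ≥0} {i : Fin n}
    (hi : IsNext X T i) [DecidablePred fun j => Precedes X T j i] :
    pathCost X T = (Finset.univ.filter fun j => Precedes X T j i).card + 1 := by
  classical
  unfold pathCost
  rw [Finset.sum_eq_single i]
  · rw [if_pos hi]
    congr
  · intro j _ hj
    rw [if_neg fun h => hj (h.unique hX hi)]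
  · simp

/-- The objects requested in `(r, T]`, and the first `k` ones of the initial order. -/
def InFront (X : Fin n → ℝ≥0 → ℕ) (T r : ℝ≥0) (k : ℕ) (j : Fin n) : Prop :=
  X j r < X j T ∨ (j : ℕ) < k

open Classical in
-- The front set is an initial segment of the list. If `k = 0` it is cut out by the time of the last
-- request; if `r = 0` it consists of all requested objects, followed by never requested ones in
-- their initial order. For `i` outside, every member precedes `i`, so the cost exceeds the
-- cardinality. For `i` inside, all its predecessors are members, and `i` is a member that does not
-- precede itself, which absorbs the `+ 1` in the cost. With `k` and `r` both positive the set need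
-- not be an initial segment.
theorem pathCost_le_card_iff (hX : ∀ i, IsCountingPath (X i)) {T r : ℝ≥0} (hr : r ≤ T) {k : ℕ}
    (hk : k = 0 ∨ r = 0) {i : Fin n} (hi : IsNext X T i) :
    pathCost X T ≤ (Finset.univ.filter fun j => InFront X T r k j).card ↔ InFront X T r k i := by
  rw [pathCost_eq_of_isNext hX hi]
  constructor
  · intro h
    by_contra hA
    have hsub : (Finset.univ.filter fun j => InFront X T r k j) ⊆
        Finset.univ.filter fun j => Precedes X T j i := by
      intro j
      simp only [Finset.mem_filter, Finset.mem_univ, true_and]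
      simp only [InFront, not_or, not_lt] at hA
      have hiT : X i r = X i T := le_antisymm ((hX i).mono hr) hA.1
      intro hj
      by_cases hj1 : X j r < X j T
      · refine Or.inl ⟨r, ?_, hj1, hiT⟩
        rcases hr.eq_or_lt with h | h
        · rw [h] at hj1
          omega
        · exact h
      · have hjk := hj.resolve_left hj1
        have hr0 : r = 0 := hk.resolve_left (by omega)
        rw [hr0, (hX _).zero] at hj1 hiT
        exact Or.inr ⟨by omega, hiT.symm, Fin.lt_def.2 (by omega)⟩
    have := Finset.card_le_card hsub
    omega
  · intro hA
    rw [Nat.add_one_le_iff]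
    refine Finset.card_lt_card ⟨fun j => ?_, fun hsub => ?_⟩
    · simp only [Finset.mem_filter, Finset.mem_univ, true_and]
      rintro (⟨r', hr', h1, h2⟩ | ⟨h1, h2, h3⟩)
      · rcases hA with hA | hA
        · have : r < r' := by
            by_contra! h
            have := (hX i).mono h
            omega
          exact Or.inl (((hX j).mono this.le).trans_lt h1)
        · have hr0 : r = 0 := hk.resolve_left (by omega)
          refine Or.inl ?_
          rw [hr0, (hX j).zero]
          omega
      · rcases hA with hA | hA
        · omega
        · exact Or.inr (lt_trans (Fin.lt_def.1 h3) hA)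
    · have hmem := hsub (Finset.mem_filter.2 ⟨Finset.mem_univ i, hA⟩)
      have := (Finset.mem_filter.1 hmem).2
      exact this.asymm hX this

theorem pathCost_le (hX : ∀ i, IsCountingPath (X i)) (T : ℝ≥0) : pathCost X T ≤ n := by
  classical
  by_cases h : ∃ i, IsNext X T i
  · obtain ⟨i, hi⟩ := h
    rw [pathCost_eq_of_isNext hX hi, Nat.add_one_le_iff]
    have : (Finset.univ.filter fun j => Precedes X T j i) ⊂ Finset.univ := by
      rw [Finset.filter_ssubset]
      exact ⟨i, Finset.mem_univ i, fun h => h.asymm hX h⟩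
    simpa using Finset.card_lt_card this
  · push Not at h
    simp [pathCost, h]

end Path

/-! ### Measurability: counting paths are determined by a countable dense set of instants -/

/-- A fixed countable dense set of instants. -/
def instant (k : ℕ) : ℝ≥0 := TopologicalSpace.denseSeq ℝ≥0 k

theorem exists_instant_btwn {a b : ℝ≥0} (h : a < b) : ∃ k, a < instant k ∧ instant k < b := by
  obtain ⟨k, hk⟩ := (TopologicalSpace.denseRange_denseSeq ℝ≥0).exists_mem_open isOpen_Ioo
    (nonempty_Ioo.2 h)
  exact ⟨k, hk.1, hk.2⟩

theorem exists_instant_gt (a : ℝ≥0) : ∃ k, a < instant k := by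
  obtain ⟨k, hk, -⟩ := exists_instant_btwn (lt_add_one a)
  exact ⟨k, hk⟩

/-- The right-continuous nondecreasing path determined by the values `y k` at the instants
`instant k`. -/
def regPath (y : ℕ → ℕ) (c : ℝ≥0) : ℕ := sInf {m | ∃ k, c < instant k ∧ y k = m}

theorem regPath_le_iff {y : ℕ → ℕ} {c : ℝ≥0} {m : ℕ} :
    regPath y c ≤ m ↔ ∃ k, c < instant k ∧ y k ≤ m := by
  constructor
  · intro h
    obtain ⟨k, hk⟩ := exists_instant_gt c
    obtain ⟨l, hl, hl'⟩ : regPath y c ∈ {m | ∃ k, c < instant k ∧ y k = m} :=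
      Nat.sInf_mem ⟨y k, k, hk, rfl⟩
    exact ⟨l, hl, hl' ▸ h⟩
  · rintro ⟨k, hk, hk'⟩
    have : y k ∈ {m | ∃ k, c < instant k ∧ y k = m} := ⟨k, hk, rfl⟩
    exact (Nat.sInf_le this).trans hk'

theorem regPath_mono (y : ℕ → ℕ) : Monotone (regPath y) := by
  intro a b hab
  obtain ⟨k, hk, hk'⟩ := regPath_le_iff.1 (le_refl (regPath y b))
  exact regPath_le_iff.2 ⟨k, hab.trans_lt hk, hk'⟩

theorem regPath_exists_gt_eq (y : ℕ → ℕ) (c : ℝ≥0) : ∃ u, c < u ∧ regPath y u = regPath y c := by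
  obtain ⟨k, hk, hk'⟩ := regPath_le_iff.1 (le_refl (regPath y c))
  obtain ⟨u, hu, hu'⟩ := exists_between hk
  exact ⟨u, hu, le_antisymm (regPath_le_iff.2 ⟨k, hu', hk'⟩) (regPath_mono y hu.le)⟩

/-- A counting path is a function of countably many of its values; the product σ-algebra on
uncountably many coordinates is thereby avoided. -/
theorem IsCountingPath.regPath_eq {x : ℝ≥0 → ℕ} (hx : IsCountingPath x) :
    regPath (fun k => x (instant k)) = x := by
  ext c
  refine le_antisymm ?_ ?_
  · obtain ⟨u, hu, hu'⟩ := hx.exists_gt_eq c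
    obtain ⟨k, hk, hk'⟩ := exists_instant_btwn hu
    exact regPath_le_iff.2 ⟨k, hk, hu' ▸ hx.mono hk'.le⟩
  · obtain ⟨k, hk, hk'⟩ := regPath_le_iff.1 (le_refl (regPath (fun k => x (instant k)) c))
    exact (hx.mono hk.le).trans hk'

/-- Joint measurability is needed because random rates make the Poisson paths run at random speeds,
hence be evaluated at random instants. -/
theorem measurable_regPath : Measurable fun z : (ℕ → ℕ) × ℝ≥0 => regPath z.1 z.2 := by
  refine measurable_of_Iic fun m => ?_
  have : (fun z : (ℕ → ℕ) × ℝ≥0 => regPath z.1 z.2) ⁻¹' Iic m =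
      ⋃ k, {z : (ℕ → ℕ) × ℝ≥0 | z.2 < instant k ∧ z.1 k ≤ m} := by
    ext z
    simp [regPath_le_iff]
  rw [this]
  refine MeasurableSet.iUnion fun k => ?_
  exact (measurableSet_lt measurable_snd measurable_const).inter
    (measurableSet_le ((measurable_pi_apply k).comp measurable_fst) measurable_const)

section MeasurablePaths

variable {n : ℕ}

/-- Only monotonicity and right-continuity are assumed, not the value at 0: `pathsOf` has these two
properties for arbitrary arguments, whereas it need not start at 0. -/
theorem isNext_iff_exists_instant {X : Fin n → ℝ≥0 → ℕ} (hm : ∀ i, Monotone (X i))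
    (hr : ∀ i s, ∃ u, s < u ∧ X i u = X i s) (T : ℝ≥0) (i : Fin n) :
    IsNext X T i ↔ ∃ k, T < instant k ∧ X i T < X i (instant k) ∧
      ∀ j, j ≠ i → X j (instant k) = X j T := by
  constructor
  · rintro ⟨s, hs, h1, h2⟩
    choose u hu hu' using fun i => hr i s
    have hne : (Finset.univ : Finset (Fin n)).Nonempty := ⟨i, Finset.mem_univ i⟩
    have hlt : s < Finset.univ.inf' hne u := by
      rw [Finset.lt_inf'_iff]
      exact fun i _ => hu i
    obtain ⟨k, hk, hk'⟩ := exists_instant_btwn hlt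
    have hjs : ∀ j, X j (instant k) = X j s := fun j => by
      refine le_antisymm ?_ (hm j hk.le)
      rw [← hu' j]
      exact hm j (hk'.le.trans (Finset.inf'_le _ (Finset.mem_univ j)))
    exact ⟨k, hs.trans hk, by rw [hjs]; exact h1, fun j hj => by rw [hjs, h2 j hj]⟩
  · rintro ⟨k, hk, h1, h2⟩
    exact ⟨_, hk, h1, h2⟩

theorem precedes_iff_exists_instant {X : Fin n → ℝ≥0 → ℕ} (hm : ∀ i, Monotone (X i))
    (hr : ∀ i s, ∃ u, s < u ∧ X i u = X i s) (T : ℝ≥0) (j i : Fin n) :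
    Precedes X T j i ↔ (∃ k, instant k < T ∧ X j (instant k) < X j T ∧
      X i (instant k) = X i T) ∨ (X j T = 0 ∧ X i T = 0 ∧ j < i) := by
  refine or_congr_left ⟨?_, ?_⟩
  · rintro ⟨s, hs, h1, h2⟩
    obtain ⟨u, hu, hu'⟩ := hr j s
    obtain ⟨k, hk, hk'⟩ := exists_instant_btwn (lt_min hu hs)
    refine ⟨k, hk'.trans_le (min_le_right _ _), ?_, ?_⟩
    · refine lt_of_le_of_lt (hm j (hk'.le.trans (min_le_left _ _))) ?_
      rw [hu']
      exact h1
    · refine le_antisymm (hm i (hk'.le.trans (min_le_right _ _))) ?_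
      rw [← h2]
      exact hm i hk.le
  · rintro ⟨k, hk, h1, h2⟩
    exact ⟨_, hk, h1, h2⟩

variable {Z : Type*} [MeasurableSpace Z] {X : Z → Fin n → ℝ≥0 → ℕ}

theorem measurableSet_isNext (hX : ∀ i s, Measurable fun z => X z i s)
    (hm : ∀ z i, Monotone (X z i)) (hr : ∀ z i s, ∃ u, s < u ∧ X z i u = X z i s)
    (T : ℝ≥0) (i : Fin n) : MeasurableSet {z | IsNext (X z) T i} := by
  have : {z | IsNext (X z) T i} = ⋃ k, {z | T < instant k ∧ X z i T < X z i (instant k) ∧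
      ∀ j, j ≠ i → X z j (instant k) = X z j T} := by
    ext z
    simp [isNext_iff_exists_instant (hm z) (hr z)]
  rw [this]
  refine MeasurableSet.iUnion fun k => (MeasurableSet.const _).inter
    ((measurableSet_lt (hX _ _) (hX _ _)).inter ?_)
  have : {z | ∀ j, j ≠ i → X z j (instant k) = X z j T} =
      ⋂ j, ⋂ (_ : j ≠ i), {z | X z j (instant k) = X z j T} := by
    ext z
    simp
  change MeasurableSet {z | ∀ j, j ≠ i → X z j (instant k) = X z j T}
  rw [this]
  exact MeasurableSet.iInter fun j => MeasurableSet.iInter fun _ =>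
    measurableSet_eq_fun (hX _ _) (hX _ _)

theorem measurableSet_precedes (hX : ∀ i s, Measurable fun z => X z i s)
    (hm : ∀ z i, Monotone (X z i)) (hr : ∀ z i s, ∃ u, s < u ∧ X z i u = X z i s)
    (T : ℝ≥0) (j i : Fin n) : MeasurableSet {z | Precedes (X z) T j i} := by
  have : {z | Precedes (X z) T j i} = (⋃ k, {z | instant k < T ∧ X z j (instant k) < X z j T ∧
      X z i (instant k) = X z i T}) ∪ {z | X z j T = 0 ∧ X z i T = 0 ∧ j < i} := by
    ext z
    simp [precedes_iff_exists_instant (hm z) (hr z)]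
  rw [this]
  refine (MeasurableSet.iUnion fun k => (MeasurableSet.const _).inter
    ((measurableSet_lt (hX _ _) (hX _ _)).inter (measurableSet_eq_fun (hX _ _) (hX _ _)))).union ?_
  exact (measurableSet_eq_fun (hX _ _) measurable_const).inter
    ((measurableSet_eq_fun (hX _ _) measurable_const).inter (MeasurableSet.const _))

theorem measurable_pathCost (hX : ∀ i s, Measurable fun z => X z i s)
    (hm : ∀ z i, Monotone (X z i)) (hr : ∀ z i s, ∃ u, s < u ∧ X z i u = X z i s)
    (T : ℝ≥0) : Measurable fun z => pathCost (X z) T := by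
  classical
  unfold pathCost
  refine Finset.measurable_sum _ fun i _ => Measurable.ite (measurableSet_isNext hX hm hr T i) ?_
    measurable_const
  simp only [Finset.card_filter]
  exact (Finset.measurable_sum _ fun j _ => Measurable.ite (measurableSet_precedes hX hm hr T j i)
    measurable_const measurable_const).add_const 1

theorem measurableSet_inFront (hX : ∀ i s, Measurable fun z => X z i s) (T r : ℝ≥0) (k : ℕ)
    (j : Fin n) : MeasurableSet {z | InFront (X z) T r k j} :=
  (measurableSet_lt (hX _ _) (hX _ _)).union (MeasurableSet.const _)

open Classical in
theorem measurable_card_inFront (hX : ∀ i s, Measurable fun z => X z i s) (T r : ℝ≥0) (k : ℕ) :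
    Measurable fun z => (Finset.univ.filter fun j => InFront (X z) T r k j).card := by
  simp only [Finset.card_filter]
  exact Finset.measurable_sum _ fun j _ => Measurable.ite (measurableSet_inFront hX T r k j)
    measurable_const measurable_const

/-- A measurable event which occurs if two objects are requested at the same instant, or if an
object is requested at time `T`. -/
def Clash (X : Fin n → ℝ≥0 → ℕ) (T : ℝ≥0) : Prop :=
  (∃ i j, i ≠ j ∧ ∃ K : ℕ, ∀ m : ℕ, ∃ k ∈ Finset.range (K * (m + 1)),
    X i (k / (m + 1)) ≠ X i ((k + 1) / (m + 1)) ∧ X j (k / (m + 1)) ≠ X j ((k + 1) / (m + 1))) ∨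
  ∀ m : ℕ, ∃ i, X i (T * (m / (m + 1))) ≠ X i T

theorem measurableSet_clash (hX : ∀ i s, Measurable fun z => X z i s) (T : ℝ≥0) :
    MeasurableSet {z | Clash (X z) T} := by
  have hne : ∀ i s t, MeasurableSet {z | X z i s ≠ X z i t} := fun i s t =>
    (measurableSet_eq_fun (hX _ _) (hX _ _)).compl
  have : {z | Clash (X z) T} = (⋃ i, ⋃ j, ⋃ (_ : i ≠ j), ⋃ K : ℕ, ⋂ m : ℕ,
      ⋃ k ∈ Finset.range (K * (m + 1)), {z | X z i (k / (m + 1)) ≠ X z i ((k + 1) / (m + 1))} ∩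
        {z | X z j (k / (m + 1)) ≠ X z j ((k + 1) / (m + 1))}) ∪
      ⋂ m : ℕ, ⋃ i, {z | X z i (T * (m / (m + 1))) ≠ X z i T} := by
    ext z
    simp only [Clash, mem_union, mem_iUnion, mem_iInter, mem_inter_iff, mem_ofPred_eq, exists_prop]
  rw [this]
  refine MeasurableSet.union ?_ ?_
  · exact MeasurableSet.iUnion fun i => MeasurableSet.iUnion fun j => MeasurableSet.iUnion fun _ =>
      MeasurableSet.iUnion fun K => MeasurableSet.iInter fun m => MeasurableSet.iUnion fun k =>
      MeasurableSet.iUnion fun _ => (hne _ _ _).inter (hne _ _ _)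
  · exact MeasurableSet.iInter fun m => MeasurableSet.iUnion fun i => hne _ _ _

/-- A common jump instant `s` lies, for every `m`, in one cell `(k / (m + 1), (k + 1) / (m + 1)]`,
over which both paths change. Here `k + 1 = ⌈s * (m + 1)⌉₊`, and `⌈s⌉₊` bounds the range of cells
uniformly in `m`. -/
theorem eq_of_jumpsAt_of_not_clash {X : Fin n → ℝ≥0 → ℕ} (hX : ∀ i, IsCountingPath (X i))
    {T : ℝ≥0} (h : ¬ Clash X T) (i j : Fin n) (s : ℝ≥0) (hi : JumpsAt (X i) s)
    (hj : JumpsAt (X j) s) : i = j := by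
  by_contra hij
  refine h (Or.inl ⟨i, j, hij, ⌈s⌉₊, fun m => ?_⟩)
  have hm : (0 : ℝ≥0) < m + 1 := by positivity
  have hsm : 0 < s * (m + 1) := mul_pos hi.1 hm
  have hc : 0 < ⌈s * (m + 1)⌉₊ := Nat.ceil_pos.2 hsm
  obtain ⟨k, hk⟩ : ∃ k, ⌈s * (m + 1)⌉₊ = k + 1 := ⟨_, (Nat.succ_pred_eq_of_pos hc).symm⟩
  have h1 : (k : ℝ≥0) / (m + 1) < s := by
    rw [div_lt_iff₀ hm, ← Nat.lt_ceil, hk]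
    omega
  have h2 : s ≤ (k + 1 : ℝ≥0) / (m + 1) := by
    rw [le_div_iff₀ hm]
    have := Nat.le_ceil (s * (m + 1))
    rw [hk] at this
    exact_mod_cast this
  refine ⟨k, ?_, ?_, ?_⟩
  · rw [Finset.mem_range, ← Nat.succ_le_iff, Nat.succ_eq_add_one, ← hk, Nat.ceil_le]
    push_cast
    gcongr
    exact Nat.le_ceil s
  · exact ((hi.2 _ h1).trans_le ((hX i).mono h2)).ne
  · exact ((hj.2 _ h1).trans_le ((hX j).mono h2)).ne

theorem exists_eq_of_not_clash {X : Fin n → ℝ≥0 → ℕ} {T : ℝ≥0} (hT : 0 < T) (h : ¬ Clash X T) :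
    ∃ r < T, ∀ i, X i r = X i T := by
  simp only [Clash, not_or, not_forall, not_exists, not_not] at h
  obtain ⟨m, hm⟩ := h.2
  refine ⟨T * (m / (m + 1)), ?_, hm⟩
  refine mul_lt_of_lt_one_right hT ?_
  rw [div_lt_one (by positivity)]
  exact lt_add_one _

theorem searchCost_eq_pathCost_of_not_clash {X : Fin n → ℝ≥0 → ℕ}
    (hX : ∀ i, IsCountingPath (X i)) {T : ℝ≥0} (hT : 0 < T) (h : ¬ Clash X T) :
    searchCost (Equiv.refl (Fin n)) X T = pathCost X T :=
  searchCost_eq_pathCost hX (eq_of_jumpsAt_of_not_clash hX h) (exists_eq_of_not_clash hT h)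

end MeasurablePaths

/-- Fubini for an independent pair, with the second variable realised on a copy of the same space.
It serves to freeze one clock in the race between the objects, and to freeze the random rates. -/
theorem measure_preimage_prodMk_eq_lintegral {Ω α β : Type*} [MeasurableSpace Ω]
    [MeasurableSpace α] [MeasurableSpace β] {ν : Measure Ω} [IsFiniteMeasure ν] {W : Ω → α}
    {V : Ω → β} (hW : Measurable W) (hV : Measurable V) (h : IndepFun W V ν) {E : Set (α × β)}
    (hE : MeasurableSet E) :
    ν {ω | (W ω, V ω) ∈ E} = ∫⁻ ω, ν {ω' | (W ω, V ω') ∈ E} ∂ν := by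
  have h1 := (indepFun_iff_map_prod_eq_prod_map_map hW.aemeasurable hV.aemeasurable).1 h
  have h2 : ν {ω | (W ω, V ω) ∈ E} = ν.map (fun ω => (W ω, V ω)) E :=
    (Measure.map_apply (hW.prodMk hV) hE).symm
  rw [h2, h1, Measure.prod_apply hE, lintegral_map (measurable_measure_prodMk_left hE) hW]
  refine lintegral_congr fun ω => ?_
  rw [Measure.map_apply hV (measurable_prodMk_left hE)]
  rfl

/-! ### Poisson requests with deterministic popularities -/

section Poisson

variable {Ω : Type*} [MeasurableSpace Ω] {ν : Measure Ω}

theorem IsStandardPoisson.isCountingPath {Y : ℝ≥0 → Ω → ℕ} (hY : IsStandardPoisson ν Y) (ω : Ω) :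
    IsCountingPath fun s => Y s ω :=
  isCountingPath_of_continuousWithinAt (hY.zero ω) (hY.mono ω) (hY.right_continuous ω)

theorem IsStandardPoisson.measure_eq {Y : ℝ≥0 → Ω → ℕ} (hY : IsStandardPoisson ν Y)
    {s t : ℝ≥0} (hst : s ≤ t) :
    ν {ω | Y s ω = Y t ω} = ENNReal.ofReal (Real.exp (-(t - s : ℝ≥0))) := by
  have h1 : {ω | Y s ω = Y t ω} = (fun ω => Y t ω - Y s ω) ⁻¹' {0} := by
    ext ω
    have : Y s ω ≤ Y t ω := hY.mono ω hst
    simp only [mem_ofPred_eq, mem_preimage, mem_singleton_iff]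
    omega
  have hm : Measurable fun ω => Y t ω - Y s ω := (hY.measurable t).sub (hY.measurable s)
  rw [h1, ← Measure.map_apply hm (measurableSet_singleton 0),
    hY.law_increments s t hst, poissonMeasure_singleton]
  simp

theorem IsStandardPoisson.measure_ne_le [IsProbabilityMeasure ν] {Y : ℝ≥0 → Ω → ℕ}
    (hY : IsStandardPoisson ν Y) {s t : ℝ≥0} (hst : s ≤ t) :
    ν {ω | Y s ω ≠ Y t ω} ≤ ((t - s : ℝ≥0) : ℝ≥0∞) := by
  have h1 : {ω | Y s ω ≠ Y t ω} = {ω | Y s ω = Y t ω}ᶜ := rfl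
  rw [h1, measure_compl (measurableSet_eq_fun (hY.measurable s) (hY.measurable t))
    (measure_ne_top _ _), measure_univ, hY.measure_eq hst, ← ENNReal.ofReal_one,
    ← ENNReal.ofReal_sub _ (Real.exp_nonneg _), ← ENNReal.ofReal_coe_nnreal]
  refine ENNReal.ofReal_le_ofReal ?_
  have := Real.add_one_le_exp (-((t - s : ℝ≥0) : ℝ))
  linarith

theorem eq_zero_of_forall_le_div {x : ℝ≥0∞} (C : ℝ≥0)
    (h : ∀ m : ℕ, x ≤ ((C / (m + 1) : ℝ≥0) : ℝ≥0∞)) : x = 0 := by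
  have h1 : Tendsto (fun m : ℕ => C / ((m : ℝ≥0) + 1)) atTop (𝓝 0) := by
    rw [← NNReal.tendsto_coe]
    push_cast
    exact tendsto_const_div_atTop_nhds_zero_nat (C : ℝ) |>.comp (tendsto_add_atTop_nat 1) |>.congr
      fun m => by simp
  have h2 := ENNReal.tendsto_coe.2 h1
  exact le_antisymm (ge_of_tendsto' h2 h) (zero_le)

variable {n : ℕ} {Y : Fin n → ℝ≥0 → Ω → ℕ}

/-- The requests of the objects, for the popularities `p`. -/
def scaledPaths (Y : Fin n → ℝ≥0 → Ω → ℕ) (p : Fin n → ℝ≥0) (ω : Ω) (i : Fin n) (s : ℝ≥0) : ℕ :=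
  Y i (p i * s) ω

theorem isCountingPath_scaledPaths (hY : ∀ i, IsStandardPoisson ν (Y i)) (p : Fin n → ℝ≥0) (ω : Ω)
    (i : Fin n) : IsCountingPath (scaledPaths Y p ω i) :=
  ((hY i).isCountingPath ω).comp_mul (p i)

theorem measurable_path (hY : ∀ i, IsStandardPoisson ν (Y i)) (i : Fin n) :
    Measurable fun ω s => Y i s ω :=
  measurable_pi_iff.2 fun s => (hY i).measurable s

theorem measure_ne_inter_ne_le [IsProbabilityMeasure ν]
    (hY : ∀ i, IsStandardPoisson ν (Y i))
    (hind : iIndepFun (fun i ω s => Y i s ω) ν) {i j : Fin n} (hij : i ≠ j) {a b c d : ℝ≥0}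
    (hab : a ≤ b) (hcd : c ≤ d) :
    ν {ω | Y i a ω ≠ Y i b ω ∧ Y j c ω ≠ Y j d ω} ≤ ((b - a : ℝ≥0) : ℝ≥0∞) * (d - c : ℝ≥0) := by
  have hm : ∀ s t : ℝ≥0, MeasurableSet {y : ℝ≥0 → ℕ | y s ≠ y t} := fun s t =>
    (measurableSet_eq_fun (measurable_pi_apply s) (measurable_pi_apply t)).compl
  have := (hind.indepFun hij).measure_inter_preimage_eq_mul {y | y a ≠ y b} {y | y c ≠ y d}
    (hm _ _) (hm _ _)
  calc ν {ω | Y i a ω ≠ Y i b ω ∧ Y j c ω ≠ Y j d ω}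
      = ν {ω | Y i a ω ≠ Y i b ω} * ν {ω | Y j c ω ≠ Y j d ω} := this
    _ ≤ _ := mul_le_mul' ((hY i).measure_ne_le hab) ((hY j).measure_ne_le hcd)

/-- Two independent paths both change over a given cell of length `1 / (m + 1)` with probability at
most `p i * p j / (m + 1) ^ 2`; the `K * (m + 1)` cells together contribute `O(1 / m)`. A request
between `T * (m / (m + 1))` and `T` has probability `O(1 / m)` as well. -/
theorem measure_clash [IsProbabilityMeasure ν]
    (hY : ∀ i, IsStandardPoisson ν (Y i))
    (hind : iIndepFun (fun i ω s => Y i s ω) ν) (p : Fin n → ℝ≥0) (T : ℝ≥0) :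
    ν {ω | Clash (scaledPaths Y p ω) T} = 0 := by
  refine measure_mono_null (t := (⋃ i, ⋃ j, ⋃ (_ : i ≠ j), ⋃ K : ℕ, {ω | ∀ m : ℕ,
    ∃ k ∈ Finset.range (K * (m + 1)),
      scaledPaths Y p ω i (k / (m + 1)) ≠ scaledPaths Y p ω i ((k + 1) / (m + 1)) ∧
      scaledPaths Y p ω j (k / (m + 1)) ≠ scaledPaths Y p ω j ((k + 1) / (m + 1))}) ∪
      {ω | ∀ m : ℕ, ∃ i, scaledPaths Y p ω i (T * (m / (m + 1))) ≠ scaledPaths Y p ω i T}) ?_ ?_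
  · intro ω hω
    simpa only [Clash, mem_union, mem_iUnion, mem_ofPred_eq, exists_prop] using hω
  refine measure_union_null ?_ ?_
  · simp only [measure_iUnion_null_iff]
    intro i j hij K
    refine eq_zero_of_forall_le_div (K * (p i * p j)) fun m => ?_
    have hsub : {ω | ∀ m : ℕ, ∃ k ∈ Finset.range (K * (m + 1)),
        scaledPaths Y p ω i (k / (m + 1)) ≠ scaledPaths Y p ω i ((k + 1) / (m + 1)) ∧
        scaledPaths Y p ω j (k / (m + 1)) ≠ scaledPaths Y p ω j ((k + 1) / (m + 1))} ⊆
        ⋃ k ∈ Finset.range (K * (m + 1)), {ω |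
          scaledPaths Y p ω i (k / (m + 1)) ≠ scaledPaths Y p ω i ((k + 1) / (m + 1)) ∧
          scaledPaths Y p ω j (k / (m + 1)) ≠ scaledPaths Y p ω j ((k + 1) / (m + 1))} := by
      intro ω hω
      simpa only [mem_iUnion, exists_prop, mem_ofPred_eq] using hω m
    have hle : ∀ (q : ℝ≥0) (k : ℕ), q * ((k : ℝ≥0) / (m + 1)) ≤ q * ((k + 1) / (m + 1)) := by
      intro q k
      gcongr
      simp
    have hdiff : ∀ (q : ℝ≥0) (k : ℕ),
        q * (((k : ℝ≥0) + 1) / (m + 1)) - q * (k / (m + 1)) = q / (m + 1) := by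
      intro q k
      rw [tsub_eq_iff_eq_add_of_le (hle q k)]
      ring
    calc _ ≤ _ := measure_mono hsub
      _ ≤ _ := measure_biUnion_finset_le _ _
      _ ≤ ∑ _k ∈ Finset.range (K * (m + 1)), (((p i / (m + 1) : ℝ≥0) : ℝ≥0∞) *
          ((p j / (m + 1) : ℝ≥0) : ℝ≥0∞)) := by
          refine Finset.sum_le_sum fun k _ => ?_
          have := measure_ne_inter_ne_le hY hind hij (hle (p i) k) (hle (p j) k)
          rwa [hdiff, hdiff] at this
      _ = _ := by
          rw [Finset.sum_const, Finset.card_range, nsmul_eq_mul]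
          rw [← ENNReal.coe_natCast, ← ENNReal.coe_mul, ← ENNReal.coe_mul]
          congr 1
          push_cast
          field_simp
  · refine eq_zero_of_forall_le_div ((∑ i, p i) * T) fun m => ?_
    have hle : ∀ q : ℝ≥0, q * (T * ((m : ℝ≥0) / (m + 1))) ≤ q * T := by
      intro q
      gcongr
      refine mul_le_of_le_one_right (zero_le) ?_
      rw [div_le_one (by positivity)]
      simp
    have hdiff : ∀ q : ℝ≥0, q * T - q * (T * ((m : ℝ≥0) / (m + 1))) = q * T / (m + 1) := by
      intro q
      rw [tsub_eq_iff_eq_add_of_le (hle q)]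
      field_simp
      ring
    calc _ ≤ ν (⋃ i, {ω | scaledPaths Y p ω i (T * (m / (m + 1))) ≠ scaledPaths Y p ω i T}) := by
          refine measure_mono fun ω hω => ?_
          simpa only [mem_iUnion, mem_ofPred_eq] using hω m
      _ ≤ ∑ i, ν {ω | scaledPaths Y p ω i (T * (m / (m + 1))) ≠ scaledPaths Y p ω i T} :=
          measure_iUnion_fintype_le _ _
      _ ≤ ∑ i, ((p i * T / (m + 1) : ℝ≥0) : ℝ≥0∞) := by
          refine Finset.sum_le_sum fun i _ => ?_
          have := (hY i).measure_ne_le (hle (p i))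
          rwa [hdiff] at this
      _ = _ := by
          rw [← ENNReal.ofNNReal_finsetSum, ← Finset.sum_div, ← Finset.sum_mul]

/-! #### The residual waiting time -/

/-- The waiting time after the instant `c` until the next event of the path `y`
(`0` if there is none). -/
def residual (y : ℝ≥0 → ℕ) (c : ℝ≥0) : ℝ≥0 :=
  ((⨅ k, if y c < y (instant k) then (instant k : ℝ≥0∞) else ⊤) - c).toNNReal

theorem measurable_residual (c : ℝ≥0) : Measurable fun y : ℝ≥0 → ℕ => residual y c := by
  refine ((Measurable.iInf fun k => Measurable.ite ?_ measurable_const measurable_const).sub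
    measurable_const).ennreal_toNNReal
  exact measurableSet_lt (measurable_pi_apply _) (measurable_pi_apply _)

/-- Right-continuity prolongs constancy strictly beyond `c + b`, which accounts for the strict
inequality. The hypothesis `hc` keeps the infimum finite, so that `toNNReal` does not return its
default value. -/
theorem IsCountingPath.lt_residual_iff {y : ℝ≥0 → ℕ} (hy : IsCountingPath y) {c : ℝ≥0}
    (hc : ∃ u, y c < y u) (b : ℝ≥0) : b < residual y c ↔ y c = y (c + b) := by
  set I : ℝ≥0∞ := ⨅ k, if y c < y (instant k) then (instant k : ℝ≥0∞) else ⊤ with hI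
  have hIlt : ∀ u, y c < y u → I ≤ u := by
    intro u hu
    refine le_of_forall_gt fun b hb => ?_
    obtain ⟨v, hv, hvb⟩ := ENNReal.lt_iff_exists_nnreal_btwn.1 hb
    obtain ⟨k, hk, hk'⟩ := exists_instant_btwn (ENNReal.coe_lt_coe.1 hv)
    refine lt_of_le_of_lt (iInf_le _ k) ?_
    rw [if_pos (hu.trans_le (hy.mono hk.le))]
    exact (ENNReal.coe_lt_coe.2 hk').trans hvb
  have hItop : I ≠ ⊤ := by
    obtain ⟨u, hu⟩ := hc
    exact ((hIlt u hu).trans_lt ENNReal.coe_lt_top).ne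
  have hle : ∀ u v, y c = y u → u < v → y u = y v → (v : ℝ≥0∞) ≤ I := by
    intro u v hu huv hv
    refine le_iInf fun k => ?_
    split_ifs with h
    · rw [ENNReal.coe_le_coe]
      by_contra! hlt
      have := hy.mono hlt.le
      omega
    · exact le_top
  have h1 : b < residual y c ↔ ((c + b : ℝ≥0) : ℝ≥0∞) < I := by
    have : ((I - c).toNNReal : ℝ≥0∞) = I - c :=
      ENNReal.coe_toNNReal (ENNReal.sub_ne_top hItop)
    rw [residual, ← ENNReal.coe_lt_coe, this, lt_tsub_iff_left, ENNReal.coe_add]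
  rw [h1]
  constructor
  · intro h
    by_contra hne
    exact absurd (hIlt _ (lt_of_le_of_ne (hy.mono le_self_add) hne)) (not_le.2 h)
  · intro h
    obtain ⟨v, hv, hv'⟩ := hy.exists_gt_eq (c + b)
    exact (ENNReal.coe_lt_coe.2 hv).trans_le (hle _ v h hv hv'.symm)

theorem IsStandardPoisson.ae_exists_lt {Y : ℝ≥0 → Ω → ℕ} (hY : IsStandardPoisson ν Y) (c : ℝ≥0) :
    ∀ᵐ ω ∂ν, ∃ u, Y c ω < Y u ω := by
  have h1 : ∀ m : ℕ, ν {ω | ¬ ∃ u, Y c ω < Y u ω} ≤ ENNReal.ofReal (Real.exp (-(m : ℝ))) := by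
    intro m
    have h2 := hY.measure_eq (s := c) (t := c + m) le_self_add
    rw [add_tsub_cancel_left] at h2
    rw [NNReal.coe_natCast] at h2
    rw [← h2]
    refine measure_mono fun ω hω => ?_
    have hω : ∀ u, Y u ω ≤ Y c ω := by simpa using hω
    exact le_antisymm (hY.mono ω le_self_add) (hω _)
  have h3 : Tendsto (fun m : ℕ => ENNReal.ofReal (Real.exp (-(m : ℝ)))) atTop (𝓝 0) := by
    rw [← ENNReal.ofReal_zero]
    exact ENNReal.tendsto_ofReal (Real.tendsto_exp_neg_atTop_nhds_zero.comp
      tendsto_natCast_atTop_atTop)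
  exact le_antisymm (ge_of_tendsto' h3 h1) (zero_le)

/-- In real time object `i` waits `residual / p i`, and it must win against every other clock. The
comparison with `j` is multiplied by `p j`, so that it remains correct when `p j = 0` and `j` is
never requested. -/
theorem isNext_iff_residual {X : Fin n → ℝ≥0 → ℕ} {y : Fin n → ℝ≥0 → ℕ} {p : Fin n → ℝ≥0}
    (hy : ∀ i, IsCountingPath (y i)) (hX : ∀ i s, X i s = y i (p i * s)) {T : ℝ≥0}
    (hc : ∀ i, ∃ u, y i (p i * T) < y i u) (i : Fin n) :
    IsNext X T i ↔ p i ≠ 0 ∧ ∀ j, j ≠ i →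
      p j * residual (y i) (p i * T) / p i < residual (y j) (p j * T) := by
  have hkey : ∀ j b, p j * b < residual (y j) (p j * T) ↔ X j T = X j (T + b) := by
    intro j b
    rw [(hy j).lt_residual_iff (hc j), hX, hX, mul_add]
  constructor
  · rintro ⟨s, hs, h1, h2⟩
    obtain ⟨b, rfl⟩ := exists_add_of_le hs.le
    have hp : p i ≠ 0 := by
      intro h0
      simp [hX, h0] at h1
    refine ⟨hp, fun j hj => ?_⟩
    have h3 := (hkey j b).2 (h2 j hj).symm
    have h4 : residual (y i) (p i * T) ≤ p i * b := by
      by_contra! h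
      exact h1.ne ((hkey i b).1 h)
    refine lt_of_le_of_lt ?_ h3
    rw [div_le_iff₀ (pos_iff_ne_zero.2 hp)]
    calc p j * residual (y i) (p i * T) ≤ p j * (p i * b) := by gcongr
      _ = _ := by ring
  · rintro ⟨hp, h⟩
    set b := residual (y i) (p i * T) / p i with hb
    have hpb : p i * b = residual (y i) (p i * T) := mul_div_cancel₀ _ hp
    have h1 : ¬ X i T = X i (T + b) := by
      rw [← hkey, hpb]
      exact lt_irrefl _
    have h2 : X i T < X i (T + b) := by
      refine lt_of_le_of_ne ?_ h1
      rw [hX, hX]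
      exact (hy i).mono (by gcongr; exact le_self_add)
    refine ⟨T + b, ?_, h2, fun j hj => ((hkey j b).1 ?_).symm⟩
    · refine lt_of_le_of_ne le_self_add fun h => h1 ?_
      rw [← h]
    · rw [hb, ← mul_div_assoc]
      exact h j hj

end Poisson

/-! ### Exponential residual times and the race between the clocks. -/

section Poisson

variable {Ω : Type*} [MeasurableSpace Ω] {ν : Measure Ω}

theorem IsStandardPoisson.measure_lt_residual [IsProbabilityMeasure ν] {Y : ℝ≥0 → Ω → ℕ}
    (hY : IsStandardPoisson ν Y) {a c : ℝ≥0} (hac : a ≤ c) (b : ℝ≥0) :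
    ν {ω | Y a ω = Y c ω ∧ b < residual (fun s => Y s ω) c} =
      ENNReal.ofReal (Real.exp (-(c + b - a : ℝ≥0))) := by
  rw [← hY.measure_eq (hac.trans le_self_add)]
  refine measure_congr ?_
  filter_upwards [hY.ae_exists_lt c] with ω hω
  have h1 := (hY.isCountingPath ω).lt_residual_iff hω b
  refine propext ?_
  change (Y a ω = Y c ω ∧ b < residual (fun s => Y s ω) c) ↔ Y a ω = Y (c + b) ω
  rw [h1]
  have h2 : Y a ω ≤ Y c ω := hY.mono ω hac
  have h3 : Y c ω ≤ Y (c + b) ω := hY.mono ω le_self_add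
  omega

theorem measurable_residual_coe {Y : ℝ≥0 → Ω → ℕ} (hY : ∀ s, Measurable (Y s)) (c : ℝ≥0) :
    Measurable fun ω => residual (fun s => Y s ω) c := by
  have h : Measurable fun (ω : Ω) (s : ℝ≥0) => Y s ω := measurable_pi_lambda _ hY
  have h2 := (measurable_residual c).comp h
  simpa only [Function.comp_def] using h2

/-- Memorylessness: constancy on `[a, c]` together with a residual time exceeding `b` is constancy
on `[a, c + b]`, and the probability of the latter factors. -/
theorem IsStandardPoisson.map_residual [IsProbabilityMeasure ν] {Y : ℝ≥0 → Ω → ℕ}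
    (hY : IsStandardPoisson ν Y) {a c : ℝ≥0} (hac : a ≤ c) :
    (ν.restrict {ω | Y a ω = Y c ω}).map (fun ω => (residual (fun s => Y s ω) c : ℝ)) =
      ENNReal.ofReal (Real.exp (-(c - a : ℝ≥0))) • expMeasure 1 := by
  have hexp := isProbabilityMeasure_expMeasure one_pos
  have hm : Measurable fun ω => (residual (fun s => Y s ω) c : ℝ) :=
    (measurable_residual_coe hY.measurable c).coe_nnreal_real
  have hA : MeasurableSet {ω | Y a ω = Y c ω} :=
    measurableSet_eq_fun (hY.measurable a) (hY.measurable c)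
  refine Measure.ext_of_Iic _ _ fun x => ?_
  rw [Measure.map_apply hm measurableSet_Iic, Measure.restrict_apply (hm measurableSet_Iic),
    Measure.smul_apply, smul_eq_mul, ← ofReal_cdf, cdf_expMeasure_eq one_pos]
  split_ifs with hx
  · lift x to ℝ≥0 using hx
    have h1 : (fun ω => (residual (fun s => Y s ω) c : ℝ)) ⁻¹' Iic (x : ℝ) ∩ {ω | Y a ω = Y c ω} =
        {ω | Y a ω = Y c ω} \ {ω | Y a ω = Y c ω ∧ x < residual (fun s => Y s ω) c} := by
      ext ω
      simp only [mem_inter_iff, mem_preimage, mem_Iic, NNReal.coe_le_coe, mem_ofPred_eq, Set.mem_sdiff,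
        not_and, not_lt]
      tauto
    have hB' : MeasurableSet {ω | x < residual (fun s => Y s ω) c} :=
      measurableSet_lt measurable_const (measurable_residual_coe hY.measurable c)
    have hB : MeasurableSet {ω | Y a ω = Y c ω ∧ x < residual (fun s => Y s ω) c} :=
      hA.inter hB'
    have hsub : {ω | Y a ω = Y c ω ∧ x < residual (fun s => Y s ω) c} ⊆ {ω | Y a ω = Y c ω} :=
      fun ω hω => hω.1
    rw [h1, measure_sdiff hsub hB.nullMeasurableSet (measure_ne_top _ _),
      hY.measure_eq hac, hY.measure_lt_residual hac,
      ← ENNReal.ofReal_sub _ (Real.exp_nonneg _), ← ENNReal.ofReal_mul (Real.exp_nonneg _)]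
    congr 1
    rw [mul_sub, mul_one, ← Real.exp_add, tsub_add_eq_add_tsub hac |>.symm]
    push_cast
    congr 2
    ring
  · have : (fun ω => (residual (fun s => Y s ω) c : ℝ)) ⁻¹' Iic x = ∅ := by
      ext ω
      simp only [mem_preimage, mem_Iic, mem_empty_iff_false, iff_false, not_le]
      exact (not_le.1 hx).trans_le (NNReal.coe_nonneg _)
    simp [this]

/-- The exponential factor turns the density of rate 1 into `1 / (1 + κ)` times the density of rate
`1 + κ`. -/
theorem lintegral_exp_neg_mul_expMeasure (κ : ℝ≥0) :
    ∫⁻ x, ENNReal.ofReal (Real.exp (-(κ * x))) ∂(expMeasure 1) =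
      ENNReal.ofReal (1 / (1 + κ)) := by
  have h1 : expMeasure 1 = volume.withDensity (exponentialPDF 1) := rfl
  have hm : Measurable (exponentialPDF 1) := (measurable_exponentialPDFReal 1).ennreal_ofReal
  rw [h1, lintegral_withDensity_eq_lintegral_mul _ hm (by fun_prop)]
  have hκ : (0 : ℝ) < 1 + κ := by positivity
  have h2 : ∀ x, (exponentialPDF 1 * fun x => ENNReal.ofReal (Real.exp (-(κ * x)))) x =
      ENNReal.ofReal (1 / (1 + κ)) * exponentialPDF (1 + κ) x := by
    intro x
    rw [Pi.mul_apply, exponentialPDF_eq, exponentialPDF_eq]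
    split_ifs with hx
    · rw [← ENNReal.ofReal_mul (by positivity), ← ENNReal.ofReal_mul (by positivity)]
      congr 1
      rw [one_mul, ← Real.exp_add, ← mul_assoc, one_div, inv_mul_cancel₀ hκ.ne', one_mul]
      ring_nf
    · simp
  rw [lintegral_congr h2, lintegral_const_mul _ (by exact (measurable_exponentialPDFReal _).ennreal_ofReal),
    lintegral_exponentialPDF_eq_one hκ, mul_one]

theorem IsStandardPoisson.setLIntegral_exp_neg_residual [IsProbabilityMeasure ν]
    {Y : ℝ≥0 → Ω → ℕ} (hY : IsStandardPoisson ν Y) {a c : ℝ≥0} (hac : a ≤ c) (κ : ℝ≥0) :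
    ∫⁻ ω in {ω | Y a ω = Y c ω},
        ENNReal.ofReal (Real.exp (-(κ * residual (fun s => Y s ω) c))) ∂ν =
      ENNReal.ofReal (Real.exp (-(c - a : ℝ≥0)) * (1 / (1 + κ))) := by
  have hm : Measurable fun ω => (residual (fun s => Y s ω) c : ℝ) :=
    (measurable_residual_coe hY.measurable c).coe_nnreal_real
  rw [← lintegral_map (μ := ν.restrict {ω | Y a ω = Y c ω})
    (f := fun x : ℝ => ENNReal.ofReal (Real.exp (-(κ * x)))) (by fun_prop) hm,
    hY.map_residual hac, lintegral_smul_measure, lintegral_exp_neg_mul_expMeasure, smul_eq_mul,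
    ← ENNReal.ofReal_mul (Real.exp_nonneg _)]

variable [IsProbabilityMeasure ν] {n : ℕ} {Y : Fin n → ℝ≥0 → Ω → ℕ}

theorem measure_forall_lt_residual (hY : ∀ i, IsStandardPoisson ν (Y i))
    (hind : iIndepFun (fun i ω s => Y i s ω) ν) (c b : Fin n → ℝ≥0) (S : Finset (Fin n)) :
    ν {ω | ∀ j ∈ S, b j < residual (fun s => Y j s ω) (c j)} =
      ENNReal.ofReal (Real.exp (-(∑ j ∈ S, b j : ℝ≥0))) := by
  have h1 := hind.measure_inter_preimage_eq_mul S
    (sets := fun j => {y | b j < residual y (c j)})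
    fun j _ => measurableSet_lt measurable_const (measurable_residual (c j))
  have h2 : {ω | ∀ j ∈ S, b j < residual (fun s => Y j s ω) (c j)} =
      ⋂ j ∈ S, (fun ω s => Y j s ω) ⁻¹' {y | b j < residual y (c j)} := by
    ext ω
    simp
  rw [h2, h1]
  have h3 : ∀ j ∈ S, ν ((fun ω s => Y j s ω) ⁻¹' {y | b j < residual y (c j)}) =
      ENNReal.ofReal (Real.exp (-(b j))) := by
    intro j _
    have := (hY j).measure_lt_residual le_rfl (a := c j) (b j)
    rw [add_tsub_cancel_left] at this
    simpa using this
  rw [Finset.prod_congr rfl h3, ← ENNReal.ofReal_prod_of_nonneg fun _ _ => Real.exp_nonneg _,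
    ← Real.exp_sum]
  push_cast
  rw [Finset.sum_neg_distrib]

/-- Freeze the path of `i`, with residual time `R`. The other clocks all outlast it with probability
`exp (-κ R)`, where `κ` is the ratio of the sum of the other popularities to `p i`. As `R` is
exponential, integration gives `1 / (1 + κ)`, which is `p i` because the popularities sum to one. By
memorylessness, the absence of requests of `i` in `(r, T]` only contributes the factor `exp (-(p i *
(T - r)))`. -/
theorem measure_isNext_inter (hY : ∀ i, IsStandardPoisson ν (Y i))
    (hind : iIndepFun (fun i ω s => Y i s ω) ν) {p : Fin n → ℝ≥0} (hp : ∑ i, p i = 1)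
    {r T : ℝ≥0} (hr : r ≤ T) (i : Fin n) :
    ν {ω | IsNext (scaledPaths Y p ω) T i ∧ scaledPaths Y p ω i r = scaledPaths Y p ω i T} =
      ENNReal.ofReal (p i * Real.exp (-(p i * (T - r)))) := by
  have hae : ∀ᵐ ω ∂ν, IsNext (scaledPaths Y p ω) T i ↔ p i ≠ 0 ∧ ∀ j, j ≠ i →
      p j * residual (fun s => Y i s ω) (p i * T) / p i <
        residual (fun s => Y j s ω) (p j * T) := by
    have : ∀ᵐ ω ∂ν, ∀ j, ∃ u, Y j (p j * T) ω < Y j u ω :=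
      ae_all_iff.2 fun j => (hY j).ae_exists_lt (p j * T)
    filter_upwards [this] with ω hω
    exact isNext_iff_residual (fun j => (hY j).isCountingPath ω) (fun _ _ => rfl) hω i
  rcases eq_or_ne (p i) 0 with h0 | h0
  · have : ν {ω | IsNext (scaledPaths Y p ω) T i ∧
        scaledPaths Y p ω i r = scaledPaths Y p ω i T} = 0 := by
      refine measure_eq_zero_iff_ae_notMem.2 ?_
      filter_upwards [hae] with ω hω
      simp [hω, h0]
    simp [h0, this]
  · set β : ℝ≥0 → Fin n → ℝ≥0 := fun x j => p j * x / p i with hβ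
    have hr' : p i * r ≤ p i * T := by gcongr
    -- The event is written on the two disjoint blocks `{i}` and its complement, which are
    -- independent.
    set E : Set ((({i} : Finset (Fin n)) → ℝ≥0 → ℕ) × ((Finset.univ.erase i) → ℝ≥0 → ℕ)) :=
      {z | z.1 ⟨i, Finset.mem_singleton_self i⟩ (p i * r) =
          z.1 ⟨i, Finset.mem_singleton_self i⟩ (p i * T)} ∩
        ⋂ j : (Finset.univ.erase i : Finset (Fin n)),
          {z | β (residual (z.1 ⟨i, Finset.mem_singleton_self i⟩) (p i * T)) j <
            residual (z.2 j) (p j * T)} with hE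
    have hm1 : Measurable fun z : ((({i} : Finset (Fin n)) → ℝ≥0 → ℕ) ×
        ((Finset.univ.erase i) → ℝ≥0 → ℕ)) => z.1 ⟨i, Finset.mem_singleton_self i⟩ :=
      (measurable_pi_apply _).comp measurable_fst
    have hEm : MeasurableSet E := by
      refine MeasurableSet.inter (measurableSet_eq_fun ((measurable_pi_apply _).comp hm1)
        ((measurable_pi_apply _).comp hm1)) (MeasurableSet.iInter fun j => measurableSet_lt ?_ ?_)
      · exact (((measurable_residual _).comp hm1).const_mul _).div_const _
      · exact (measurable_residual _).comp ((measurable_pi_apply j).comp measurable_snd)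
    have hYm : ∀ i, Measurable fun ω s => Y i s ω := measurable_path hY
    have hfr := measure_preimage_prodMk_eq_lintegral (ν := ν)
      (W := fun ω (l : ({i} : Finset (Fin n))) s => Y l s ω)
      (V := fun ω (l : (Finset.univ.erase i : Finset (Fin n))) s => Y l s ω)
      (measurable_pi_iff.2 fun l => hYm l) (measurable_pi_iff.2 fun l => hYm l)
      (hind.indepFun_finset {i} (Finset.univ.erase i) (by simp) hYm) hEm
    have hmem : ∀ ω ω', ((fun (l : ({i} : Finset (Fin n))) s => Y l s ω,
        fun (l : (Finset.univ.erase i : Finset (Fin n))) s => Y l s ω') ∈ E) ↔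
        (Y i (p i * r) ω = Y i (p i * T) ω ∧ ∀ j ∈ Finset.univ.erase i,
          β (residual (fun s => Y i s ω) (p i * T)) j < residual (fun s => Y j s ω') (p j * T)) := by
      intro ω ω'
      simp [hE]
    simp only [hmem] at hfr
    have h1 : ν {ω | IsNext (scaledPaths Y p ω) T i ∧
        scaledPaths Y p ω i r = scaledPaths Y p ω i T} =
        ν {ω | Y i (p i * r) ω = Y i (p i * T) ω ∧ ∀ j ∈ Finset.univ.erase i,
          β (residual (fun s => Y i s ω) (p i * T)) j < residual (fun s => Y j s ω) (p j * T)} := by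
      refine measure_congr ?_
      filter_upwards [hae] with ω hω
      refine propext ?_
      change (IsNext (scaledPaths Y p ω) T i ∧ Y i (p i * r) ω = Y i (p i * T) ω) ↔
        Y i (p i * r) ω = Y i (p i * T) ω ∧ ∀ j ∈ Finset.univ.erase i,
          β (residual (fun s => Y i s ω) (p i * T)) j < residual (fun s => Y j s ω) (p j * T)
      rw [hω]
      simp only [Finset.mem_erase, Finset.mem_univ, and_true, ne_eq, h0, not_false_eq_true,
        true_and, hβ]
      tauto
    set κ : ℝ≥0 := (∑ j ∈ Finset.univ.erase i, p j) / p i with hκ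
    have hpsum : p i + ∑ j ∈ Finset.univ.erase i, p j = 1 := by
      rw [Finset.add_sum_erase _ _ (Finset.mem_univ i), hp]
    have hκ1 : (1 : ℝ) / (1 + κ) = p i := by
      have h0' : (p i : ℝ) ≠ 0 := by exact_mod_cast h0
      have h3 : (p i : ℝ) + ((∑ j ∈ Finset.univ.erase i, p j : ℝ≥0) : ℝ) = 1 := by
        exact_mod_cast hpsum
      rw [hκ, NNReal.coe_div]
      field_simp
      exact h3.symm
    have hA : MeasurableSet {ω | Y i (p i * r) ω = Y i (p i * T) ω} :=
      measurableSet_eq_fun ((hY i).measurable _) ((hY i).measurable _)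
    have h2 : ∀ ω, ν {ω' | Y i (p i * r) ω = Y i (p i * T) ω ∧ ∀ j ∈ Finset.univ.erase i,
          β (residual (fun s => Y i s ω) (p i * T)) j < residual (fun s => Y j s ω') (p j * T)} =
        {ω | Y i (p i * r) ω = Y i (p i * T) ω}.indicator (fun ω => ENNReal.ofReal
          (Real.exp (-(κ * residual (fun s => Y i s ω) (p i * T))))) ω := by
      intro ω
      by_cases hω : Y i (p i * r) ω = Y i (p i * T) ω
      · rw [indicator_of_mem (by exact hω)]
        simp only [hω, true_and]
        rw [measure_forall_lt_residual hY hind (fun j => p j * T)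
          (β (residual (fun s => Y i s ω) (p i * T))) (Finset.univ.erase i)]
        congr 3
        rw [hβ, ← NNReal.coe_mul, NNReal.coe_inj, hκ, ← Finset.sum_div, ← Finset.sum_mul]
        ring
      · rw [indicator_of_notMem (by exact hω)]
        simp [hω]
    rw [h1, hfr, lintegral_congr h2, lintegral_indicator hA,
      (hY i).setLIntegral_exp_neg_residual hr', hκ1, mul_comm, ← mul_tsub, NNReal.coe_mul,
      NNReal.coe_sub hr]

end Poisson

/-- The probability that an object of popularity `p` and initial position `j + 1` is requested
in `(r, T]`, or is among the first `k` ones of the initial order. -/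
def frontProb (p T r : ℝ≥0) (k j : ℕ) : ℝ :=
  if j < k then 1 else 1 - Real.exp (-(p * (T - r)))

/-! ### The probability of the front event and the concentration of the size of the front set, for
fixed popularities. -/

section Poisson

variable {Ω : Type*} [MeasurableSpace Ω] {ν : Measure Ω} {n : ℕ}
  {Y : Fin n → ℝ≥0 → Ω → ℕ}

theorem measurable_scaledPaths (hY : ∀ i, IsStandardPoisson ν (Y i)) (p : Fin n → ℝ≥0) (i : Fin n)
    (s : ℝ≥0) : Measurable fun ω => scaledPaths Y p ω i s :=
  (hY i).measurable _

theorem measurableSet_isNext_scaledPaths [IsProbabilityMeasure ν]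
    (hY : ∀ i, IsStandardPoisson ν (Y i)) (p : Fin n → ℝ≥0)
    (T : ℝ≥0) (i : Fin n) : MeasurableSet {ω | IsNext (scaledPaths Y p ω) T i} :=
  measurableSet_isNext (measurable_scaledPaths hY p)
    (fun ω i => (isCountingPath_scaledPaths hY p ω i).mono)
    (fun ω i => (isCountingPath_scaledPaths hY p ω i).exists_gt_eq) T i

theorem measureReal_isNext [IsProbabilityMeasure ν]
    (hY : ∀ i, IsStandardPoisson ν (Y i))
    (hind : iIndepFun (fun i ω s => Y i s ω) ν) {p : Fin n → ℝ≥0} (hp : ∑ i, p i = 1)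
    (T : ℝ≥0) (i : Fin n) : ν.real {ω | IsNext (scaledPaths Y p ω) T i} = p i := by
  have := measure_isNext_inter hY hind hp (le_refl T) i
  simp only [and_true, sub_self, mul_zero, neg_zero, Real.exp_zero, mul_one,
    ENNReal.ofReal_coe_nnreal] at this
  simp [measureReal_def, this]

theorem measureReal_isNext_inFront [IsProbabilityMeasure ν]
    (hY : ∀ i, IsStandardPoisson ν (Y i))
    (hind : iIndepFun (fun i ω s => Y i s ω) ν) {p : Fin n → ℝ≥0} (hp : ∑ i, p i = 1)
    {r T : ℝ≥0} (hr : r ≤ T) (k : ℕ) (i : Fin n) :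
    ν.real {ω | IsNext (scaledPaths Y p ω) T i ∧ InFront (scaledPaths Y p ω) T r k i} =
      p i * frontProb (p i) T r k i := by
  unfold frontProb InFront
  split_ifs with hik
  · simp only [hik, or_true, and_true]
    rw [measureReal_isNext hY hind hp, mul_one]
  · simp only [hik, or_false]
    have h1 : {ω | IsNext (scaledPaths Y p ω) T i ∧ scaledPaths Y p ω i r < scaledPaths Y p ω i T} =
        {ω | IsNext (scaledPaths Y p ω) T i} \
        {ω | IsNext (scaledPaths Y p ω) T i ∧ scaledPaths Y p ω i r = scaledPaths Y p ω i T} := by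
      ext ω
      have := (isCountingPath_scaledPaths hY p ω i).mono hr
      simp only [mem_ofPred_eq, Set.mem_sdiff, not_and]
      refine and_congr_right fun h => ⟨fun h' _ => h'.ne, fun h' => lt_of_le_of_ne this (h' h)⟩
    have hm : MeasurableSet {ω | IsNext (scaledPaths Y p ω) T i ∧
        scaledPaths Y p ω i r = scaledPaths Y p ω i T} :=
      (measurableSet_isNext_scaledPaths hY p T i).inter
        (measurableSet_eq_fun (measurable_scaledPaths hY p i r) (measurable_scaledPaths hY p i T))
    have hsub : {ω | IsNext (scaledPaths Y p ω) T i ∧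
        scaledPaths Y p ω i r = scaledPaths Y p ω i T} ⊆ {ω | IsNext (scaledPaths Y p ω) T i} :=
      fun ω hω => hω.1
    rw [h1, measureReal_sdiff hsub hm, measureReal_isNext hY hind hp,
      measureReal_def,
      measure_isNext_inter hY hind hp hr, ENNReal.toReal_ofReal (by positivity)]
    ring

theorem pairwise_disjoint_isNext (hY : ∀ i, IsStandardPoisson ν (Y i)) (p : Fin n → ℝ≥0) (T : ℝ≥0) :
    Pairwise fun i j => Disjoint {ω | IsNext (scaledPaths Y p ω) T i}
      {ω | IsNext (scaledPaths Y p ω) T j} := by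
  intro i j hij
  rw [Set.disjoint_left]
  intro ω hi hj
  exact hij (IsNext.unique (isCountingPath_scaledPaths hY p ω) hi hj)

theorem ae_exists_isNext [IsProbabilityMeasure ν]
    (hY : ∀ i, IsStandardPoisson ν (Y i))
    (hind : iIndepFun (fun i ω s => Y i s ω) ν) {p : Fin n → ℝ≥0} (hp : ∑ i, p i = 1)
    (T : ℝ≥0) : ∀ᵐ ω ∂ν, ∃ i, IsNext (scaledPaths Y p ω) T i := by
  have h1 : ν.real (⋃ i, {ω | IsNext (scaledPaths Y p ω) T i}) = 1 := by
    rw [measureReal_iUnion_fintype (pairwise_disjoint_isNext hY p T)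
      fun i => measurableSet_isNext_scaledPaths hY p T i,
      Finset.sum_congr rfl fun i _ => measureReal_isNext hY hind hp T i]
    exact_mod_cast hp
  have h2 : ν (⋃ i, {ω | IsNext (scaledPaths Y p ω) T i}) = 1 := by
    rw [measureReal_def] at h1
    rwa [ENNReal.toReal_eq_one_iff] at h1
  have h3 := (mem_ae_iff_prob_eq_one
    (MeasurableSet.iUnion fun i => measurableSet_isNext_scaledPaths hY p T i)).2 h2
  filter_upwards [h3] with ω hω
  simpa only [mem_iUnion, mem_ofPred_eq] using hω

open Classical in
-- Comparing the cost with the random size of the front set, rather than with a constant, makes the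
-- event a disjoint union over the next requested object, each piece having an explicit probability.
theorem measureReal_pathCost_le [IsProbabilityMeasure ν]
    (hY : ∀ i, IsStandardPoisson ν (Y i))
    (hind : iIndepFun (fun i ω s => Y i s ω) ν) {p : Fin n → ℝ≥0} (hp : ∑ i, p i = 1)
    {r T : ℝ≥0} (hr : r ≤ T) {k : ℕ} (hk : k = 0 ∨ r = 0) :
    ν.real {ω | pathCost (scaledPaths Y p ω) T ≤
      (Finset.univ.filter fun j => InFront (scaledPaths Y p ω) T r k j).card} =
      ∑ i, p i * frontProb (p i) T r k i := by
  have h1 : {ω | pathCost (scaledPaths Y p ω) T ≤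
      (Finset.univ.filter fun j => InFront (scaledPaths Y p ω) T r k j).card} =ᵐ[ν]
      ⋃ i, {ω | IsNext (scaledPaths Y p ω) T i ∧ InFront (scaledPaths Y p ω) T r k i} := by
    filter_upwards [ae_exists_isNext hY hind hp T] with ω hω
    obtain ⟨i, hi⟩ := hω
    have hX := isCountingPath_scaledPaths hY p ω
    refine propext ?_
    change pathCost (scaledPaths Y p ω) T ≤
      (Finset.univ.filter fun j => InFront (scaledPaths Y p ω) T r k j).card ↔ ω ∈ ⋃ i,
        {ω | IsNext (scaledPaths Y p ω) T i ∧ InFront (scaledPaths Y p ω) T r k i}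
    rw [pathCost_le_card_iff hX hr hk hi]
    simp only [mem_iUnion, mem_ofPred_eq]
    exact ⟨fun h => ⟨i, hi, h⟩, fun ⟨j, hj, h⟩ => hi.unique hX hj ▸ h⟩
  have hm : ∀ i, MeasurableSet
      {ω | IsNext (scaledPaths Y p ω) T i ∧ InFront (scaledPaths Y p ω) T r k i} := fun i =>
    (measurableSet_isNext_scaledPaths hY p T i).inter
      (measurableSet_inFront (measurable_scaledPaths hY p) T r k i)
  have hd : Pairwise fun i j => Disjoint
      {ω | IsNext (scaledPaths Y p ω) T i ∧ InFront (scaledPaths Y p ω) T r k i}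
      {ω | IsNext (scaledPaths Y p ω) T j ∧ InFront (scaledPaths Y p ω) T r k j} := fun i j hij =>
    (pairwise_disjoint_isNext hY p T hij).mono (fun ω hω => hω.1) fun ω hω => hω.1
  rw [measureReal_congr h1, measureReal_iUnion_fintype hd hm]
  exact Finset.sum_congr rfl fun i _ => measureReal_isNext_inFront hY hind hp hr k i

theorem measureReal_inFront [IsProbabilityMeasure ν]
    (hY : ∀ i, IsStandardPoisson ν (Y i)) (p : Fin n → ℝ≥0)
    {r T : ℝ≥0} (hr : r ≤ T) (k : ℕ) (i : Fin n) :
    ν.real {ω | InFront (scaledPaths Y p ω) T r k i} = frontProb (p i) T r k i := by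
  unfold frontProb InFront
  split_ifs with hik
  · simp [hik]
  · simp only [hik, or_false]
    have hr' : p i * r ≤ p i * T := by gcongr
    have h1 : {ω | scaledPaths Y p ω i r < scaledPaths Y p ω i T} =
        {ω | Y i (p i * r) ω = Y i (p i * T) ω}ᶜ := by
      ext ω
      have : Y i (p i * r) ω ≤ Y i (p i * T) ω := (hY i).mono ω hr'
      simp only [mem_ofPred_eq, mem_compl_iff, scaledPaths]
      omega
    rw [h1, probReal_compl_eq_one_sub
      (measurableSet_eq_fun ((hY i).measurable _) ((hY i).measurable _)), measureReal_def,
      (hY i).measure_eq hr', ENNReal.toReal_ofReal (Real.exp_nonneg _), ← mul_tsub, NNReal.coe_mul,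
      NNReal.coe_sub hr]

open Classical in
-- Chebyshev's inequality for a sum of `n` independent indicators, each of variance at most 1. The
-- bound does not depend on the popularities.
theorem measure_card_inFront_deviation_le [IsProbabilityMeasure ν]
    (hY : ∀ i, IsStandardPoisson ν (Y i))
    (hind : iIndepFun (fun i ω s => Y i s ω) ν) (p : Fin n → ℝ≥0)
    {r T : ℝ≥0} (hr : r ≤ T) (k : ℕ) {δ : ℝ} (hδ : 0 < δ) :
    ν {ω | δ ≤ |((Finset.univ.filter fun j => InFront (scaledPaths Y p ω) T r k j).card : ℝ) -
      ∑ i, frontProb (p i) T r k i|} ≤ ENNReal.ofReal (n / δ ^ 2) := by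
  set B : Fin n → Set (ℝ≥0 → ℕ) := fun j => {y | y (p j * r) < y (p j * T) ∨ (j : ℕ) < k} with hB
  have hBm : ∀ j, MeasurableSet (B j) := fun j =>
    (measurableSet_lt (measurable_pi_apply (p j * r)) (measurable_pi_apply (p j * T))).union
      (MeasurableSet.const ((j : ℕ) < k))
  set f : Fin n → Ω → ℝ := fun j ω => (B j).indicator (fun _ => (1 : ℝ)) fun s => Y j s ω with hf
  have hfm : ∀ j, Measurable (f j) := fun j =>
    (measurable_const.indicator (hBm j)).comp (measurable_path hY j)
  have hfb : ∀ j ω, f j ω ∈ Icc (0 : ℝ) 1 := by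
    intro j ω
    simp only [hf, indicator]
    split_ifs <;> simp
  have hfL : ∀ j, MemLp (f j) 2 ν := fun j =>
    MemLp.of_bound (hfm j).aestronglyMeasurable 1 (ae_of_all _ fun ω => by
      rw [Real.norm_eq_abs, abs_of_nonneg (hfb j ω).1]
      exact (hfb j ω).2)
  have hcard : ∀ ω, ((Finset.univ.filter fun j => InFront (scaledPaths Y p ω) T r k j).card : ℝ) =
      (∑ j, f j) ω := by
    intro ω
    rw [Finset.sum_apply, Finset.card_filter]
    push_cast
    rfl
  have hint : ∀ j, ∫ ω, f j ω ∂ν = frontProb (p j) T r k j := by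
    intro j
    rw [← measureReal_inFront hY p hr k j]
    exact integral_indicator_one (measurable_path hY j (hBm j))
  have hE : ∫ ω, (∑ j, f j) ω ∂ν = ∑ i, frontProb (p i) T r k i := by
    simp only [Finset.sum_apply]
    rw [integral_finsetSum _ fun j _ => (hfL j).integrable (by norm_num)]
    exact Finset.sum_congr rfl fun j _ => hint j
  have hindf : iIndepFun f ν :=
    hind.comp (fun j y => (B j).indicator (fun _ => (1 : ℝ)) y)
      fun j => measurable_const.indicator (hBm j)
  have hvar : Var[∑ j, f j; ν] ≤ n := by
    rw [IndepFun.variance_sum (fun j _ => hfL j) fun i _ j _ hij => hindf.indepFun hij]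
    calc ∑ j, Var[f j; ν] ≤ ∑ _j : Fin n, (1 : ℝ) := by
          refine Finset.sum_le_sum fun j _ => ?_
          refine (variance_le_sq_of_bounded (ae_of_all _ (hfb j)) (hfm j).aemeasurable).trans ?_
          norm_num
      _ = n := by simp
  have h := meas_ge_le_variance_div_sq (memLp_finsetSum' Finset.univ fun j _ => hfL j) hδ
  rw [hE] at h
  simp only [hcard]
  refine h.trans (ENNReal.ofReal_le_ofReal ?_)
  gcongr

end Poisson

/-! ### Convergence in probability along varying probability spaces -/

section ProbFilter

variable {Ω : ℕ → Type u} [∀ n, MeasurableSpace (Ω n)]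

/-- The events whose probability tends to one. Convergence in probability to a constant of a
sequence of random variables is convergence along this filter. -/
def probFilter (ν : ∀ n, Measure (Ω n)) : Filter (Σ n, Ω n) where
  sets := {U | Tendsto (fun n => ν n {ω | (⟨n, ω⟩ : Σ n, Ω n) ∉ U}) atTop (𝓝 0)}
  univ_sets := by simp
  sets_of_superset {U V} hU hUV :=
    tendsto_of_tendsto_of_tendsto_of_le_of_le tendsto_const_nhds hU (fun _ => zero_le)
      fun n => measure_mono fun ω hω h => hω (hUV h)
  inter_sets {U V} hU hV := by
    have h := Tendsto.add hU hV
    rw [add_zero] at h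
    refine tendsto_of_tendsto_of_tendsto_of_le_of_le tendsto_const_nhds h (fun _ => zero_le)
      fun n => ?_
    refine le_trans (measure_mono fun ω hω => ?_) (measure_union_le _ _)
    by_cases hU : (⟨n, ω⟩ : Σ n, Ω n) ∈ U
    · exact Or.inr fun hV => hω ⟨hU, hV⟩
    · exact Or.inl hU

variable {ν : ∀ n, Measure (Ω n)}

theorem eventually_probFilter {q : (Σ n, Ω n) → Prop} :
    (∀ᶠ z in probFilter ν, q z) ↔ Tendsto (fun n => ν n {ω | ¬ q ⟨n, ω⟩}) atTop (𝓝 0) :=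
  Iff.rfl

theorem eventually_probFilter_of_ae {q : (Σ n, Ω n) → Prop}
    (h : ∀ᶠ n in atTop, ∀ᵐ ω ∂(ν n), q ⟨n, ω⟩) : ∀ᶠ z in probFilter ν, q z := by
  rw [eventually_probFilter]
  refine tendsto_const_nhds.congr' ?_
  filter_upwards [h] with n hn
  exact (ae_iff.1 hn).symm

theorem tendsto_fst_probFilter : Tendsto (Sigma.fst : (Σ n, Ω n) → ℕ) (probFilter ν) atTop := by
  rw [tendsto_atTop]
  intro b
  refine eventually_probFilter_of_ae ?_
  filter_upwards [eventually_ge_atTop b] with n hn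
  exact ae_of_all _ fun _ => hn

theorem tendsto_probFilter_of_lintegral {f : (Σ n, Ω n) → ℝ≥0∞} {ε : ℕ → ℝ≥0∞}
    (hf : ∀ n, Measurable fun ω => f ⟨n, ω⟩)
    (h : ∀ n, ∫⁻ ω, f ⟨n, ω⟩ ∂(ν n) ≤ ε n) (hε : Tendsto ε atTop (𝓝 0)) :
    Tendsto f (probFilter ν) (𝓝 0) := by
  rw [ENNReal.tendsto_nhds_zero]
  intro δ hδ
  rcases eq_or_ne δ ⊤ with rfl | hδ'
  · simp
  rw [eventually_probFilter]
  have h1 : Tendsto (fun n => ε n / δ) atTop (𝓝 0) := by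
    have := ENNReal.Tendsto.div_const hε (b := δ) (Or.inr hδ.ne')
    rwa [ENNReal.zero_div] at this
  refine tendsto_of_tendsto_of_tendsto_of_le_of_le tendsto_const_nhds h1 (fun _ => zero_le)
    fun n => ?_
  calc ν n {ω | ¬ f ⟨n, ω⟩ ≤ δ} ≤ ν n {ω | δ ≤ f ⟨n, ω⟩} :=
        measure_mono fun ω hω => (not_le.1 hω).le
    _ ≤ (∫⁻ ω, f ⟨n, ω⟩ ∂(ν n)) / δ :=
        meas_ge_le_lintegral_div (hf n).aemeasurable hδ.ne' hδ'
    _ ≤ ε n / δ := by gcongr; exact h n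

theorem tendsto_integral_of_probFilter [∀ n, IsProbabilityMeasure (ν n)]
    {f : (Σ n, Ω n) → ℝ} (hf : ∀ n, Measurable fun ω => f ⟨n, ω⟩) {M : ℝ} (hM : ∀ z, |f z| ≤ M)
    {c : ℝ} (h : Tendsto f (probFilter ν) (𝓝 c)) :
    Tendsto (fun n => ∫ ω, f ⟨n, ω⟩ ∂(ν n)) atTop (𝓝 c) := by
  rw [Metric.tendsto_atTop']
  intro ε hε
  have hU : ∀ᶠ z in probFilter ν, |f z - c| < ε / 2 := by
    have := Metric.tendsto_nhds.1 h (ε / 2) (by positivity)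
    simpa only [Real.dist_eq] using this
  rw [eventually_probFilter] at hU
  set B : ∀ n, Set (Ω n) := fun n => {ω | ¬ |f ⟨n, ω⟩ - c| < ε / 2} with hB
  have hBm : ∀ n, MeasurableSet (B n) := fun n =>
    (measurableSet_lt ((hf n).sub_const c).abs measurable_const).compl
  have hU' : Tendsto (fun n => (ν n).real (B n) * (|M| + |c|)) atTop (𝓝 0) := by
    have h0 : Tendsto (fun n => (ν n).real (B n)) atTop (𝓝 0) :=
      (ENNReal.tendsto_toReal ENNReal.zero_ne_top).comp hU
    simpa only [zero_mul] using h0.mul_const (|M| + |c|)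
  obtain ⟨N, hN⟩ := (Metric.tendsto_atTop'.1 hU') (ε / 2) (by positivity)
  refine ⟨N, fun n hn => ?_⟩
  have h1 := hN n hn
  rw [Real.dist_eq, sub_zero] at h1
  have hint : Integrable (fun ω => f ⟨n, ω⟩) (ν n) :=
    Integrable.of_bound (hf n).aestronglyMeasurable M (ae_of_all _ fun ω => hM ⟨n, ω⟩)
  have hind : Integrable ((B n).indicator fun _ => |M| + |c|) (ν n) :=
    (integrable_const _).indicator (hBm n)
  rw [Real.dist_eq]
  calc |∫ ω, f ⟨n, ω⟩ ∂(ν n) - c| = |∫ ω, (f ⟨n, ω⟩ - c) ∂(ν n)| := by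
        rw [integral_sub hint (integrable_const c)]
        simp
    _ ≤ ∫ ω, |f ⟨n, ω⟩ - c| ∂(ν n) := abs_integral_le_integral_abs
    _ ≤ ∫ ω, (ε / 2 + (B n).indicator (fun _ => |M| + |c|) ω) ∂(ν n) := by
        refine integral_mono (hint.sub (integrable_const c)).abs
          ((integrable_const _).add hind) fun ω => ?_
        by_cases hω : ω ∈ B n
        · rw [indicator_of_mem hω]
          have h2 : |f ⟨n, ω⟩ - c| ≤ |f ⟨n, ω⟩| + |c| := abs_sub _ _
          have h3 := hM ⟨n, ω⟩
          have h4 := le_abs_self M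
          change |f ⟨n, ω⟩ - c| ≤ _
          linarith
        · rw [indicator_of_notMem hω, add_zero]
          exact (not_not.1 hω).le
    _ = ε / 2 + (ν n).real (B n) * (|M| + |c|) := by
        rw [integral_add (integrable_const _) hind, integral_indicator_const _ (hBm n)]
        simp
    _ < ε := by
        have := le_abs_self ((ν n).real (B n) * (|M| + |c|))
        linarith

/-- The law is tested against the bounded function `min 1 |g - g c|`, which vanishes at `c`;
Markov's inequality does the rest. Measurability is asked of `g ∘ X` only, since `E` carries no
σ-algebra. -/
theorem TendstoInLawConst.tendsto_probFilter [∀ n, IsProbabilityMeasure (ν n)] {E : Type*}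
    [TopologicalSpace E] {X : ∀ n, Ω n → E} {c : E} (h : TendstoInLawConst ν X c) {g : E → ℝ}
    (hg : Continuous g) (hm : ∀ n, Measurable fun ω => g (X n ω)) :
    Tendsto (fun z : Σ n, Ω n => g (X z.1 z.2)) (probFilter ν) (𝓝 (g c)) := by
  set Ψ : E →ᵇ ℝ := BoundedContinuousFunction.ofNormedAddCommGroup
    (fun e => min 1 |g e - g c|) (by fun_prop) 1 (fun e => by
      rw [Real.norm_eq_abs, abs_of_nonneg (le_min zero_le_one (abs_nonneg _))]
      exact min_le_left _ _) with hΨ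
  have hΨ0 : Ψ c = 0 := by
    change min 1 |g c - g c| = 0
    simp
  have hΨn : ∀ e, 0 ≤ Ψ e := fun e => le_min zero_le_one (abs_nonneg _)
  have hΨ1 : ∀ e, Ψ e ≤ 1 := fun e => min_le_left _ _
  have hΨm : ∀ n, Measurable fun ω => Ψ (X n ω) := fun n =>
    measurable_const.min ((hm n).sub_const _).abs
  have h1 := h Ψ
  rw [hΨ0] at h1
  have h2 : Tendsto (fun z : Σ n, Ω n => ENNReal.ofReal (Ψ (X z.1 z.2))) (probFilter ν) (𝓝 0) := by
    have hint : ∀ n, Integrable (fun ω => Ψ (X n ω)) (ν n) := fun n =>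
      Integrable.of_bound (hΨm n).aestronglyMeasurable 1 (ae_of_all _ fun ω => by
        rw [Real.norm_eq_abs, abs_of_nonneg (hΨn _)]
        exact hΨ1 _)
    have h1' := ENNReal.tendsto_ofReal h1
    rw [ENNReal.ofReal_zero] at h1'
    exact tendsto_probFilter_of_lintegral (fun n => (hΨm n).ennreal_ofReal)
      (fun n => (ofReal_integral_eq_lintegral_ofReal (hint n)
        (ae_of_all _ fun ω => hΨn _)).ge) h1'
  rw [Metric.tendsto_nhds]
  intro ε hε
  have hδ : 0 < min ε 1 := lt_min hε one_pos
  have h3 := (tendsto_order.1 h2).2 (ENNReal.ofReal (min ε 1)) (by simpa using hδ)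
  filter_upwards [h3] with z hz
  have h4 : min 1 |g (X z.1 z.2) - g c| < min ε 1 := (ENNReal.ofReal_lt_ofReal_iff hδ).1 hz
  rw [Real.dist_eq]
  rcases min_lt_iff.1 (h4.trans_le (min_le_right _ _)) with h5 | h5
  · exact absurd h5 (lt_irrefl _)
  · rw [min_eq_right h5.le] at h4
    exact h4.trans_le (min_le_left _ _)

theorem integral_empiricalMeasure {n : ℕ} (hn : n ≠ 0) (x : Fin n → ℝ≥0) (f : ℝ≥0 → ℝ) :
    ∫ y, f y ∂(empiricalMeasure x : Measure ℝ≥0) = (∑ i, f (x i)) / n := by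
  have h1 : (empiricalMeasure x : Measure ℝ≥0) = (n : ℝ≥0∞)⁻¹ • ∑ i, Measure.dirac (x i) := by
    simp [empiricalMeasure, hn]
  rw [h1, integral_smul_measure, integral_finsetSum_measure fun i _ =>
    integrable_dirac (by finiteness)]
  simp [integral_dirac, div_eq_inv_mul]

/-- The popularities, normalized so that their mean is `μ`. -/
def scaledRate {n : ℕ} (μ : ℝ≥0) (w : Fin n → ℝ≥0) (i : Fin n) : ℝ≥0 :=
  n * μ * popularity w i

theorem measurable_popularity {n : ℕ} (i : Fin n) :
    Measurable fun w : Fin n → ℝ≥0 => popularity w i := by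
  unfold popularity
  fun_prop

theorem sum_popularity {n : ℕ} {w : Fin n → ℝ≥0} (hw : ∑ i, w i ≠ 0) :
    ∑ i, popularity w i = 1 := by
  simp only [popularity]
  rw [← Finset.sum_div, div_self hw]

variable [∀ n, IsProbabilityMeasure (ν n)] {w : ∀ n, Ω n → Fin n → ℝ≥0}
  {P : ProbabilityMeasure ℝ≥0} {μ : ℝ≥0}

/-- The scaled mean is close to `μ > 0`. This discards the case in which the convention `0 / 0 = 0`
makes all popularities vanish. -/
theorem LLN.eventually_sum_ne_zero (hw : ∀ n, Measurable (w n)) (h : LLN ν w P μ) (hμ : μ ≠ 0) :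
    ∀ᶠ z in probFilter ν, ∑ i, w z.1 z.2 i ≠ 0 := by
  obtain ⟨Z, hZ, -, -, h2⟩ := h
  have h3 := h2.tendsto_probFilter (g := fun x : ℝ≥0 => (x : ℝ)) (by fun_prop) fun n => by
    have := hw n
    have := hZ n
    fun_prop
  have h4 := (tendsto_order.1 h3).1 0 (by positivity)
  filter_upwards [h4] with z hz h0
  rw [← Finset.mul_sum, h0] at hz
  simp at hz

/-- The unknown factor `Z n` cancels in the popularities: the scaled rate of `i` is `μ / m` times `Z
n * w n i`, where `m` is the empirical mean of the latter. Replacing one by the other changes the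
average of `f` by at most `K * |μ / m - 1| * m = K * |μ - m|`, which tends to 0. -/
theorem LLN.tendsto_average (hw : ∀ n, Measurable (w n)) (h : LLN ν w P μ) (hμ : μ ≠ 0)
    {f : ℝ≥0 → ℝ} {K : ℝ} (hf : ∀ x y, |f x - f y| ≤ K * |(x : ℝ) - y|) {M : ℝ}
    (hM : ∀ x, |f x| ≤ M) :
    Tendsto (fun z : Σ n, Ω n => (∑ i, f (scaledRate μ (w z.1 z.2) i)) / z.1) (probFilter ν)
      (𝓝 (∫ x, f x ∂(P : Measure ℝ≥0))) := by
  have hne := h.eventually_sum_ne_zero hw hμ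
  obtain ⟨Z, hZ, hZ0, h1, h2⟩ := h
  have hfc : Continuous f := by
    have hK : ∀ x y, |f x - f y| ≤ |K| * |(x : ℝ) - y| := fun x y =>
      (hf x y).trans (mul_le_mul_of_nonneg_right (le_abs_self K) (abs_nonneg _))
    exact (LipschitzWith.of_dist_le_mul (K := ⟨|K|, abs_nonneg K⟩) fun x y => by
      rw [Real.dist_eq, NNReal.dist_eq]
      exact hK x y).continuous
  set fb : ℝ≥0 →ᵇ ℝ := BoundedContinuousFunction.ofNormedAddCommGroup f hfc M hM with hfb
  have hg : Continuous fun Q : ProbabilityMeasure ℝ≥0 => ∫ x, f x ∂(Q : Measure ℝ≥0) :=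
    ProbabilityMeasure.continuous_integral_boundedContinuousFunction fb
  have hs : ∀ n, Measurable fun ω => (∑ i, f (Z n ω * w n ω i)) / (n : ℝ) := by
    intro n
    have := hw n
    have := hZ n
    have := hfc.measurable
    fun_prop
  have h3 := h1.tendsto_probFilter hg fun n => by
    rcases eq_or_ne n 0 with rfl | hn
    · have : (fun ω => ∫ x, f x ∂(empiricalMeasure fun i => Z 0 ω * w 0 ω i : Measure ℝ≥0)) =
          fun _ => f 0 := by
        ext ω
        simp [empiricalMeasure]
      rw [this]
      exact measurable_const
    · simp only [integral_empiricalMeasure hn]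
      exact hs n
  have h4 := h2.tendsto_probFilter (g := fun x : ℝ≥0 => (x : ℝ)) (by fun_prop) fun n => by
    have := hw n
    have := hZ n
    fun_prop
  have h5 : Tendsto (fun z : Σ n, Ω n => K * |((μ : ℝ≥0) : ℝ) -
      (((∑ i, Z z.1 z.2 * w z.1 z.2 i) / z.1 : ℝ≥0) : ℝ)|) (probFilter ν) (𝓝 0) := by
    have := ((tendsto_const_nhds (x := (μ : ℝ))).sub h4).abs.const_mul K
    simpa using this
  refine tendsto_of_tendsto_of_dist h3 (squeeze_zero' (Eventually.of_forall fun _ => dist_nonneg)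
    ?_ h5)
  have hpos : ∀ᶠ z in probFilter ν, 0 < Z z.1 z.2 :=
    eventually_probFilter_of_ae (Eventually.of_forall hZ0)
  filter_upwards [hne, hpos, tendsto_fst_probFilter.eventually (eventually_ge_atTop 1)]
    with z hz hZz hn
  obtain ⟨n, ω⟩ := z
  have hn0 : n ≠ 0 := by
    simp only at hn
    omega
  have hn' : (0 : ℝ) < n := by positivity
  simp only at hz hZz ⊢
  rw [integral_empiricalMeasure hn0, dist_comm, Real.dist_eq, ← sub_div, ← Finset.sum_sub_distrib,
    abs_div, abs_of_pos hn', div_le_iff₀ hn']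
  set m : ℝ≥0 := (∑ i, Z n ω * w n ω i) / n with hm
  have hm0 : m ≠ 0 := by
    rw [hm, ← Finset.mul_sum]
    have : (n : ℝ≥0) ≠ 0 := by exact_mod_cast hn0
    positivity
  have hx : ∀ i, scaledRate μ (w n ω) i = μ / m * (Z n ω * w n ω i) := by
    intro i
    have h6 : (n : ℝ≥0) ≠ 0 := by exact_mod_cast hn0
    rw [scaledRate, popularity, hm, ← Finset.mul_sum]
    field_simp
  have hsum : ((∑ i, Z n ω * w n ω i : ℝ≥0) : ℝ) = m * n := by
    rw [← NNReal.coe_natCast, ← NNReal.coe_mul, hm, div_mul_cancel₀]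
    exact_mod_cast hn0
  calc |∑ i, (f (scaledRate μ (w n ω) i) - f (Z n ω * w n ω i))|
      ≤ ∑ i, |f (scaledRate μ (w n ω) i) - f (Z n ω * w n ω i)| := Finset.abs_sum_le_sum_abs _ _
    _ ≤ ∑ i, K * (|(μ : ℝ) / m - 1| * (Z n ω * w n ω i : ℝ≥0)) := by
        refine Finset.sum_le_sum fun i _ => (hf _ _).trans (le_of_eq ?_)
        rw [hx, NNReal.coe_mul, NNReal.coe_div, ← sub_one_mul, abs_mul, NNReal.abs_eq]
    _ = K * |(μ : ℝ) - m| * n := by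
        rw [← Finset.mul_sum, ← Finset.mul_sum, ← NNReal.coe_sum, hsum]
        have hm' : (m : ℝ) ≠ 0 := by exact_mod_cast hm0
        have h7 : |(μ : ℝ) / m - 1| * m = |(μ : ℝ) - m| := by
          rw [← NNReal.abs_eq m, ← abs_mul, sub_mul, one_mul, NNReal.abs_eq, div_mul_cancel₀ _ hm']
        rw [← h7]
        ring

end ProbFilter

/-! ### Random request rates -/

section Scheme

/-- The request counting paths as a function of the rates and of the values of the standard Poisson
paths at the instants `instant k`. -/
def pathsOf {n : ℕ} (z : (Fin n → ℝ≥0) × (Fin n → ℕ → ℕ)) (i : Fin n) (s : ℝ≥0) : ℕ :=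
  regPath (z.2 i) (popularity z.1 i * s)

theorem measurable_pathsOf {n : ℕ} (i : Fin n) (s : ℝ≥0) :
    Measurable fun z : (Fin n → ℝ≥0) × (Fin n → ℕ → ℕ) => pathsOf z i s := by
  have h1 : Measurable fun z : (Fin n → ℝ≥0) × (Fin n → ℕ → ℕ) =>
      (z.2 i, popularity z.1 i * s) :=
    ((measurable_pi_apply i).comp measurable_snd).prodMk
      (((measurable_popularity i).comp measurable_fst).mul_const s)
  exact measurable_regPath.comp h1

theorem pathsOf_mono {n : ℕ} (z : (Fin n → ℝ≥0) × (Fin n → ℕ → ℕ)) (i : Fin n) :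
    Monotone (pathsOf z i) := fun a b hab => regPath_mono _ (by gcongr)

theorem pathsOf_exists_gt_eq {n : ℕ} (z : (Fin n → ℝ≥0) × (Fin n → ℕ → ℕ)) (i : Fin n) (s : ℝ≥0) :
    ∃ u, s < u ∧ pathsOf z i u = pathsOf z i s := by
  rcases eq_or_ne (popularity z.1 i) 0 with h | h
  · exact ⟨s + 1, by simp, by simp [pathsOf, h]⟩
  · obtain ⟨u, hu, hu'⟩ := regPath_exists_gt_eq (z.2 i) (popularity z.1 i * s)
    refine ⟨u / popularity z.1 i, ?_, ?_⟩
    · rw [lt_div_iff₀ (pos_iff_ne_zero.2 h), mul_comm]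
      exact hu
    · simp only [pathsOf, mul_div_cancel₀ _ h, hu']

variable {Ω : Type*} [MeasurableSpace Ω] {ν : Measure Ω} {n : ℕ} {w : Ω → Fin n → ℝ≥0}
  {Y : Fin n → ℝ≥0 → Ω → ℕ}

theorem pathsOf_eq_scaledPaths (hY : ∀ i, IsStandardPoisson ν (Y i)) (v : Fin n → ℝ≥0) (ω : Ω) :
    pathsOf (v, fun i k => Y i (instant k) ω) = scaledPaths Y (popularity v) ω := by
  ext i s
  simp only [pathsOf, scaledPaths, ((hY i).isCountingPath ω).regPath_eq]

theorem measurable_instantValues (h : IsRequestScheme ν w Y) :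
    Measurable fun ω (i : Fin n) (k : ℕ) => Y i (instant k) ω :=
  measurable_pi_iff.2 fun i => measurable_pi_iff.2 fun _ => (h.poisson i).measurable _

theorem IsRequestScheme.measurable_pathCost (h : IsRequestScheme ν w Y) (T : ℝ≥0) :
    Measurable fun ω => pathCost (scaledPaths Y (popularity (w ω)) ω) T := by
  have h1 := (MtF.measurable_pathCost measurable_pathsOf pathsOf_mono pathsOf_exists_gt_eq T).comp
    (h.measurable_rates.prodMk (measurable_instantValues h))
  simpa only [Function.comp_def, pathsOf_eq_scaledPaths h.poisson] using h1

variable [IsProbabilityMeasure ν]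

/-- Conditioning on the rates: they are frozen at `w ω` while the Poisson paths are drawn afresh.
Independence is used through the values at the dense instants, where `hQ` provides measurability. -/
theorem IsRequestScheme.measure_eq_lintegral (h : IsRequestScheme ν w Y)
    {Q : (Fin n → ℝ≥0) → (Fin n → ℝ≥0 → ℕ) → Prop}
    (hQ : MeasurableSet {z : (Fin n → ℝ≥0) × (Fin n → ℕ → ℕ) | Q z.1 (pathsOf z)}) :
    ν {ω | Q (w ω) (scaledPaths Y (popularity (w ω)) ω)} =
      ∫⁻ ω, ν {ω' | Q (w ω) (scaledPaths Y (popularity (w ω)) ω')} ∂ν := by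
  have hm : Measurable fun (y : Fin n → ℝ≥0 → ℕ) (i : Fin n) (k : ℕ) => y i (instant k) :=
    measurable_pi_iff.2 fun i => measurable_pi_iff.2 fun k =>
      (measurable_pi_apply (instant k)).comp (measurable_pi_apply i)
  have hind : IndepFun w (fun ω (i : Fin n) (k : ℕ) => Y i (instant k) ω) ν :=
    h.indep_rates.comp measurable_id hm
  have := measure_preimage_prodMk_eq_lintegral h.measurable_rates (measurable_instantValues h)
    hind hQ
  simpa only [mem_ofPred_eq, pathsOf_eq_scaledPaths h.poisson] using this

theorem IsRequestScheme.measurable_section (h : IsRequestScheme ν w Y)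
    {Q : (Fin n → ℝ≥0) → (Fin n → ℝ≥0 → ℕ) → Prop}
    (hQ : MeasurableSet {z : (Fin n → ℝ≥0) × (Fin n → ℕ → ℕ) | Q z.1 (pathsOf z)}) :
    Measurable fun ω => ν {ω' | Q (w ω) (scaledPaths Y (popularity (w ω)) ω')} := by
  have hV := measurable_instantValues h
  have h1 := (measurable_measure_prodMk_left
    (ν := ν.map fun ω (i : Fin n) (k : ℕ) => Y i (instant k) ω) hQ).comp h.measurable_rates
  convert h1 using 2 with ω
  rw [Function.comp_apply, Measure.map_apply hV (measurable_prodMk_left hQ)]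
  simp only [preimage_ofPred_eq, pathsOf_eq_scaledPaths h.poisson]

theorem IsRequestScheme.ae_not_clash (h : IsRequestScheme ν w Y) (T : ℝ≥0) :
    ∀ᵐ ω ∂ν, ¬ Clash (scaledPaths Y (popularity (w ω)) ω) T := by
  have h1 := h.measure_eq_lintegral (Q := fun _ X => Clash X T)
    (measurableSet_clash measurable_pathsOf T)
  rw [ae_iff]
  simp only [not_not]
  rw [h1]
  simp [measure_clash h.poisson h.indep]

theorem IsRequestScheme.randomSearchCost_ae_eq (h : IsRequestScheme ν w Y) {T : ℝ≥0}
    (hT : 0 < T) :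
    randomSearchCost w Y T =ᵐ[ν] fun ω => pathCost (scaledPaths Y (popularity (w ω)) ω) T := by
  filter_upwards [h.ae_not_clash T] with ω hω
  exact searchCost_eq_pathCost_of_not_clash (isCountingPath_scaledPaths h.poisson _ ω) hT hω

theorem IsRequestScheme.aemeasurable_randomSearchCost (h : IsRequestScheme ν w Y) {T : ℝ≥0}
    (hT : n ≠ 0 → 0 < T) : AEMeasurable (randomSearchCost w Y T) ν := by
  rcases eq_or_ne n 0 with rfl | hn
  · have : randomSearchCost w Y T = fun _ => 0 := by
      ext ω
      simp [randomSearchCost, searchCost]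
    rw [this]
    exact aemeasurable_const
  · exact (h.measurable_pathCost T).aemeasurable.congr (h.randomSearchCost_ae_eq (hT hn)).symm

end Scheme

/-! ### From fixed to random rates: the size of the front set and the probability of the front
event. -/

section Limits

variable {Ω : ℕ → Type u} [∀ n, MeasurableSpace (Ω n)] {ν : ∀ n, Measure (Ω n)}
  [∀ n, IsProbabilityMeasure (ν n)] {w : ∀ n, Ω n → Fin n → ℝ≥0}
  {Y : ∀ n, Fin n → ℝ≥0 → Ω n → ℕ} {T r : ℕ → ℝ≥0} {k : ℕ → ℕ}

open Classical in
/-- The number of objects requested in `(r, T]` or among the first `k` ones of the initial order. -/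
def frontCount {Ω : Type*} {n : ℕ} (w : Ω → Fin n → ℝ≥0) (Y : Fin n → ℝ≥0 → Ω → ℕ)
    (T r : ℝ≥0) (k : ℕ) (ω : Ω) : ℕ :=
  (Finset.univ.filter fun j => InFront (scaledPaths Y (popularity (w ω)) ω) T r k j).card

/-- The conditional Chebyshev bound `1 / (ε ^ 2 * n)` is uniform in the rates, hence survives
integration over them. -/
theorem tendsto_frontCount (h : ∀ n, IsRequestScheme (ν n) (w n) (Y n)) (hr : ∀ n, r n ≤ T n)
    {G : ℝ} (hG : Tendsto (fun z : Σ n, Ω n => (∑ i : Fin z.1,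
      frontProb (popularity (w z.1 z.2) i) (T z.1) (r z.1) (k z.1) i) / z.1) (probFilter ν) (𝓝 G)) :
    Tendsto (fun z : Σ n, Ω n =>
      (frontCount (w z.1) (Y z.1) (T z.1) (r z.1) (k z.1) z.2 : ℝ) / z.1) (probFilter ν) (𝓝 G) := by
  refine tendsto_of_tendsto_of_dist hG ?_
  rw [Metric.tendsto_nhds]
  intro ε hε
  rw [eventually_probFilter]
  have h0 : Tendsto (fun n : ℕ => ENNReal.ofReal (1 / ε ^ 2 / n)) atTop (𝓝 0) := by
    have := ENNReal.tendsto_ofReal (tendsto_const_div_atTop_nhds_zero_nat (1 / ε ^ 2))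
    rwa [ENNReal.ofReal_zero] at this
  refine tendsto_of_tendsto_of_tendsto_of_le_of_le' tendsto_const_nhds h0
    (Eventually.of_forall fun _ => zero_le) ?_
  filter_upwards [eventually_gt_atTop 0] with n hn
  have hn' : (0 : ℝ) < n := by exact_mod_cast hn
  have hm1 : Measurable fun z : (Fin n → ℝ≥0) × (Fin n → ℕ → ℕ) =>
      ∑ i, frontProb (popularity z.1 i) (T n) (r n) (k n) i := by
    refine Finset.measurable_sum _ fun i _ => ?_
    unfold frontProb
    split_ifs
    · exact measurable_const
    · have : Measurable fun z : (Fin n → ℝ≥0) × (Fin n → ℕ → ℕ) => popularity z.1 i :=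
        (measurable_popularity i).comp measurable_fst
      fun_prop
  have hm2 := measurable_card_inFront (measurable_pathsOf (n := n)) (T n) (r n) (k n)
  have h1 := (h n).measure_eq_lintegral (Q := fun v X => n * ε ≤
    |((@Finset.filter _ (fun j => InFront X (T n) (r n) (k n) j)
      (fun _ => Classical.propDecidable _) Finset.univ).card : ℝ) -
      ∑ i, frontProb (popularity v i) (T n) (r n) (k n) i|)
    (measurableSet_le measurable_const
      (((measurable_of_countable (fun m : ℕ => (m : ℝ))).comp hm2).sub hm1).abs)
  calc _ ≤ ν n {ω | n * ε ≤ |(frontCount (w n) (Y n) (T n) (r n) (k n) ω : ℝ) -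
        ∑ i, frontProb (popularity (w n ω) i) (T n) (r n) (k n) i|} := by
        refine measure_mono fun ω hω => ?_
        simp only [mem_ofPred_eq, not_lt, Real.dist_eq, sub_zero] at hω
        rw [← sub_div, abs_abs, abs_div, abs_of_pos hn', le_div_iff₀ hn', abs_sub_comm] at hω
        rw [mem_ofPred_eq, mul_comm]
        exact hω
    _ = _ := h1
    _ ≤ ∫⁻ _, ENNReal.ofReal (1 / ε ^ 2 / n) ∂(ν n) := by
        refine lintegral_mono fun ω => ?_
        refine (measure_card_inFront_deviation_le (h n).poisson (h n).indep _ (hr n) (k n)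
          (by positivity)).trans (le_of_eq ?_)
        congr 1
        field_simp
    _ = _ := by simp

/-- The conditional probability given the rates converges in probability to the constant `C` and is
bounded by 1, so its expectation converges to `C`. -/
theorem tendsto_measure_pathCost_le_frontCount (h : ∀ n, IsRequestScheme (ν n) (w n) (Y n))
    (hr : ∀ n, r n ≤ T n) (hk : ∀ n, k n = 0 ∨ r n = 0)
    (hw : ∀ᶠ z in probFilter ν, ∑ i, w z.1 z.2 i ≠ 0)
    {C : ℝ} (hC : Tendsto (fun z : Σ n, Ω n => ∑ i : Fin z.1, popularity (w z.1 z.2) i *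
      frontProb (popularity (w z.1 z.2) i) (T z.1) (r z.1) (k z.1) i) (probFilter ν) (𝓝 C)) :
    Tendsto (fun n => (ν n).real {ω | pathCost (scaledPaths (Y n) (popularity (w n ω)) ω) (T n) ≤
      frontCount (w n) (Y n) (T n) (r n) (k n) ω}) atTop (𝓝 C) := by
  have hQ : ∀ n, MeasurableSet {z : (Fin n → ℝ≥0) × (Fin n → ℕ → ℕ) | pathCost (pathsOf z) (T n) ≤
      (@Finset.filter _ (fun j => InFront (pathsOf z) (T n) (r n) (k n) j)
      (fun _ => Classical.propDecidable _) Finset.univ).card} := fun n =>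
    measurableSet_le
      (measurable_pathCost measurable_pathsOf pathsOf_mono pathsOf_exists_gt_eq (T n))
      (measurable_card_inFront measurable_pathsOf _ _ _)
  have h1 := fun n => (h n).measure_eq_lintegral (Q := fun _ X => pathCost X (T n) ≤
    (@Finset.filter _ (fun j => InFront X (T n) (r n) (k n) j)
      (fun _ => Classical.propDecidable _) Finset.univ).card) (hQ n)
  have h2 := fun n => (h n).measurable_section (Q := fun _ X => pathCost X (T n) ≤
    (@Finset.filter _ (fun j => InFront X (T n) (r n) (k n) j)
      (fun _ => Classical.propDecidable _) Finset.univ).card) (hQ n)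
  set f : (Σ n, Ω n) → ℝ := fun z => (ν z.1).real {ω' | pathCost
    (scaledPaths (Y z.1) (popularity (w z.1 z.2)) ω') (T z.1) ≤
      (@Finset.filter _ (fun j => InFront (scaledPaths (Y z.1) (popularity (w z.1 z.2)) ω') (T z.1)
        (r z.1) (k z.1) j) (fun _ => Classical.propDecidable _) Finset.univ).card} with hf
  have h3 : Tendsto f (probFilter ν) (𝓝 C) := by
    refine hC.congr' ?_
    filter_upwards [hw] with z hz
    exact (measureReal_pathCost_le (h z.1).poisson (h z.1).indep (sum_popularity hz) (hr z.1)
      (hk z.1)).symm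
  have h4 := tendsto_integral_of_probFilter (f := f) (fun n => (h2 n).ennreal_toReal) (M := 1)
    (fun z => by
      rw [abs_of_nonneg measureReal_nonneg]
      exact measureReal_le_one) h3
  refine h4.congr fun n => ?_
  rw [measureReal_def]
  have h5 : ν n {ω | pathCost (scaledPaths (Y n) (popularity (w n ω)) ω) (T n) ≤
      frontCount (w n) (Y n) (T n) (r n) (k n) ω} = _ := h1 n
  rw [h5, ← integral_toReal (h2 n).aemeasurable (ae_of_all _ fun ω => measure_lt_top _ _)]
  rfl

end Limits

/-! ### The quantile function -/

section Quantile

/-- The quantile function of `P`. -/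
def quantile (P : ProbabilityMeasure ℝ≥0) (r : ℝ) : ℝ≥0 :=
  sInf {x : ℝ≥0 | r ≤ (P : Measure ℝ≥0).real (Iic x)}

variable (P : ProbabilityMeasure ℝ≥0)

theorem cdf_map_coe (x : ℝ≥0) :
    cdf ((P : Measure ℝ≥0).map ((↑) : ℝ≥0 → ℝ)) x = (P : Measure ℝ≥0).real (Iic x) := by
  have := Measure.isProbabilityMeasure_map (μ := (P : Measure ℝ≥0)) (f := ((↑) : ℝ≥0 → ℝ))
    (by fun_prop)
  rw [cdf_eq_real, measureReal_def, Measure.map_apply (by fun_prop) measurableSet_Iic,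
    measureReal_def]
  congr 2

/-- Right-continuity of the distribution function makes the infimum defining the quantile a minimum;
`r < 1` ensures that the set is not empty. -/
theorem quantile_le_iff {r : ℝ} (hr : r ∈ Ioo (0 : ℝ) 1) (x : ℝ≥0) :
    quantile P r ≤ x ↔ r ≤ (P : Measure ℝ≥0).real (Iic x) := by
  have hP := Measure.isProbabilityMeasure_map (μ := (P : Measure ℝ≥0)) (f := ((↑) : ℝ≥0 → ℝ))
    (by fun_prop)
  have hmono : Monotone fun x => (P : Measure ℝ≥0).real (Iic x) := fun a b hab =>
    measureReal_mono (Iic_subset_Iic.2 hab)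
  constructor
  · intro h
    refine le_trans ?_ (hmono h)
    have hne : {x : ℝ≥0 | r ≤ (P : Measure ℝ≥0).real (Iic x)}.Nonempty := by
      have h1 := tendsto_cdf_atTop ((P : Measure ℝ≥0).map ((↑) : ℝ≥0 → ℝ))
      have h2 := ((tendsto_order.1 h1).1 r hr.2).and (eventually_ge_atTop 0)
      obtain ⟨y, hy, hy0⟩ := h2.exists
      lift y to ℝ≥0 using hy0
      rw [cdf_map_coe] at hy
      exact ⟨y, hy.le⟩
    set c := quantile P r with hc
    have h3 := ((cdf ((P : Measure ℝ≥0).map ((↑) : ℝ≥0 → ℝ))).right_continuous c).mono_left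
      (nhdsWithin_mono _ Ioi_subset_Ici_self)
    rw [cdf_map_coe] at h3
    refine ge_of_tendsto h3 ?_
    filter_upwards [self_mem_nhdsWithin] with y hy
    have hy0 : 0 ≤ y := c.coe_nonneg.trans (le_of_lt hy)
    lift y to ℝ≥0 using hy0
    rw [cdf_map_coe]
    obtain ⟨z, hz, hzy⟩ := exists_lt_of_csInf_lt hne (show c < y by exact_mod_cast hy)
    exact le_trans hz (hmono hzy.le)
  · intro h
    exact csInf_le (OrderBot.bddBelow _) h

theorem monotoneOn_quantile : MonotoneOn (quantile P) (Ioo 0 1) := by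
  intro a ha b hb hab
  rw [quantile_le_iff P ha]
  exact hab.trans ((quantile_le_iff P hb _).1 le_rfl)

theorem aemeasurable_quantile : AEMeasurable (quantile P) (volume.restrict (Ioo 0 1)) :=
  aemeasurable_restrict_of_monotoneOn measurableSet_Ioo (monotoneOn_quantile P)

theorem map_quantile : (volume.restrict (Ioo (0 : ℝ) 1)).map (quantile P) = P := by
  refine Measure.ext_of_Iic _ _ fun x => ?_
  rw [Measure.map_apply_of_aemeasurable (aemeasurable_quantile P) measurableSet_Iic,
    Measure.restrict_apply' measurableSet_Ioo]
  set F := (P : Measure ℝ≥0).real (Iic x) with hF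
  have h1 : quantile P ⁻¹' Iic x ∩ Ioo 0 1 = Iic F ∩ Ioo 0 1 := by
    ext r
    simp only [mem_inter_iff, mem_preimage, mem_Iic]
    exact and_congr_left fun hr => quantile_le_iff P hr x
  have hF1 : F ≤ 1 := measureReal_le_one
  have h2 : volume (Iic F ∩ Ioo 0 1) = ENNReal.ofReal F := by
    rcases hF1.eq_or_lt with h | h
    · have : Iic F ∩ Ioo 0 1 = Ioo (0 : ℝ) 1 := by
        rw [h]
        exact inter_eq_right.2 fun r hr => hr.2.le
      rw [this, h]
      simp
    · have : Iic F ∩ Ioo 0 1 = Ioc 0 F := by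
        ext r
        simp only [mem_inter_iff, mem_Iic, mem_Ioo, mem_Ioc]
        exact ⟨fun h => ⟨h.2.1, h.1⟩, fun h' => ⟨h'.2, h'.1, h'.2.trans_lt h⟩⟩
      rw [this]
      simp
  rw [h1, h2, hF, ofReal_measureReal]

theorem integral_quantile (f : ℝ≥0 → ℝ) (hf : Continuous f) :
    ∫ r in (0 : ℝ)..1, f (quantile P r) = ∫ x, f x ∂(P : Measure ℝ≥0) := by
  rw [intervalIntegral.integral_of_le zero_le_one, integral_Ioc_eq_integral_Ioo]
  conv_rhs => rw [← map_quantile P]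
  rw [integral_map (aemeasurable_quantile P) hf.aestronglyMeasurable]

theorem intervalIntegrable_quantile {f : ℝ≥0 → ℝ} (hf : Continuous f) {M : ℝ}
    (hM : ∀ x, |f x| ≤ M) {a b : ℝ} (ha : a ∈ Icc (0 : ℝ) 1) (hb : b ∈ Icc (0 : ℝ) 1) :
    IntervalIntegrable (fun r => f (quantile P r)) volume a b := by
  have h1 : IntegrableOn (fun r => f (quantile P r)) (Ioo 0 1) := by
    refine Integrable.of_bound (C := M)
      (hf.measurable.comp_aemeasurable (aemeasurable_quantile P)).aestronglyMeasurable
      (ae_of_all _ fun r => hM _)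
  have h2 : IntervalIntegrable (fun r => f (quantile P r)) volume 0 1 := by
    rw [intervalIntegrable_iff_integrableOn_Ioo_of_le zero_le_one]
    exact h1
  refine h2.mono_set ?_
  rw [uIcc_of_le zero_le_one]
  exact uIcc_subset_Icc ha hb

/-- Above `v` the quantile function is at least `c = quantile P v`, so truncation at `c` leaves
nothing there. The partial integral becomes an integral of a continuous function against `P`, a form
that passes to the limit even when `P` has an atom at `c`. -/
theorem integral_quantile_eq {f : ℝ≥0 → ℝ} (hf : Continuous f) {M : ℝ}
    (hM : ∀ x, |f x| ≤ M) {v : ℝ} (hv : v ∈ Ioo (0 : ℝ) 1) :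
    ∫ r in (0 : ℝ)..v, f (quantile P r) =
      v * f (quantile P v) +
        ∫ x, (f (min x (quantile P v)) - f (quantile P v)) ∂(P : Measure ℝ≥0) := by
  set c := quantile P v with hc
  have hg : Continuous fun x => f (min x c) - f c := by fun_prop
  have hgM : ∀ x, |f (min x c) - f c| ≤ M + M := fun x =>
    (abs_sub _ _).trans (add_le_add (hM _) (hM _))
  have hvI : v ∈ Icc (0 : ℝ) 1 := ⟨hv.1.le, hv.2.le⟩
  rw [← integral_quantile P _ hg, ← intervalIntegral.integral_add_adjacent_intervals
    (intervalIntegrable_quantile P hg hgM (left_mem_Icc.2 zero_le_one) hvI)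
    (intervalIntegrable_quantile P hg hgM hvI (right_mem_Icc.2 zero_le_one))]
  have h1 : ∫ r in v..1, (f (min (quantile P r) c) - f c) = 0 := by
    rw [intervalIntegral.integral_of_le hv.2.le, integral_Ioc_eq_integral_Ioo]
    refine setIntegral_eq_zero_of_forall_eq_zero fun r hr => ?_
    rw [min_eq_right (monotoneOn_quantile P hv ⟨hv.1.trans hr.1, hr.2⟩ hr.1.le), sub_self]
  have h2 : ∫ r in (0 : ℝ)..v, (f (min (quantile P r) c) - f c) =
      ∫ r in (0 : ℝ)..v, (f (quantile P r) - f c) := by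
    rw [intervalIntegral.integral_of_le hv.1.le, intervalIntegral.integral_of_le hv.1.le]
    refine setIntegral_congr_fun measurableSet_Ioc fun r hr => ?_
    rw [min_eq_left (monotoneOn_quantile P ⟨hr.1, hr.2.trans_lt hv.2⟩ hv hr.2)]
  rw [h1, h2, intervalIntegral.integral_sub
    (intervalIntegrable_quantile P hf hM (left_mem_Icc.2 zero_le_one) hvI)
    intervalIntegrable_const]
  simp

theorem le_measureReal_Iic_quantile {v : ℝ} (hv : v ∈ Ioo (0 : ℝ) 1) :
    v ≤ (P : Measure ℝ≥0).real (Iic (quantile P v)) :=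
  (quantile_le_iff P hv _).1 le_rfl

theorem measureReal_Iio_quantile_le {v : ℝ} (hv : v ∈ Ioo (0 : ℝ) 1) :
    (P : Measure ℝ≥0).real (Iio (quantile P v)) ≤ v := by
  set c := quantile P v with hc
  have h1 : (P : Measure ℝ≥0) (Iio c) ≤ ENNReal.ofReal v := by
    conv_lhs => rw [← map_quantile P]
    rw [Measure.map_apply_of_aemeasurable (aemeasurable_quantile P) measurableSet_Iio,
      Measure.restrict_apply' measurableSet_Ioo]
    have : quantile P ⁻¹' Iio c ∩ Ioo 0 1 ⊆ Ioc 0 v := by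
      rintro r ⟨h1, h2⟩
      refine ⟨h2.1, ?_⟩
      by_contra! h3
      exact absurd (monotoneOn_quantile P hv h2 h3.le) (not_le.2 h1)
    refine (measure_mono this).trans ?_
    simp
  exact ENNReal.toReal_le_of_le_ofReal hv.1.le h1

end Quantile

/-! ### Partial sums of sorted sequences -/

/-- The function equal to `1` on `(-∞, s - ε]` and `0` on `[s, ∞)`, affine in between. -/
def ramp (s ε : ℝ) (x : ℝ≥0) : ℝ := max 0 (min 1 ((s - x) / ε))

theorem ramp_nonneg (s ε : ℝ) (x : ℝ≥0) : 0 ≤ ramp s ε x := le_max_left _ _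

theorem ramp_le_one (s ε : ℝ) (x : ℝ≥0) : ramp s ε x ≤ 1 :=
  max_le zero_le_one (min_le_left _ _)

theorem abs_ramp_le (s ε : ℝ) (x : ℝ≥0) : |ramp s ε x| ≤ 1 := by
  rw [abs_of_nonneg (ramp_nonneg s ε x)]
  exact ramp_le_one s ε x

theorem ramp_eq_one {s ε : ℝ} (hε : 0 < ε) {x : ℝ≥0} (hx : (x : ℝ) ≤ s - ε) : ramp s ε x = 1 := by
  have : 1 ≤ (s - x) / ε := by
    rw [le_div_iff₀ hε]
    linarith
  rw [ramp, min_eq_left this, max_eq_right zero_le_one]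

theorem ramp_eq_zero {s ε : ℝ} (hε : 0 < ε) {x : ℝ≥0} (hx : s ≤ x) : ramp s ε x = 0 := by
  have : (s - x) / ε ≤ 0 := div_nonpos_of_nonpos_of_nonneg (by linarith) hε.le
  rw [ramp, max_eq_left ((min_le_right _ _).trans this)]

theorem abs_ramp_sub_ramp_le {s ε : ℝ} (hε : 0 < ε) (x y : ℝ≥0) :
    |ramp s ε x - ramp s ε y| ≤ ε⁻¹ * |(x : ℝ) - y| := by
  have h1 : ∀ a b : ℝ, |max 0 (min 1 a) - max 0 (min 1 b)| ≤ |a - b| := fun a b => by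
    refine (abs_max_sub_max_le_max _ _ _ _).trans ?_
    rw [sub_self, abs_zero, max_eq_right (abs_nonneg _)]
    refine (abs_min_sub_min_le_max _ _ _ _).trans ?_
    rw [sub_self, abs_zero, max_eq_right (abs_nonneg _)]
  refine (h1 _ _).trans (le_of_eq ?_)
  rw [← sub_div, abs_div, abs_of_pos hε, abs_sub_comm]
  ring_nf

/-- The empirical counterpart of `integral_quantile_eq`. A term with `x i` within `ε` of `c` costs
at most `K * ε`. The other terms are exact, except for those of the first `k` values that exceed `c
+ ε` and those of the later values that lie below `c - ε`; since `x` is sorted, the ramp functions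
bound the number of these. -/
theorem abs_sorted_sum_sub_le {n k : ℕ} (hk : k ≤ n) {x : Fin n → ℝ≥0} (hx : Monotone x)
    {f : ℝ≥0 → ℝ} {K M : ℝ} (hK : 0 ≤ K) (hf : ∀ x y, |f x - f y| ≤ K * |(x : ℝ) - y|)
    (hM : ∀ x, |f x| ≤ M) (c : ℝ≥0) {ε : ℝ} (hε : 0 < ε) :
    |(∑ i : Fin n, if (i : ℕ) < k then f (x i) else 0) -
      (k * f c + ∑ i, (f (min (x i) c) - f c))| ≤
      n * (K * ε) + 2 * M * (max 0 (k - ∑ i, ramp (c + ε) ε (x i)) +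
        max 0 (∑ i, ramp c ε (x i) - k)) := by
  have hM0 : 0 ≤ M := (abs_nonneg _).trans (hM c)
  have hkc : ∑ i : Fin n, (if (i : ℕ) < k then (1 : ℝ) else 0) = k := by
    rw [Finset.sum_boole, Fin.card_filter_val_lt, min_eq_right hk]
  set A : Fin n → ℝ := fun i => if (i : ℕ) < k ∧ (c : ℝ) + ε < x i then 1 else 0 with hA
  set B : Fin n → ℝ := fun i => if k ≤ (i : ℕ) ∧ (x i : ℝ) < c - ε then 1 else 0 with hB
  have hA0 : ∀ i, 0 ≤ A i := fun i => by
    simp only [hA]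
    split_ifs <;> norm_num
  have hB0 : ∀ i, 0 ≤ B i := fun i => by
    simp only [hB]
    split_ifs <;> norm_num
  have hAsum : ∑ i, A i ≤ max 0 (k - ∑ i, ramp (c + ε) ε (x i)) := by
    -- One value above `c + ε` among the first `k` forces all later values above it too, so the ramp
    -- only counts indices below `k`, and among these only unexceptional ones.
    by_cases hne : ∃ i : Fin n, (i : ℕ) < k ∧ (c : ℝ) + ε < x i
    · refine le_max_of_le_right ?_
      obtain ⟨i₀, hi₀, hx₀⟩ := hne
      rw [le_sub_iff_add_le, ← hkc, ← Finset.sum_add_distrib]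
      refine Finset.sum_le_sum fun i _ => ?_
      simp only [hA]
      by_cases hik : (i : ℕ) < k
      · by_cases hxi : (c : ℝ) + ε < x i
        · rw [if_pos ⟨hik, hxi⟩, if_pos hik, ramp_eq_zero hε hxi.le, add_zero]
        · rw [if_neg fun h => hxi h.2, if_pos hik, zero_add]
          exact ramp_le_one _ _ _
      · have h1 : x i₀ ≤ x i := hx (Fin.le_def.2 (by omega))
        have h2 : (c : ℝ) + ε ≤ x i := hx₀.le.trans (by exact_mod_cast h1)
        rw [if_neg fun h => hik h.1, if_neg hik, ramp_eq_zero hε h2, add_zero]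
    · refine le_max_of_le_left (le_of_eq (Finset.sum_eq_zero fun i _ => ?_))
      exact if_neg fun h => hne ⟨i, h⟩
  have hBsum : ∑ i, B i ≤ max 0 (∑ i, ramp c ε (x i) - k) := by
    by_cases hne : ∃ i : Fin n, k ≤ (i : ℕ) ∧ (x i : ℝ) < c - ε
    · refine le_max_of_le_right ?_
      obtain ⟨i₀, hi₀, hx₀⟩ := hne
      rw [le_sub_iff_add_le, ← hkc, ← Finset.sum_add_distrib]
      refine Finset.sum_le_sum fun i _ => ?_
      simp only [hB]
      by_cases hik : (i : ℕ) < k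
      · have h1 : x i ≤ x i₀ := hx (Fin.le_def.2 (by omega))
        have h2 : (x i : ℝ) ≤ c - ε := le_trans (by exact_mod_cast h1) hx₀.le
        rw [if_neg (by omega), if_pos hik, ramp_eq_one hε h2, zero_add]
      · by_cases hxi : (x i : ℝ) < c - ε
        · rw [if_pos ⟨not_lt.1 hik, hxi⟩, if_neg hik, ramp_eq_one hε hxi.le, add_zero]
        · rw [if_neg fun h => hxi h.2, if_neg hik, add_zero]
          exact ramp_nonneg _ _ _
    · refine le_max_of_le_left (le_of_eq (Finset.sum_eq_zero fun i _ => ?_))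
      exact if_neg fun h => hne ⟨i, h⟩
  have h2M : ∀ i, |f (x i) - f c| ≤ 2 * M := fun i => by
    have := abs_sub (f (x i)) (f c)
    have := hM (x i)
    have := hM c
    linarith
  have hterm : ∀ i : Fin n, |(if (i : ℕ) < k then f (x i) - f c else 0) -
      (f (min (x i) c) - f c)| ≤ K * ε + 2 * M * (A i + B i) := by
    intro i
    have hKε : 0 ≤ K * ε := mul_nonneg hK hε.le
    have hAB : 0 ≤ 2 * M * (A i + B i) :=
      mul_nonneg (by positivity) (add_nonneg (hA0 i) (hB0 i))
    have hclose : |(x i : ℝ) - c| ≤ ε → |f (x i) - f c| ≤ K * ε + 2 * M * (A i + B i) := fun h =>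
      ((hf _ _).trans (mul_le_mul_of_nonneg_left h hK)).trans (le_add_of_nonneg_right hAB)
    rcases le_total (x i) c with hxc | hxc
    · have hxc' : (x i : ℝ) ≤ c := by exact_mod_cast hxc
      rw [min_eq_left hxc]
      split_ifs with hik
      · simpa using add_nonneg hKε hAB
      · rw [zero_sub, abs_neg]
        by_cases hfar : (x i : ℝ) < c - ε
        · have : B i = 1 := if_pos ⟨not_lt.1 hik, hfar⟩
          rw [this]
          have := mul_nonneg hM0 (hA0 i)
          linarith [h2M i]
        · refine hclose ?_
          rw [abs_le]
          constructor <;> linarith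
    · have hxc' : (c : ℝ) ≤ x i := by exact_mod_cast hxc
      rw [min_eq_right hxc, sub_self, sub_zero]
      split_ifs with hik
      · by_cases hfar : (c : ℝ) + ε < x i
        · have : A i = 1 := if_pos ⟨hik, hfar⟩
          rw [this]
          have := mul_nonneg hM0 (hB0 i)
          linarith [h2M i]
        · refine hclose ?_
          rw [abs_le]
          constructor <;> linarith
      · simpa using add_nonneg hKε hAB
  have hsum : (∑ i : Fin n, if (i : ℕ) < k then f (x i) else 0) -
      (k * f c + ∑ i, (f (min (x i) c) - f c)) =
      ∑ i : Fin n, ((if (i : ℕ) < k then f (x i) - f c else 0) - (f (min (x i) c) - f c)) := by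
    rw [← hkc, Finset.sum_mul, sub_add_eq_sub_sub, ← Finset.sum_sub_distrib,
      ← Finset.sum_sub_distrib]
    refine Finset.sum_congr rfl fun i _ => ?_
    split_ifs <;> ring
  rw [hsum]
  refine (Finset.abs_sum_le_sum_abs _ _).trans ((Finset.sum_le_sum fun i _ => hterm i).trans ?_)
  rw [Finset.sum_add_distrib, Finset.sum_const, Finset.card_univ, Fintype.card_fin, nsmul_eq_mul,
    ← Finset.mul_sum, Finset.sum_add_distrib]
  gcongr

/-- The averages over the first `k` terms of sorted sequences with asymptotic distribution `P`. -/
theorem tendsto_sorted_average {Z : Type*} {l : Filter Z} {N k : Z → ℕ} {P : ProbabilityMeasure ℝ≥0}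
    {x : ∀ z, Fin (N z) → ℝ≥0} (hN : ∀ᶠ z in l, N z ≠ 0) (hk : ∀ z, k z ≤ N z) {v : ℝ}
    (hkv : Tendsto (fun z => (k z : ℝ) / N z) l (𝓝 v)) (hv : v ∈ Ioo (0 : ℝ) 1)
    (hx : ∀ (f : ℝ≥0 → ℝ) (K M : ℝ), (∀ x y, |f x - f y| ≤ K * |(x : ℝ) - y|) →
      (∀ x, |f x| ≤ M) → Tendsto (fun z => (∑ i, f (x z i)) / N z) l
        (𝓝 (∫ x, f x ∂(P : Measure ℝ≥0))))
    (hmono : ∀ᶠ z in l, Monotone (x z)) {f : ℝ≥0 → ℝ} {K M : ℝ} (hK : 0 ≤ K)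
    (hf : ∀ x y, |f x - f y| ≤ K * |(x : ℝ) - y|) (hM : ∀ x, |f x| ≤ M) :
    Tendsto (fun z => (∑ i : Fin (N z), if (i : ℕ) < k z then f (x z i) else 0) / N z) l
      (𝓝 (∫ r in (0 : ℝ)..v, f (quantile P r))) := by
  have hfc : Continuous f :=
    (LipschitzWith.of_dist_le_mul (K := ⟨K, hK⟩) fun x y => by
      rw [Real.dist_eq, NNReal.dist_eq]
      exact hf x y).continuous
  rw [integral_quantile_eq P hfc hM hv]
  set c := quantile P v with hc
  have hmain : Tendsto (fun z => (k z * f c + ∑ i, (f (min (x z i) c) - f c)) / N z) l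
      (𝓝 (v * f c + ∫ x, (f (min x c) - f c) ∂(P : Measure ℝ≥0))) := by
    have h1 := hx (fun x => f (min x c) - f c) K (M + M) (fun a b => by
      rw [sub_sub_sub_cancel_right]
      refine (hf _ _).trans (mul_le_mul_of_nonneg_left ?_ hK)
      push_cast
      refine (abs_min_sub_min_le_max _ _ _ _).trans ?_
      rw [sub_self, abs_zero, max_eq_left (abs_nonneg _)])
      (fun a => (abs_sub _ _).trans (add_le_add (hM _) (hM _)))
    refine ((hkv.mul_const (f c)).add h1).congr fun z => ?_
    ring
  refine tendsto_of_tendsto_of_dist hmain ?_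
  rw [Metric.tendsto_nhds]
  intro δ hδ
  obtain ⟨ε, hε, hεδ⟩ : ∃ ε > 0, K * ε < δ / 2 := by
    refine ⟨δ / (4 * (K + 1)), by positivity, ?_⟩
    rw [mul_div_assoc', div_lt_div_iff₀ (by positivity) (by positivity)]
    nlinarith
  have hramp : ∀ s, Tendsto (fun z => (∑ i, ramp s ε (x z i)) / N z) l
      (𝓝 (∫ x, ramp s ε x ∂(P : Measure ℝ≥0))) := fun s =>
    hx _ ε⁻¹ 1 (abs_ramp_sub_ramp_le hε) (abs_ramp_le s ε)
  have hrampm : ∀ s, Continuous (ramp s ε) := fun s => by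
    unfold ramp
    fun_prop
  have hrampi : ∀ s, Integrable (ramp s ε) (P : Measure ℝ≥0) := fun s =>
    Integrable.of_bound (hrampm s).aestronglyMeasurable 1 (ae_of_all _ (abs_ramp_le s ε))
  -- The two ramps enclose the quantile: one dominates the indicator of `[0, c]`, of mass at least
  -- `v`, the other is below that of `[0, c)`, of mass at most `v`. Both positive parts in the error
  -- bound therefore vanish in the limit, leaving `K * ε`.
  have hP1 : v ≤ ∫ x, ramp (c + ε) ε x ∂(P : Measure ℝ≥0) := by
    refine (le_measureReal_Iic_quantile P hv).trans ?_
    rw [← integral_indicator_one measurableSet_Iic]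
    refine integral_mono ((integrable_const 1).indicator measurableSet_Iic) (hrampi _) fun y => ?_
    by_cases hy : y ∈ Iic c
    · have h2 : (y : ℝ) ≤ c + ε - ε := by
        rw [add_sub_cancel_right]
        exact_mod_cast hy
      rw [indicator_of_mem hy, ramp_eq_one hε h2, Pi.one_apply]
    · rw [indicator_of_notMem hy]
      exact ramp_nonneg _ _ _
  have hP2 : ∫ x, ramp c ε x ∂(P : Measure ℝ≥0) ≤ v := by
    refine le_trans ?_ (measureReal_Iio_quantile_le P hv)
    rw [← integral_indicator_one measurableSet_Iio]
    refine integral_mono (hrampi _) ((integrable_const 1).indicator measurableSet_Iio) fun y => ?_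
    by_cases hy : y ∈ Iio c
    · rw [indicator_of_mem hy]
      exact ramp_le_one _ _ _
    · have h2 : (c : ℝ) ≤ y := by exact_mod_cast not_lt.1 hy
      rw [indicator_of_notMem hy, ramp_eq_zero hε h2]
  have hbound : Tendsto (fun z => K * ε + 2 * M *
      (max 0 ((k z : ℝ) / N z - (∑ i, ramp (c + ε) ε (x z i)) / N z) +
        max 0 ((∑ i, ramp c ε (x z i)) / N z - (k z : ℝ) / N z))) l (𝓝 (K * ε)) := by
    have h1 := ((tendsto_const_nhds (x := (0 : ℝ))).max (hkv.sub (hramp (c + ε)))).add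
      ((tendsto_const_nhds (x := (0 : ℝ))).max ((hramp c).sub hkv))
    rw [max_eq_left (by linarith), max_eq_left (by linarith), add_zero] at h1
    simpa using (h1.const_mul (2 * M)).const_add (K * ε)
  filter_upwards [hN, hmono, (tendsto_order.1 hbound).2 δ (by linarith)] with z hz hm hlt
  have hz' : (0 : ℝ) < N z := by positivity
  rw [Real.dist_eq, sub_zero, dist_comm, Real.dist_eq, abs_abs, ← sub_div, abs_div, abs_of_pos hz',
    div_lt_iff₀ hz']
  refine (abs_sorted_sum_sub_le (hk z) hm hK hf hM c hε).trans_lt ?_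
  refine lt_of_eq_of_lt ?_ (mul_lt_mul_of_pos_right hlt hz')
  have hmax : ∀ a b : ℝ, max 0 (a / N z - b / N z) * N z = max 0 (a - b) := fun a b => by
    rw [← sub_div, max_mul_of_nonneg _ _ hz'.le, zero_mul, div_mul_cancel₀ _ hz'.ne']
  rw [add_mul, mul_assoc (2 * M), add_mul, hmax, hmax]
  ring

/-! ### Partial averages for the three initial orders -/

section Orders

/-- The limit of the averages of `f` over the normalized popularities of the first objects, a
proportion `v` of all objects. -/
def partialLimit (P : ProbabilityMeasure ℝ≥0) (f : ℝ≥0 → ℝ) : InitialOrder → ℝ → ℝ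
  | .exchangeable, v => v * ∫ x, f x ∂(P : Measure ℝ≥0)
  | .increasing, v => ∫ r in (0 : ℝ)..v, f (quantile P r)
  | .decreasing, v => ∫ r in (1 - v)..1, f (quantile P r)

theorem scaledRate_comp {n : ℕ} (μ : ℝ≥0) (w : Fin n → ℝ≥0) (σ : Equiv.Perm (Fin n)) (i : Fin n) :
    scaledRate μ (fun i => w (σ i)) i = scaledRate μ w (σ i) := by
  simp only [scaledRate, popularity, Equiv.sum_comp σ w]

theorem measurable_scaledRate {n : ℕ} (μ : ℝ≥0) (i : Fin n) :
    Measurable fun w : Fin n → ℝ≥0 => scaledRate μ w i :=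
  (measurable_popularity i).const_mul _

theorem scaledRate_le {n : ℕ} (μ : ℝ≥0) {w : Fin n → ℝ≥0} {i j : Fin n} (h : w i ≤ w j) :
    scaledRate μ w i ≤ scaledRate μ w j := by
  unfold scaledRate popularity
  gcongr

/-- The deviation of an observable of object `i` from its average. -/
def deviation {n : ℕ} (μ : ℝ≥0) (f : ℝ≥0 → ℝ) (w : Fin n → ℝ≥0) (i : Fin n) : ℝ :=
  f (scaledRate μ w i) - (∑ l, f (scaledRate μ w l)) / n

theorem sum_deviation {n : ℕ} (hn : n ≠ 0) (μ : ℝ≥0) (f : ℝ≥0 → ℝ) (w : Fin n → ℝ≥0) :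
    ∑ i, deviation μ f w i = 0 := by
  simp only [deviation]
  rw [Finset.sum_sub_distrib, Finset.sum_const, Finset.card_univ, Fintype.card_fin, nsmul_eq_mul,
    mul_div_cancel₀ _ (by exact_mod_cast hn), sub_self]

theorem abs_deviation_le {n : ℕ} (μ : ℝ≥0) {f : ℝ≥0 → ℝ} {M : ℝ} (hM : ∀ x, |f x| ≤ M)
    (w : Fin n → ℝ≥0) (i : Fin n) : |deviation μ f w i| ≤ 2 * M := by
  have hn : (0 : ℝ) < n := by
    have := i.pos
    exact_mod_cast this
  have h1 : |(∑ l, f (scaledRate μ w l)) / n| ≤ M := by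
    rw [abs_div, abs_of_pos hn, div_le_iff₀ hn]
    refine (Finset.abs_sum_le_sum_abs _ _).trans ((Finset.sum_le_sum fun l _ => hM _).trans ?_)
    rw [Finset.sum_const, Finset.card_univ, Fintype.card_fin, nsmul_eq_mul, mul_comm]
  have h2 := abs_sub (f (scaledRate μ w i)) ((∑ l, f (scaledRate μ w l)) / n)
  have h3 := hM (scaledRate μ w i)
  unfold deviation
  linarith

theorem measurable_deviation {n : ℕ} (μ : ℝ≥0) {f : ℝ≥0 → ℝ} (hf : Measurable f) (i : Fin n) :
    Measurable fun w : Fin n → ℝ≥0 => deviation μ f w i :=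
  (hf.comp (measurable_scaledRate μ i)).sub ((Finset.measurable_sum _ fun l _ =>
    hf.comp (measurable_scaledRate μ l)).div_const _)

theorem deviation_comp {n : ℕ} (μ : ℝ≥0) (f : ℝ≥0 → ℝ) (w : Fin n → ℝ≥0)
    (σ : Equiv.Perm (Fin n)) (i : Fin n) :
    deviation μ f (fun i => w (σ i)) i = deviation μ f w (σ i) := by
  simp only [deviation, scaledRate_comp, Equiv.sum_comp σ fun l => f (scaledRate μ w l)]

/-- The deviations sum to zero, so each row of their matrix of second moments sums to zero. The
off-diagonal entries of a row are equal by exchangeability, while the diagonal one is nonnegative;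
hence the off-diagonal entries are at most 0, and only the diagonal contributes to the upper bound.
-/
theorem integral_sq_sum_deviation_le {Ω : Type*} [MeasurableSpace Ω] {ν : Measure Ω}
    [IsProbabilityMeasure ν] {n : ℕ} {w : Ω → Fin n → ℝ≥0} (hw : Measurable w)
    (h : InitialOrder.exchangeable.Holds ν w) (μ : ℝ≥0) {f : ℝ≥0 → ℝ} (hf : Measurable f) {M : ℝ}
    (hM : ∀ x, |f x| ≤ M) (S : Finset (Fin n)) :
    ∫ ω, (∑ i ∈ S, deviation μ f (w ω) i) ^ 2 ∂ν ≤ n * (2 * M) ^ 2 := by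
  have hn : ∀ _ : Fin n, n ≠ 0 := fun i => i.pos.ne'
  set a : Fin n → Ω → ℝ := fun i ω => deviation μ f (w ω) i with ha
  have ham : ∀ i, Measurable (a i) := fun i => (measurable_deviation μ hf i).comp hw
  have hab : ∀ i ω, |a i ω| ≤ 2 * M := fun i ω => abs_deviation_le μ hM (w ω) i
  have haint : ∀ i j, Integrable (fun ω => a i ω * a j ω) ν := fun i j =>
    Integrable.of_bound ((ham i).mul (ham j)).aestronglyMeasurable ((2 * M) * (2 * M))
      (ae_of_all _ fun ω => by
        rw [Real.norm_eq_abs, abs_mul]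
        exact mul_le_mul (hab i ω) (hab j ω) (abs_nonneg _) ((abs_nonneg _).trans (hab i ω)))
  have hperm : ∀ (σ : Equiv.Perm (Fin n)) i j,
      ∫ ω, a (σ i) ω * a (σ j) ω ∂ν = ∫ ω, a i ω * a j ω ∂ν := by
    intro σ i j
    have hg : Measurable fun v : Fin n → ℝ≥0 => deviation μ f v i * deviation μ f v j :=
      (measurable_deviation μ hf i).mul (measurable_deviation μ hf j)
    have hw' : Measurable fun ω i => w ω (σ i) :=
      measurable_pi_iff.2 fun i => (measurable_pi_apply _).comp hw
    have h1 := integral_map (μ := ν) hw'.aemeasurable hg.aestronglyMeasurable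
    have h2 := integral_map (μ := ν) hw.aemeasurable hg.aestronglyMeasurable
    rw [h σ, h2] at h1
    simp only [deviation_comp] at h1
    exact h1.symm
  have hrow : ∀ i, ∑ l, ∫ ω, a i ω * a l ω ∂ν = 0 := by
    intro i
    rw [← integral_finsetSum _ fun l _ => haint i l]
    simp only [← Finset.mul_sum, ha, sum_deviation (hn i), mul_zero, integral_zero]
  have hdiag : ∀ i, 0 ≤ ∫ ω, a i ω * a i ω ∂ν := fun i =>
    integral_nonneg fun ω => mul_self_nonneg _
  have hdiag' : ∀ i, ∫ ω, a i ω * a i ω ∂ν ≤ (2 * M) ^ 2 := fun i => by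
    refine (integral_mono (haint i i) (integrable_const ((2 * M) ^ 2)) fun ω => ?_).trans ?_
    · simp only
      rw [← abs_mul_abs_self, ← sq]
      exact pow_le_pow_left₀ (abs_nonneg _) (hab i ω) 2
    · simp
  have hoff : ∀ i j, i ≠ j → ∫ ω, a i ω * a j ω ∂ν ≤ 0 := by
    intro i j hij
    by_contra! hpos
    have h1 : ∀ l ∈ Finset.univ.erase i, 0 < ∫ ω, a i ω * a l ω ∂ν := by
      intro l hl
      have hli := (Finset.mem_erase.1 hl).1
      have := hperm (Equiv.swap j l) i j
      rw [Equiv.swap_apply_left, Equiv.swap_apply_of_ne_of_ne hij (Ne.symm hli)] at this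
      rwa [this]
    have h2 : 0 < ∑ l ∈ Finset.univ.erase i, ∫ ω, a i ω * a l ω ∂ν :=
      Finset.sum_pos h1 ⟨j, by simp [Ne.symm hij]⟩
    have h3 := hrow i
    rw [← Finset.add_sum_erase _ _ (Finset.mem_univ i)] at h3
    linarith [hdiag i]
  calc ∫ ω, (∑ i ∈ S, a i ω) ^ 2 ∂ν = ∑ i ∈ S, ∑ j ∈ S, ∫ ω, a i ω * a j ω ∂ν := by
        simp only [sq, Finset.sum_mul_sum]
        rw [integral_finsetSum _ fun i _ => integrable_finsetSum _ fun j _ => haint i j]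
        exact Finset.sum_congr rfl fun i _ => integral_finsetSum _ fun j _ => haint i j
    _ ≤ ∑ i ∈ S, (2 * M) ^ 2 := by
        refine Finset.sum_le_sum fun i hi => ?_
        rw [← Finset.add_sum_erase _ _ hi]
        have : ∑ j ∈ S.erase i, ∫ ω, a i ω * a j ω ∂ν ≤ 0 :=
          Finset.sum_nonpos fun j hj => hoff i j (Finset.mem_erase.1 hj).1.symm
        linarith [hdiag' i]
    _ ≤ n * (2 * M) ^ 2 := by
        rw [Finset.sum_const, nsmul_eq_mul]
        gcongr
        simpa using Finset.card_le_univ S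

theorem ceil_mul_le {v : ℝ} (hv : v ≤ 1) (n : ℕ) : ⌈v * n⌉₊ ≤ n := by
  rw [Nat.ceil_le]
  exact mul_le_of_le_one_left (Nat.cast_nonneg n) hv

theorem sum_ite_lt_add_sum_rev {n k : ℕ} (hk : k ≤ n) (g : Fin n → ℝ) :
    (∑ i : Fin n, if (i : ℕ) < k then g i else 0) +
      (∑ i : Fin n, if (i : ℕ) < n - k then g i.rev else 0) = ∑ i, g i := by
  have h1 : (∑ i : Fin n, if (i : ℕ) < n - k then g i.rev else 0) =
      ∑ i : Fin n, if (i : ℕ) < k then 0 else g i := by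
    rw [← Equiv.sum_comp Fin.revPerm]
    refine Finset.sum_congr rfl fun i _ => ?_
    rw [Fin.revPerm_apply, Fin.rev_rev, Fin.val_rev]
    by_cases hi : (i : ℕ) < k
    · rw [if_pos hi, if_neg (by omega)]
    · rw [if_neg hi, if_pos (by omega)]
  rw [h1, ← Finset.sum_add_distrib]
  refine Finset.sum_congr rfl fun i _ => ?_
  split_ifs <;> simp

variable {Ω : ℕ → Type u} [∀ n, MeasurableSpace (Ω n)] {ν : ∀ n, Measure (Ω n)}
  {w : ∀ n, Ω n → Fin n → ℝ≥0} {P : ProbabilityMeasure ℝ≥0} {μ : ℝ≥0}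

theorem tendsto_ceil_div {v : ℝ} (hv : 0 ≤ v) :
    Tendsto (fun z : Σ n, Ω n => (⌈v * z.1⌉₊ : ℝ) / z.1) (probFilter ν) (𝓝 v) :=
  (tendsto_nat_ceil_mul_div_atTop hv).comp (tendsto_natCast_atTop_atTop.comp tendsto_fst_probFilter)

variable [∀ n, IsProbabilityMeasure (ν n)]

/-- The sum over the first objects is the full average times their number, plus a sum of deviations;
divided by `n`, the latter has second moment `O(1 / n)`. -/
theorem tendsto_exchangeable_average (hw : ∀ n, Measurable (w n)) (h : LLN ν w P μ) (hμ : μ ≠ 0)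
    (ho : ∀ n, InitialOrder.exchangeable.Holds (ν n) (w n)) {f : ℝ≥0 → ℝ} {K M : ℝ} (hK : 0 ≤ K)
    (hf : ∀ x y, |f x - f y| ≤ K * |(x : ℝ) - y|) (hM : ∀ x, |f x| ≤ M) {v : ℝ}
    (hv : v ∈ Ioo (0 : ℝ) 1) :
    Tendsto (fun z : Σ n, Ω n => (∑ i : Fin z.1, if (i : ℕ) < ⌈v * z.1⌉₊ then
      f (scaledRate μ (w z.1 z.2) i) else 0) / z.1) (probFilter ν)
      (𝓝 (v * ∫ x, f x ∂(P : Measure ℝ≥0))) := by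
  have hfc : Continuous f :=
    (LipschitzWith.of_dist_le_mul (K := ⟨K, hK⟩) fun x y => by
      rw [Real.dist_eq, NNReal.dist_eq]
      exact hf x y).continuous
  have hmain := (tendsto_ceil_div (ν := ν) hv.1.le).mul (h.tendsto_average hw hμ hf hM)
  set S : ∀ n, Finset (Fin n) := fun n => Finset.univ.filter fun i => (i : ℕ) < ⌈v * n⌉₊ with hS
  have hdm : ∀ n, Measurable fun ω => (∑ i ∈ S n, deviation μ f (w n ω) i) ^ 2 := fun n =>
    (Finset.measurable_sum _ fun i _ =>
      (measurable_deviation μ hfc.measurable i).comp (hw n)).pow_const 2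
  have hdev : Tendsto (fun z : Σ n, Ω n => ENNReal.ofReal
      ((∑ i ∈ S z.1, deviation μ f (w z.1 z.2) i) ^ 2 / (z.1 : ℝ) ^ 2)) (probFilter ν) (𝓝 0) := by
    have hlim : Tendsto (fun n : ℕ => ENNReal.ofReal ((2 * M) ^ 2 / n)) atTop (𝓝 0) := by
      have := ENNReal.tendsto_ofReal (tendsto_const_div_atTop_nhds_zero_nat ((2 * M) ^ 2))
      rwa [ENNReal.ofReal_zero] at this
    refine tendsto_probFilter_of_lintegral (fun n => ((hdm n).div_const ((n : ℝ) ^ 2)).ennreal_ofReal)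
      (fun n => ?_) hlim
    have hbd : ∀ ω, |∑ i ∈ S n, deviation μ f (w n ω) i| ≤ (S n).card * (2 * M) := fun ω => by
      refine (Finset.abs_sum_le_sum_abs _ _).trans
        ((Finset.sum_le_sum fun i _ => abs_deviation_le μ hM _ i).trans ?_)
      rw [Finset.sum_const, nsmul_eq_mul]
    have hint : Integrable (fun ω => (∑ i ∈ S n, deviation μ f (w n ω) i) ^ 2 / (n : ℝ) ^ 2)
        (ν n) := by
      refine (Integrable.of_bound (hdm n).aestronglyMeasurable (((S n).card * (2 * M)) ^ 2)
        (ae_of_all _ fun ω => ?_)).div_const _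
      rw [Real.norm_eq_abs, abs_pow]
      exact pow_le_pow_left₀ (abs_nonneg _) (hbd ω) 2
    rw [← ofReal_integral_eq_lintegral_ofReal hint (ae_of_all _ fun ω => by positivity)]
    refine ENNReal.ofReal_le_ofReal ?_
    rw [integral_div]
    refine (div_le_div_of_nonneg_right (integral_sq_sum_deviation_le (hw n) (ho n) μ
      hfc.measurable hM (S n)) (by positivity)).trans (le_of_eq ?_)
    rcases eq_or_ne n 0 with rfl | hn
    · simp
    · have : (n : ℝ) ≠ 0 := by exact_mod_cast hn
      field_simp
  refine tendsto_of_tendsto_of_dist hmain ?_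
  rw [Metric.tendsto_nhds]
  intro ε hε
  have h3 := (tendsto_order.1 hdev).2 (ENNReal.ofReal (ε ^ 2)) (by simpa using by positivity)
  filter_upwards [h3, tendsto_fst_probFilter.eventually (eventually_gt_atTop 0)] with z hz hn
  have hn' : (0 : ℝ) < z.1 := by exact_mod_cast hn
  have h4 := (ENNReal.ofReal_lt_ofReal_iff (by positivity)).1 hz
  rw [← div_pow, sq_lt_sq, abs_of_pos hε] at h4
  rw [Real.dist_eq, sub_zero, dist_comm, Real.dist_eq, abs_abs]
  refine lt_of_eq_of_lt ?_ h4
  congr 1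
  have hcard : ((S z.1).card : ℝ) = ⌈v * z.1⌉₊ := by
    rw [hS]
    simp only
    rw [Fin.card_filter_val_lt, min_eq_right (ceil_mul_le hv.2.le _)]
  simp only [deviation]
  rw [Finset.sum_sub_distrib, Finset.sum_const, nsmul_eq_mul, hcard, hS]
  simp only
  rw [Finset.sum_filter]
  field_simp

/-- The decreasing order reduces to the increasing one by reversal: the first `k` objects are the
complement of the first `n - k` of the reversed list. -/
theorem LLN.tendsto_partial_average (hw : ∀ n, Measurable (w n)) (h : LLN ν w P μ) (hμ : μ ≠ 0)
    {o : InitialOrder} (ho : ∀ n, o.Holds (ν n) (w n)) {f : ℝ≥0 → ℝ} {K M : ℝ} (hK : 0 ≤ K)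
    (hf : ∀ x y, |f x - f y| ≤ K * |(x : ℝ) - y|) (hM : ∀ x, |f x| ≤ M) {v : ℝ}
    (hv : v ∈ Ioo (0 : ℝ) 1) :
    Tendsto (fun z : Σ n, Ω n => (∑ i : Fin z.1, if (i : ℕ) < ⌈v * z.1⌉₊ then
      f (scaledRate μ (w z.1 z.2) i) else 0) / z.1) (probFilter ν)
      (𝓝 (partialLimit P f o v)) := by
  have hfc : Continuous f :=
    (LipschitzWith.of_dist_le_mul (K := ⟨K, hK⟩) fun x y => by
      rw [Real.dist_eq, NNReal.dist_eq]
      exact hf x y).continuous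
  have hN : ∀ᶠ z : Σ n, Ω n in probFilter ν, z.1 ≠ 0 :=
    tendsto_fst_probFilter.eventually (eventually_ne_atTop 0)
  have havg : ∀ (f : ℝ≥0 → ℝ) (K M : ℝ), (∀ x y, |f x - f y| ≤ K * |(x : ℝ) - y|) →
      (∀ x, |f x| ≤ M) → Tendsto (fun z : Σ n, Ω n =>
        (∑ i, f (scaledRate μ (w z.1 z.2) i)) / z.1) (probFilter ν)
        (𝓝 (∫ x, f x ∂(P : Measure ℝ≥0))) := fun f K M hf hM => h.tendsto_average hw hμ hf hM
  cases o with
  | exchangeable => exact tendsto_exchangeable_average hw h hμ ho hK hf hM hv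
  | increasing =>
    refine tendsto_sorted_average (l := probFilter ν) (P := P) (N := fun z : Σ n, Ω n => z.1)
      (k := fun z => ⌈v * z.1⌉₊) (x := fun z => scaledRate μ (w z.1 z.2)) hN
      (fun z => ceil_mul_le hv.2.le z.1) (tendsto_ceil_div (ν := ν) hv.1.le) hv havg ?_ hK hf hM
    refine eventually_probFilter_of_ae (Eventually.of_forall fun n => ?_)
    filter_upwards [ho n] with ω hω i j hij
    exact scaledRate_le μ (hω hij)
  | decreasing =>
    have hv' : 1 - v ∈ Ioo (0 : ℝ) 1 := ⟨by linarith [hv.2], by linarith [hv.1]⟩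
    have hk : Tendsto (fun z : Σ n, Ω n => ((z.1 - ⌈v * z.1⌉₊ : ℕ) : ℝ) / z.1) (probFilter ν)
        (𝓝 (1 - v)) := by
      refine ((tendsto_ceil_div (ν := ν) hv.1.le).const_sub 1).congr' ?_
      filter_upwards [hN] with z hz
      have : (z.1 : ℝ) ≠ 0 := by exact_mod_cast hz
      rw [Nat.cast_sub (ceil_mul_le hv.2.le z.1)]
      field_simp
    have h1 := tendsto_sorted_average (l := probFilter ν) (N := fun z : Σ n, Ω n => z.1)
      (k := fun z => z.1 - ⌈v * z.1⌉₊) (x := fun z i => scaledRate μ (w z.1 z.2) i.rev) hN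
      (fun z : Σ n, Ω n => Nat.sub_le z.1 ⌈v * z.1⌉₊) hk hv' (P := P) (fun f K M hf hM => by
        refine (havg f K M hf hM).congr fun z => ?_
        rw [← Equiv.sum_comp Fin.revPerm]
        rfl) (by
        refine eventually_probFilter_of_ae (Eventually.of_forall fun n => ?_)
        filter_upwards [ho n] with ω hω i j hij
        exact scaledRate_le μ (hω (Fin.rev_le_rev.2 hij))) hK hf hM
    have h2 := (havg f K M hf hM).sub h1
    have h3 : ∫ x, f x ∂(P : Measure ℝ≥0) - ∫ r in (0 : ℝ)..(1 - v), f (quantile P r) =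
        partialLimit P f .decreasing v := by
      have hI : 1 - v ∈ Icc (0 : ℝ) 1 := ⟨hv'.1.le, hv'.2.le⟩
      rw [← integral_quantile P f hfc, partialLimit, ← intervalIntegral.integral_add_adjacent_intervals
        (intervalIntegrable_quantile P hfc hM (left_mem_Icc.2 zero_le_one) hI)
        (intervalIntegrable_quantile P hfc hM hI (right_mem_Icc.2 zero_le_one)), add_sub_cancel_left]
    rw [h3] at h2
    refine h2.congr fun z => ?_
    rw [← sub_div, ← sum_ite_lt_add_sum_rev (ceil_mul_le hv.2.le z.1), add_sub_cancel_right]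

end Orders

/-! ### The limiting proportions of objects and of requests in the front part of the list -/

section Partial

variable {P : ProbabilityMeasure ℝ≥0} {f : ℝ≥0 → ℝ} {M : ℝ}

theorem partialLimit_decreasing (hf : Continuous f) (hM : ∀ x, |f x| ≤ M) {v : ℝ}
    (hv : v ∈ Icc (0 : ℝ) 1) :
    partialLimit P f .decreasing v =
      ∫ x, f x ∂(P : Measure ℝ≥0) - partialLimit P f .increasing (1 - v) := by
  have hI : 1 - v ∈ Icc (0 : ℝ) 1 := ⟨by linarith [hv.2], by linarith [hv.1]⟩
  rw [← integral_quantile P f hf, partialLimit, partialLimit,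
    ← intervalIntegral.integral_add_adjacent_intervals
    (intervalIntegrable_quantile P hf hM (left_mem_Icc.2 zero_le_one) hI)
    (intervalIntegrable_quantile P hf hM hI (right_mem_Icc.2 zero_le_one)), add_sub_cancel_left]

theorem partialLimit_zero (o : InitialOrder) : partialLimit P f o 0 = 0 := by
  cases o <;> simp [partialLimit]

theorem partialLimit_one (hf : Continuous f) (o : InitialOrder) :
    partialLimit P f o 1 = ∫ x, f x ∂(P : Measure ℝ≥0) := by
  cases o <;> simp [partialLimit, integral_quantile P f hf]

theorem continuousOn_partialLimit (hf : Continuous f) (hM : ∀ x, |f x| ≤ M) (o : InitialOrder) :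
    ContinuousOn (partialLimit P f o) (Icc 0 1) := by
  have hinc : ContinuousOn (partialLimit P f .increasing) (Icc 0 1) := by
    have := intervalIntegral.continuousOn_primitive_interval'
      (intervalIntegrable_quantile P hf hM (left_mem_Icc.2 zero_le_one)
        (right_mem_Icc.2 zero_le_one)) left_mem_uIcc
    rwa [uIcc_of_le zero_le_one] at this
  cases o with
  | exchangeable => exact (continuous_id.mul continuous_const).continuousOn
  | increasing => exact hinc
  | decreasing =>
    have h1 : ContinuousOn (fun v : ℝ => ∫ x, f x ∂(P : Measure ℝ≥0) -
        partialLimit P f .increasing (1 - v)) (Icc 0 1) :=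
      continuousOn_const.sub (hinc.comp (by fun_prop) fun v hv =>
        ⟨by linarith [hv.2], by linarith [hv.1]⟩)
    exact h1.congr fun v hv => partialLimit_decreasing hf hM hv

theorem strictMonoOn_partialLimit (hf : Continuous f) (hM : ∀ x, |f x| ≤ M) (hpos : ∀ x, 0 < f x)
    (o : InitialOrder) : StrictMonoOn (partialLimit P f o) (Icc 0 1) := by
  have hinc : StrictMonoOn (partialLimit P f .increasing) (Icc 0 1) := by
    intro a ha b hb hab
    have h0 : (0 : ℝ) ∈ Icc (0 : ℝ) 1 := left_mem_Icc.2 zero_le_one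
    have h1 := intervalIntegral.integral_add_adjacent_intervals
      (intervalIntegrable_quantile P hf hM h0 ha) (intervalIntegrable_quantile P hf hM ha hb)
    have h2 := intervalIntegral.intervalIntegral_pos_of_pos
      (intervalIntegrable_quantile P hf hM ha hb) (fun _ => hpos _) hab
    simp only [partialLimit]
    linarith
  cases o with
  | exchangeable =>
    have h1 : 0 < ∫ x, f x ∂(P : Measure ℝ≥0) := by
      have := hinc (left_mem_Icc.2 zero_le_one) (right_mem_Icc.2 zero_le_one) zero_lt_one
      rwa [partialLimit_zero, partialLimit_one hf] at this
    exact fun a _ b _ hab => mul_lt_mul_of_pos_right hab h1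
  | increasing => exact hinc
  | decreasing =>
    intro a ha b hb hab
    rw [partialLimit_decreasing hf hM ha, partialLimit_decreasing hf hM hb]
    have := hinc (a := 1 - b) ⟨by linarith [hb.2], by linarith [hb.1]⟩ (b := 1 - a)
      ⟨by linarith [ha.2], by linarith [ha.1]⟩ (by linarith)
    linarith

theorem monotoneOn_partialLimit (hf : Continuous f) (hM : ∀ x, |f x| ≤ M) (hpos : ∀ x, 0 ≤ f x)
    (o : InitialOrder) : MonotoneOn (partialLimit P f o) (Icc 0 1) := by
  have hinc : MonotoneOn (partialLimit P f .increasing) (Icc 0 1) := by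
    intro a ha b hb hab
    have h0 : (0 : ℝ) ∈ Icc (0 : ℝ) 1 := left_mem_Icc.2 zero_le_one
    have h1 := intervalIntegral.integral_add_adjacent_intervals
      (intervalIntegrable_quantile P hf hM h0 ha) (intervalIntegrable_quantile P hf hM ha hb)
    have h2 := intervalIntegral.integral_nonneg (μ := volume) hab fun r _ => hpos (quantile P r)
    simp only [partialLimit]
    linarith
  cases o with
  | exchangeable => exact fun a _ b _ hab => mul_le_mul_of_nonneg_right hab (integral_nonneg hpos)
  | increasing => exact hinc
  | decreasing =>
    intro a ha b hb hab
    rw [partialLimit_decreasing hf hM ha, partialLimit_decreasing hf hM hb]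
    have := hinc (a := 1 - b) ⟨by linarith [hb.2], by linarith [hb.1]⟩ (b := 1 - a)
      ⟨by linarith [ha.2], by linarith [ha.1]⟩ (by linarith)
    linarith

/-- Chebyshev's inequality for the monotone quantile function. -/
theorem partialLimit_increasing_mul_le {g : ℝ≥0 → ℝ} (hf : Continuous f) (hM : ∀ x, |f x| ≤ M)
    (hpos : ∀ x, 0 ≤ f x) (hg : Monotone g) (hgf : Continuous fun x => g x * f x) {M' : ℝ}
    (hM' : ∀ x, |g x * f x| ≤ M') {v : ℝ} (hv : v ∈ Icc (0 : ℝ) 1) :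
    partialLimit P (fun x => g x * f x) .increasing v * ∫ x, f x ∂(P : Measure ℝ≥0) ≤
      partialLimit P f .increasing v * ∫ x, g x * f x ∂(P : Measure ℝ≥0) := by
  have h0 : (0 : ℝ) ∈ Icc (0 : ℝ) 1 := left_mem_Icc.2 zero_le_one
  have h1 : (1 : ℝ) ∈ Icc (0 : ℝ) 1 := right_mem_Icc.2 zero_le_one
  rcases hv.1.eq_or_lt with rfl | hv0
  · simp [partialLimit_zero]
  rcases hv.2.eq_or_lt with rfl | hv1
  · rw [partialLimit_one hf, partialLimit_one hgf, mul_comm]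
  have hI := fun {a b : ℝ} => intervalIntegrable_quantile P hf hM (a := a) (b := b)
  have hI' := fun {a b : ℝ} => intervalIntegrable_quantile P hgf hM' (a := a) (b := b)
  set c := g (quantile P v) with hc
  have hle : partialLimit P (fun x => g x * f x) .increasing v ≤
      c * partialLimit P f .increasing v := by
    simp only [partialLimit]
    rw [← intervalIntegral.integral_const_mul]
    refine intervalIntegral.integral_mono_on_of_le_Ioo hv.1 (hI' h0 hv) ((hI h0 hv).const_mul c)
      fun r hr => ?_
    exact mul_le_mul_of_nonneg_right (hg (monotoneOn_quantile P ⟨hr.1, hr.2.trans hv1⟩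
      ⟨hv0, hv1⟩ hr.2.le)) (hpos _)
  have hge : c * (∫ r in v..1, f (quantile P r)) ≤
      ∫ r in v..1, g (quantile P r) * f (quantile P r) := by
    rw [← intervalIntegral.integral_const_mul]
    refine intervalIntegral.integral_mono_on_of_le_Ioo hv.2 ((hI hv h1).const_mul c) (hI' hv h1)
      fun r hr => ?_
    exact mul_le_mul_of_nonneg_right (hg (monotoneOn_quantile P ⟨hv0, hv1⟩
      ⟨hv0.trans hr.1, hr.2⟩ hr.1.le)) (hpos _)
  have hA := intervalIntegral.integral_add_adjacent_intervals (hI h0 hv) (hI hv h1)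
  have hB := intervalIntegral.integral_add_adjacent_intervals (hI' h0 hv) (hI' hv h1)
  have hA0 : 0 ≤ ∫ r in (0 : ℝ)..v, f (quantile P r) :=
    intervalIntegral.integral_nonneg hv.1 fun r _ => hpos _
  have hA1 : 0 ≤ ∫ r in v..1, f (quantile P r) :=
    intervalIntegral.integral_nonneg hv.2 fun r _ => hpos _
  rw [← integral_quantile P f hf, ← integral_quantile P _ hgf, ← hA, ← hB]
  simp only [partialLimit] at hle ⊢
  -- Let `A`, `A'` be the integrals of `f` below and above `v`, and `B`, `B'` those of `g * f`. Then
  -- `B ≤ c * A` and `c * A' ≤ B'`, so `B * A' ≤ c * A * A' ≤ A * B'`; adding `A * B` gives the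
  -- claim.
  nlinarith [mul_le_mul_of_nonneg_right hle hA1, mul_le_mul_of_nonneg_left hge hA0]

end Partial

/-- The observable `g`, damped exponentially at rate `u`. -/
def damped (g : ℝ≥0 → ℝ) (u : ℝ) (x : ℝ≥0) : ℝ := g x * Real.exp (-(u * x))

/-- A continuous probability density whose damped versions are bounded and Lipschitz. -/
structure IsWeight (P : ProbabilityMeasure ℝ≥0) (g : ℝ≥0 → ℝ) : Prop where
  continuous : Continuous g
  nonneg : ∀ x, 0 ≤ g x
  integrable : Integrable g (P : Measure ℝ≥0)
  integral_eq_one : ∫ x, g x ∂(P : Measure ℝ≥0) = 1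
  lipschitz : ∀ u > 0, ∃ K, 0 ≤ K ∧ ∀ x y, |damped g u x - damped g u y| ≤ K * |(x : ℝ) - y|
  bounded : ∀ u > 0, ∃ M, ∀ x, |damped g u x| ≤ M

theorem damped_one (u : ℝ) (x : ℝ≥0) : damped (fun _ => 1) u x = Real.exp (-(u * x)) := by
  simp [damped]

theorem isWeight_one (P : ProbabilityMeasure ℝ≥0) : IsWeight P fun _ => 1 where
  continuous := continuous_const
  nonneg _ := zero_le_one
  integrable := integrable_const 1
  integral_eq_one := by simp
  lipschitz u hu := by
    refine ⟨u, hu.le, fun x y => ?_⟩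
    rw [damped_one, damped_one]
    have h := (convex_Ici (0 : ℝ)).norm_image_sub_le_of_norm_hasDerivWithin_le
      (f := fun x => Real.exp (-(u * x))) (f' := fun x => Real.exp (-(u * x)) * (-(u * 1))) (C := u)
      (fun x _ => (((hasDerivAt_id x).const_mul u).neg.exp).hasDerivWithinAt)
      (fun x hx => by
        rw [norm_mul, Real.norm_eq_abs, Real.norm_eq_abs, abs_neg, mul_one, abs_of_pos hu,
          abs_of_pos (Real.exp_pos _)]
        refine mul_le_of_le_one_left hu.le (Real.exp_le_one_iff.2 ?_)
        have := mul_nonneg hu.le (mem_Ici.1 hx)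
        linarith) (mem_Ici.2 y.coe_nonneg) (mem_Ici.2 x.coe_nonneg)
    exact h
  bounded u hu := by
    refine ⟨1, fun x => ?_⟩
    rw [damped_one, abs_of_pos (Real.exp_pos _)]
    refine Real.exp_le_one_iff.2 ?_
    have := mul_nonneg hu.le x.coe_nonneg
    linarith

theorem isWeight_div {P : ProbabilityMeasure ℝ≥0} {μ : ℝ≥0}
    (hP : ∫⁻ x : ℝ≥0, (x : ℝ≥0∞) ∂(P : Measure ℝ≥0) = μ) (hμ : μ ≠ 0) :
    IsWeight P fun x => (x : ℝ) / μ where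
  continuous := by fun_prop
  nonneg _ := by positivity
  integrable := by
    refine Integrable.div_const ⟨by fun_prop, ?_⟩ _
    rw [hasFiniteIntegral_iff_enorm]
    simp only [Real.enorm_eq_ofReal (NNReal.coe_nonneg _), ENNReal.ofReal_coe_nnreal, hP]
    exact ENNReal.coe_lt_top
  integral_eq_one := by
    rw [integral_div, integral_eq_lintegral_of_nonneg_ae (ae_of_all _ fun x => x.coe_nonneg)
      (by fun_prop)]
    simp only [ENNReal.ofReal_coe_nnreal, hP, ENNReal.coe_toReal]
    exact div_self (by exact_mod_cast hμ)
  lipschitz u hu := by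
    have hμ' : (0 : ℝ) < μ := by positivity
    refine ⟨1 / μ, by positivity, fun x y => ?_⟩
    have h := (convex_Ici (0 : ℝ)).norm_image_sub_le_of_norm_hasDerivWithin_le
      (f := fun x => x * Real.exp (-(u * x)))
      (f' := fun x => 1 * Real.exp (-(u * x)) + x * (Real.exp (-(u * x)) * (-(u * 1)))) (C := 1)
      (fun x _ => ((hasDerivAt_id x).mul
        ((hasDerivAt_id x).const_mul u).neg.exp).hasDerivWithinAt)
      (fun x hx => by
        -- The derivative is `(1 - u * x) * exp (-(u * x))`, and `|1 - u * x| ≤ 1 + u * x ≤ exp (u *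
        -- x)`.
        have h0 := mul_nonneg hu.le (mem_Ici.1 hx)
        have h1 := Real.add_one_le_exp (u * x)
        have h2 : Real.exp (-(u * x)) * Real.exp (u * x) = 1 := by
          rw [← Real.exp_add]
          simp
        have h3 := Real.exp_pos (-(u * x))
        rw [Real.norm_eq_abs, abs_le]
        constructor <;> nlinarith) (mem_Ici.2 y.coe_nonneg) (mem_Ici.2 x.coe_nonneg)
    have h2 : damped (fun x : ℝ≥0 => (x : ℝ) / μ) u x - damped (fun x : ℝ≥0 => (x : ℝ) / μ) u y =
        (x * Real.exp (-(u * x)) - y * Real.exp (-(u * y))) / μ := by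
      simp only [damped]
      ring
    rw [h2, abs_div, abs_of_pos hμ', one_div, inv_mul_eq_div]
    rw [one_mul] at h
    exact div_le_div_of_nonneg_right h hμ'.le
  bounded u hu := by
    refine ⟨1 / u / μ, fun x => ?_⟩
    -- From `u * x ≤ exp (u * x)` one gets `x * exp (-(u * x)) ≤ 1 / u`.
    have h1 := Real.add_one_le_exp (u * x)
    have h2 : Real.exp (-(u * x)) * Real.exp (u * x) = 1 := by
      rw [← Real.exp_add]
      simp
    have h3 := Real.exp_pos (-(u * x))
    simp only [damped]
    rw [abs_of_nonneg (by positivity), div_mul_eq_mul_div]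
    refine div_le_div_of_nonneg_right ?_ μ.coe_nonneg
    rw [le_div_iff₀ hu]
    nlinarith

/-! ### The limiting profiles as functions of the time span. -/

section Profile

variable {P : ProbabilityMeasure ℝ≥0} {g : ℝ≥0 → ℝ}

theorem IsWeight.continuous_damped (hg : IsWeight P g) (u : ℝ) : Continuous (damped g u) := by
  have := hg.continuous
  unfold damped
  fun_prop

theorem IsWeight.damped_nonneg (hg : IsWeight P g) (u : ℝ) (x : ℝ≥0) : 0 ≤ damped g u x :=
  mul_nonneg (hg.nonneg x) (Real.exp_pos _).le

theorem IsWeight.damped_le (hg : IsWeight P g) {u : ℝ} (hu : 0 ≤ u) (x : ℝ≥0) :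
    damped g u x ≤ g x := by
  refine mul_le_of_le_one_right (hg.nonneg x) (Real.exp_le_one_iff.2 ?_)
  have := mul_nonneg hu x.coe_nonneg
  linarith

theorem IsWeight.integrable_damped (hg : IsWeight P g) {u : ℝ} (hu : 0 ≤ u) :
    Integrable (damped g u) (P : Measure ℝ≥0) :=
  hg.integrable.mono' (hg.continuous_damped u).aestronglyMeasurable (ae_of_all _ fun x => by
    rw [Real.norm_eq_abs, abs_of_nonneg (hg.damped_nonneg u x)]
    exact hg.damped_le hu x)

/-- The limiting proportion, with respect to the density `g`, of the objects that have been
requested during the last time span of length `τ` (if `τ ≤ t`), respectively that have been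
requested at all or that are initially among the first `τ - t` (if `t ≤ τ ≤ t + 1`). -/
def profile (P : ProbabilityMeasure ℝ≥0) (o : InitialOrder) (t : ℝ≥0) (g : ℝ≥0 → ℝ) (τ : ℝ) : ℝ :=
  1 - ∫ x, damped g (max 0 (min τ t)) x ∂(P : Measure ℝ≥0) +
    partialLimit P (damped g t) o (max 0 (min (τ - t) 1))

theorem max_min_mem_Icc (s : ℝ) : max 0 (min s 1) ∈ Icc (0 : ℝ) 1 :=
  ⟨le_max_left _ _, max_le zero_le_one (min_le_right _ _)⟩

variable (o : InitialOrder) {t : ℝ≥0}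

theorem profile_of_le {τ : ℝ} (h0 : 0 ≤ τ) (h : τ ≤ t) :
    profile P o t g τ = 1 - ∫ x, damped g τ x ∂(P : Measure ℝ≥0) := by
  rw [profile, min_eq_left h, max_eq_right h0, max_eq_left ((min_le_left _ _).trans (by linarith)),
    partialLimit_zero, add_zero]

theorem profile_of_ge {τ : ℝ} (h : t ≤ τ) (h1 : τ ≤ t + 1) :
    profile P o t g τ = 1 - ∫ x, damped g t x ∂(P : Measure ℝ≥0) +
      partialLimit P (damped g t) o (τ - t) := by
  rw [profile, min_eq_right h, max_eq_right t.coe_nonneg, min_eq_left (by linarith),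
    max_eq_right (by linarith)]

theorem IsWeight.profile_of_nonpos (hg : IsWeight P g) {τ : ℝ} (h : τ ≤ 0) :
    profile P o t g τ = 0 := by
  rw [profile, max_eq_left ((min_le_left _ _).trans h), max_eq_left ((min_le_left _ _).trans
    (by linarith [t.coe_nonneg])), partialLimit_zero]
  simp [damped, hg.integral_eq_one]

theorem IsWeight.profile_of_ge_add_one (hg : IsWeight P g) {τ : ℝ} (h : t + 1 ≤ τ) :
    profile P o t g τ = 1 := by
  rw [profile, min_eq_right (by linarith), max_eq_right t.coe_nonneg, min_eq_right (by linarith),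
    max_eq_right zero_le_one, partialLimit_one (hg.continuous_damped _)]
  ring

theorem IsWeight.continuous_profile (hg : IsWeight P g) (ht : 0 < t) :
    Continuous (profile P o t g) := by
  obtain ⟨M, hM⟩ := hg.bounded t ht
  unfold profile
  refine (continuous_const.sub ?_).add ?_
  · refine continuous_of_dominated (bound := g)
      (fun τ => (hg.continuous_damped _).aestronglyMeasurable) (fun τ => ae_of_all _ fun x => ?_)
      hg.integrable (ae_of_all _ fun x => ?_)
    · rw [Real.norm_eq_abs, abs_of_nonneg (hg.damped_nonneg _ x)]
      exact hg.damped_le (le_max_left _ _) x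
    · unfold damped
      fun_prop
  · exact (continuousOn_partialLimit (hg.continuous_damped _) hM o).comp_continuous (by fun_prop)
      fun τ => max_min_mem_Icc _

theorem IsWeight.monotone_profile (hg : IsWeight P g) (ht : 0 < t) :
    Monotone (profile P o t g) := by
  obtain ⟨M, hM⟩ := hg.bounded t ht
  intro a b hab
  have h1 : max 0 (min a (t : ℝ)) ≤ max 0 (min b (t : ℝ)) := by gcongr
  have h2 : max 0 (min (a - t) 1) ≤ max 0 (min (b - t) 1) := by gcongr
  refine add_le_add (sub_le_sub_left (integral_mono (hg.integrable_damped (le_max_left _ _))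
    (hg.integrable_damped (le_max_left _ _)) fun x => ?_) _)
    (monotoneOn_partialLimit (hg.continuous_damped _) hM (hg.damped_nonneg _) o (max_min_mem_Icc _)
      (max_min_mem_Icc _) h2)
  refine mul_le_mul_of_nonneg_left (Real.exp_le_exp.2 (neg_le_neg ?_)) (hg.nonneg x)
  exact mul_le_mul_of_nonneg_right h1 x.coe_nonneg

/-- On `[0, t]` equal values at `a < b` would force `(b - a) * x = 0` almost everywhere,
contradicting the positive mean. On `[t, t + 1]` strictness comes from `exp (-(t * x)) > 0`. -/
theorem strictMonoOn_profile_one {μ : ℝ≥0}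
    (hP : ∫⁻ x : ℝ≥0, (x : ℝ≥0∞) ∂(P : Measure ℝ≥0) = μ) (hμ : μ ≠ 0) (ht : 0 < t) :
    StrictMonoOn (profile P o t fun _ => 1) (Icc 0 (t + 1)) := by
  have hg := isWeight_one P
  obtain ⟨M, hM⟩ := hg.bounded t ht
  have h1 : StrictMonoOn (profile P o t fun _ => 1) (Icc 0 t) := by
    intro a ha b hb hab
    rw [profile_of_le o ha.1 ha.2, profile_of_le o hb.1 hb.2]
    refine sub_lt_sub_left ?_ _
    refine lt_of_le_of_ne (integral_mono (hg.integrable_damped hb.1) (hg.integrable_damped ha.1)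
      fun x => ?_) fun heq => hμ ?_
    · simp only [damped_one]
      exact Real.exp_le_exp.2 (neg_le_neg (mul_le_mul_of_nonneg_right hab.le x.coe_nonneg))
    · have hae := (integral_eq_iff_of_ae_le (hg.integrable_damped hb.1)
        (hg.integrable_damped ha.1) (ae_of_all _ fun x => by
          simp only [damped_one]
          exact Real.exp_le_exp.2 (neg_le_neg (mul_le_mul_of_nonneg_right hab.le x.coe_nonneg)))).1
          heq
      have hzero : ∀ᵐ x : ℝ≥0 ∂(P : Measure ℝ≥0), (x : ℝ≥0∞) = 0 := by
        filter_upwards [hae] with x hx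
        rw [damped_one, damped_one, Real.exp_eq_exp, neg_inj] at hx
        have : (b - a) * x = 0 := by linarith
        rcases mul_eq_zero.1 this with h | h
        · exact absurd h (sub_pos.2 hab).ne'
        · exact_mod_cast h
      rw [lintegral_congr_ae hzero, lintegral_zero] at hP
      exact_mod_cast hP.symm
  have h2 : StrictMonoOn (profile P o t fun _ => 1) (Icc t (t + 1)) := by
    intro a ha b hb hab
    rw [profile_of_ge o ha.1 ha.2, profile_of_ge o hb.1 hb.2]
    refine add_lt_add_right (strictMonoOn_partialLimit (hg.continuous_damped _) hM (fun x => ?_) o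
      ⟨by linarith [ha.1], by linarith [ha.2]⟩ ⟨by linarith [hb.1], by linarith [hb.2]⟩
      (by linarith)) _
    rw [damped_one]
    exact Real.exp_pos _
  have := h1.union h2 (isGreatest_Icc t.coe_nonneg) (isLeast_Icc (by linarith))
  rwa [Icc_union_Icc_eq_Icc t.coe_nonneg (by linarith)] at this

end Profile

/-! ### Front sets parametrized by the time span, and convergence to the profiles. -/

section WeightedFront

/-- The instant at which the last time span of length `τ`, in units of `n * μ`, before the time
`n * μ * t` begins. -/
def cutInstant (μ t : ℝ≥0) (n : ℕ) (τ : ℝ≥0) : ℝ≥0 := n * μ * (t - τ)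

/-- The number of objects that make up a proportion `τ - t` of all objects. -/
def cutIndex (t : ℝ≥0) (n : ℕ) (τ : ℝ≥0) : ℕ := ⌈((τ - t : ℝ≥0) : ℝ) * n⌉₊

theorem cutInstant_le (μ t : ℝ≥0) (n : ℕ) (τ : ℝ≥0) : cutInstant μ t n τ ≤ n * μ * t :=
  mul_le_mul_of_nonneg_left tsub_le_self zero_le

theorem cutIndex_eq_zero_or (μ t : ℝ≥0) (n : ℕ) (τ : ℝ≥0) :
    cutIndex t n τ = 0 ∨ cutInstant μ t n τ = 0 := by
  rcases le_total τ t with h | h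
  · left
    simp [cutIndex, tsub_eq_zero_of_le h]
  · right
    simp [cutInstant, tsub_eq_zero_of_le h]

/-- A single formula covers both regimes: for `τ ≤ t` no object is in front by its initial position,
and for `τ ≥ t` the time cut is at 0, so that the exponent is `t` times the scaled rate. -/
theorem mul_frontProb {n : ℕ} (μ t τ : ℝ≥0) (w : Fin n → ℝ≥0) (g : ℝ≥0 → ℝ) (i : Fin n) :
    g (scaledRate μ w i) *
        frontProb (popularity w i) (n * μ * t) (cutInstant μ t n τ) (cutIndex t n τ) i =
      g (scaledRate μ w i) - damped g (min τ t : ℝ≥0) (scaledRate μ w i) +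
        if (i : ℕ) < cutIndex t n τ then damped g t (scaledRate μ w i) else 0 := by
  unfold frontProb
  split_ifs with h
  · have ht : t ≤ τ := by
      by_contra! hlt
      simp [cutIndex, tsub_eq_zero_of_le hlt.le] at h
    rw [min_eq_right ht]
    ring
  · have h1 : (popularity w i : ℝ) * ((n * μ * t : ℝ≥0) - cutInstant μ t n τ) =
        (min τ t : ℝ≥0) * scaledRate μ w i := by
      rcases le_total τ t with hle | hle
      · rw [min_eq_left hle, cutInstant, scaledRate]
        push_cast [NNReal.coe_sub hle]
        ring
      · rw [min_eq_right hle, cutInstant, scaledRate, tsub_eq_zero_of_le hle]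
        push_cast
        ring
    rw [h1, damped]
    ring

variable {Ω : ℕ → Type u} [∀ n, MeasurableSpace (Ω n)] {ν : ∀ n, Measure (Ω n)}
  [∀ n, IsProbabilityMeasure (ν n)] {w : ∀ n, Ω n → Fin n → ℝ≥0} {P : ProbabilityMeasure ℝ≥0}
  {μ t : ℝ≥0} {o : InitialOrder}

/-- The weight `x / μ` is unbounded, and only its damped versions are covered by
`LLN.tendsto_average`. The undamped average is supplied by `hsum`, which for this weight expresses
that the popularities sum to one. Positivity of `τ` provides the damping; `τ < t + 1` keeps the
proportion of initial objects below one. -/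
theorem LLN.tendsto_weighted_frontProb (hw : ∀ n, Measurable (w n)) (h : LLN ν w P μ) (hμ : μ ≠ 0)
    (ho : ∀ n, o.Holds (ν n) (w n)) (ht : 0 < t) {g : ℝ≥0 → ℝ} (hg : IsWeight P g)
    (hsum : ∀ᶠ z in probFilter ν, (∑ i, g (scaledRate μ (w z.1 z.2) i)) / z.1 = 1) {τ : ℝ≥0}
    (hτ : 0 < τ) (hτ' : τ < t + 1) :
    Tendsto (fun z : Σ n, Ω n => (∑ i : Fin z.1, g (scaledRate μ (w z.1 z.2) i) *
      frontProb (popularity (w z.1 z.2) i) (z.1 * μ * t) (cutInstant μ t z.1 τ) (cutIndex t z.1 τ) i)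
      / z.1) (probFilter ν) (𝓝 (profile P o t g τ)) := by
  have hm : 0 < min τ t := lt_min hτ ht
  obtain ⟨K, -, hK⟩ := hg.lipschitz (min τ t : ℝ≥0) hm
  obtain ⟨M, hM⟩ := hg.bounded (min τ t : ℝ≥0) hm
  obtain ⟨K', hK0, hK'⟩ := hg.lipschitz t ht
  obtain ⟨M', hM'⟩ := hg.bounded t ht
  have h1 : Tendsto (fun z : Σ n, Ω n => (∑ i, g (scaledRate μ (w z.1 z.2) i)) / z.1)
      (probFilter ν) (𝓝 1) :=
    tendsto_const_nhds.congr' (hsum.mono fun z hz => hz.symm)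
  have h2 := h.tendsto_average hw hμ hK hM
  have h3 : Tendsto (fun z : Σ n, Ω n => (∑ i : Fin z.1, if (i : ℕ) < cutIndex t z.1 τ then
      damped g t (scaledRate μ (w z.1 z.2) i) else 0) / z.1) (probFilter ν)
      (𝓝 (partialLimit P (damped g t) o (max 0 (min (τ - t) 1)))) := by
    rcases le_or_gt τ t with hle | hlt
    · have h0 : ((τ : ℝ) - t) ≤ 0 := sub_nonpos.2 (by exact_mod_cast hle)
      rw [max_eq_left ((min_le_left _ _).trans h0), partialLimit_zero]
      simpa [cutIndex, tsub_eq_zero_of_le hle] using tendsto_const_nhds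
    · have hv : ((τ - t : ℝ≥0) : ℝ) = τ - t := NNReal.coe_sub hlt.le
      have h0 : (0 : ℝ) < τ - t := sub_pos.2 (by exact_mod_cast hlt)
      have h1 : (τ : ℝ) - t < 1 := by
        have : (τ : ℝ) < t + 1 := by exact_mod_cast hτ'
        linarith
      rw [min_eq_left h1.le, max_eq_right h0.le]
      have := h.tendsto_partial_average hw hμ ho hK0 hK' hM' ⟨h0, h1⟩
      simpa only [cutIndex, hv] using this
  have h4 := (h1.sub h2).add h3
  have h5 : max 0 (min (τ : ℝ) t) = (min τ t : ℝ≥0) := by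
    rw [NNReal.coe_min, max_eq_right (le_min τ.coe_nonneg t.coe_nonneg)]
  rw [profile, h5]
  refine h4.congr fun z => ?_
  rw [← sub_div, ← add_div, ← Finset.sum_sub_distrib, ← Finset.sum_add_distrib]
  congr 1
  exact Finset.sum_congr rfl fun i _ => (mul_frontProb μ t τ (w z.1 z.2) g i).symm

variable {Y : ∀ n, Fin n → ℝ≥0 → Ω n → ℕ}

theorem LLN.tendsto_frontCount (hS : ∀ n, IsRequestScheme (ν n) (w n) (Y n)) (h : LLN ν w P μ)
    (hμ : μ ≠ 0) (ho : ∀ n, o.Holds (ν n) (w n)) (ht : 0 < t) {τ : ℝ≥0}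
    (hτ : 0 < τ) (hτ' : τ < t + 1) :
    Tendsto (fun z : Σ n, Ω n => (frontCount (w z.1) (Y z.1) (z.1 * μ * t) (cutInstant μ t z.1 τ)
      (cutIndex t z.1 τ) z.2 : ℝ) / z.1) (probFilter ν) (𝓝 (profile P o t (fun _ => 1) τ)) := by
  have h1 := h.tendsto_weighted_frontProb (fun n => (hS n).measurable_rates) hμ ho ht
    (isWeight_one P) (by
      filter_upwards [tendsto_fst_probFilter.eventually (eventually_ne_atTop 0)] with z hz
      have : (z.1 : ℝ) ≠ 0 := by exact_mod_cast hz
      simp [this]) hτ hτ'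
  simp only [one_mul] at h1
  exact MtF.tendsto_frontCount (T := fun n => n * μ * t) (r := fun n => cutInstant μ t n τ)
    (k := fun n => cutIndex t n τ) hS (fun n => cutInstant_le μ t n τ) h1

/-- The popularity of an object is its scaled rate divided by `n * μ`, so weighting by popularities
is averaging with weight `x / μ`. -/
theorem LLN.tendsto_measure_pathCost_le_frontCount
    (hS : ∀ n, IsRequestScheme (ν n) (w n) (Y n)) (h : LLN ν w P μ)
    (hP : ∫⁻ x : ℝ≥0, (x : ℝ≥0∞) ∂(P : Measure ℝ≥0) = μ) (hμ : μ ≠ 0)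
    (ho : ∀ n, o.Holds (ν n) (w n)) (ht : 0 < t) {τ : ℝ≥0} (hτ : 0 < τ) (hτ' : τ < t + 1) :
    Tendsto (fun n => (ν n).real {ω | pathCost (scaledPaths (Y n) (popularity (w n ω)) ω)
      (n * μ * t) ≤ frontCount (w n) (Y n) (n * μ * t) (cutInstant μ t n τ) (cutIndex t n τ) ω})
      atTop (𝓝 (profile P o t (fun x => (x : ℝ) / μ) τ)) := by
  have hw := fun n => (hS n).measurable_rates
  have hN : ∀ᶠ z : Σ n, Ω n in probFilter ν, z.1 ≠ 0 :=
    tendsto_fst_probFilter.eventually (eventually_ne_atTop 0)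
  have hμ' : (μ : ℝ) ≠ 0 := by exact_mod_cast hμ
  have hx : ∀ (n : ℕ), n ≠ 0 → ∀ (v : Fin n → ℝ≥0) i,
      (scaledRate μ v i : ℝ) / μ = n * popularity v i := fun n hn v i => by
    rw [scaledRate]
    push_cast
    field_simp
  have h1 := h.tendsto_weighted_frontProb hw hμ ho ht (isWeight_div hP hμ) (by
    filter_upwards [hN, h.eventually_sum_ne_zero hw hμ] with z hz hz'
    have hz0 : (z.1 : ℝ) ≠ 0 := by exact_mod_cast hz
    simp only [hx z.1 hz]
    rw [← Finset.mul_sum, mul_div_cancel_left₀ _ hz0]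
    exact_mod_cast sum_popularity hz') hτ hτ'
  refine MtF.tendsto_measure_pathCost_le_frontCount (T := fun n => n * μ * t)
    (r := fun n => cutInstant μ t n τ) (k := fun n => cutIndex t n τ) hS
    (fun n => cutInstant_le μ t n τ) (fun n => cutIndex_eq_zero_or μ t n τ)
    (h.eventually_sum_ne_zero hw hμ) (h1.congr' ?_)
  filter_upwards [hN] with z hz
  have hz0 : (z.1 : ℝ) ≠ 0 := by exact_mod_cast hz
  simp only [hx z.1 hz, mul_assoc]
  rw [← Finset.mul_sum, mul_div_cancel_left₀ _ hz0]

end WeightedFront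

/-! ### The limit law and convergence in distribution. -/

section Convergence

/-- The half-open intervals form a π-system containing arbitrarily small neighbourhoods of every
point, so convergence of their masses implies weak convergence. -/
theorem tendstoInDistribution_of_cdf {Ω : ℕ → Type*} [∀ n, MeasurableSpace (Ω n)]
    {ν : ∀ n, Measure (Ω n)} [∀ n, IsProbabilityMeasure (ν n)] {X : ∀ n, Ω n → ℝ}
    (hX : ∀ n, AEMeasurable (X n) (ν n)) (L : ProbabilityMeasure ℝ)
    (h : ∀ z, Tendsto (fun n => (ν n).real {ω | X n ω ≤ z}) atTop
      (𝓝 ((L : Measure ℝ).real (Iic z)))) :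
    TendstoInDistribution X atTop (id : ℝ → ℝ) ν (L : Measure ℝ) := by
  have hsub : ∀ (ρ : Measure ℝ) [IsProbabilityMeasure ρ] (a b : ℝ), a < b →
      ρ.real (Ioc a b) = ρ.real (Iic b) - ρ.real (Iic a) := fun ρ _ a b hab => by
    rw [← Iic_sdiff_Iic, measureReal_sdiff (Iic_subset_Iic.2 hab.le) measurableSet_Iic]
  have hmap : ∀ n z, ((ν n).map (X n)).real (Iic z) = (ν n).real {ω | X n ω ≤ z} := fun n z => by
    rw [measureReal_def, Measure.map_apply_of_aemeasurable (hX n) measurableSet_Iic]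
    rfl
  refine ⟨hX, aemeasurable_id, ?_⟩
  refine (isPiSystem_Ioc (id : ℝ → ℝ) id).tendsto_probabilityMeasure_of_tendsto_of_mem ?_ ?_ ?_
  · rintro s ⟨a, b, -, rfl⟩
    exact measurableSet_Ioc
  · intro u hu x hx
    obtain ⟨ε, hε, hsub⟩ := Metric.isOpen_iff.1 hu x hx
    refine ⟨Ioc (x - ε / 2) (x + ε / 2), ⟨x - ε / 2, x + ε / 2, by simp only [id]; linarith, rfl⟩,
      Ioc_mem_nhds (by linarith) (by linarith), fun y hy => hsub ?_⟩
    rw [Metric.mem_ball, Real.dist_eq, abs_lt]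
    constructor <;> linarith [hy.1, hy.2]
  · rintro s ⟨a, b, hab, rfl⟩
    rw [← NNReal.tendsto_coe]
    have := fun n => Measure.isProbabilityMeasure_map (hX n)
    have h1 := (h b).sub (h a)
    simp only [← hmap] at h1
    simp only [id] at hab
    rw [← hsub _ _ _ hab] at h1
    replace h1 := h1.congr fun n => (hsub ((ν n).map (X n)) _ _ hab).symm
    rw [← Measure.map_id (μ := (L : Measure ℝ))] at h1
    exact h1

variable {P : ProbabilityMeasure ℝ≥0} {μ t : ℝ≥0}

variable (o : InitialOrder)

theorem measurable_profile_one (ht : 0 < t) : Measurable (profile P o t fun _ => 1) :=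
  ((isWeight_one P).continuous_profile o ht).measurable

theorem profile_one_mem_Icc (ht : 0 < t) (τ : ℝ) :
    profile P o t (fun _ => 1) τ ∈ Icc (0 : ℝ) 1 := by
  have hg := isWeight_one P
  exact ⟨(hg.profile_of_nonpos o (t := t) (min_le_left 0 τ)).symm.trans_le
      (hg.monotone_profile o ht (min_le_right _ _)),
    (hg.monotone_profile o ht (le_max_right _ _)).trans_eq
      (hg.profile_of_ge_add_one o (t := t) (le_max_left (t + 1 : ℝ) τ))⟩

theorem exists_profile_one_eq (ht : 0 < t) {z : ℝ} (hz : z ∈ Ico (0 : ℝ) 1) :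
    ∃ τ ∈ Ico (0 : ℝ) (t + 1), profile P o t (fun _ => 1) τ = z := by
  have hg := isWeight_one P
  have h1 := intermediate_value_Ico (f := profile P o t fun _ => 1) (a := 0) (b := (t : ℝ) + 1)
    (by positivity) (hg.continuous_profile o ht).continuousOn
  rw [hg.profile_of_nonpos o le_rfl, hg.profile_of_ge_add_one o le_rfl] at h1
  exact h1 hz

/-- The limiting distribution of the search-cost in the parametrization by time spans. -/
def costProfile (hP : ∫⁻ x : ℝ≥0, (x : ℝ≥0∞) ∂(P : Measure ℝ≥0) = μ)
    (hμ : μ ≠ 0) (ht : 0 < t) : StieltjesFunction ℝ where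
  toFun := profile P o t fun x => (x : ℝ) / μ
  mono' := (isWeight_div hP hμ).monotone_profile o ht
  right_continuous' _ := ((isWeight_div hP hμ).continuous_profile o ht).continuousWithinAt

variable (hP : ∫⁻ x : ℝ≥0, (x : ℝ≥0∞) ∂(P : Measure ℝ≥0) = μ)
  (hμ : μ ≠ 0) (ht : 0 < t)

theorem tendsto_costProfile_atBot : Tendsto (costProfile o hP hμ ht) atBot (𝓝 0) :=
  tendsto_const_nhds.congr' ((eventually_le_atBot 0).mono fun _ hτ =>
    ((isWeight_div hP hμ).profile_of_nonpos o hτ).symm)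

theorem tendsto_costProfile_atTop : Tendsto (costProfile o hP hμ ht) atTop (𝓝 1) :=
  tendsto_const_nhds.congr' ((eventually_ge_atTop (t + 1 : ℝ)).mono fun _ hτ =>
    ((isWeight_div hP hμ).profile_of_ge_add_one o hτ).symm)

theorem isProbabilityMeasure_costProfile :
    IsProbabilityMeasure (costProfile o hP hμ ht).measure :=
  StieltjesFunction.isProbabilityMeasure _ (tendsto_costProfile_atBot o hP hμ ht)
    (tendsto_costProfile_atTop o hP hμ ht)

/-- The law of the limiting transient search-cost. -/
def limitLaw : ProbabilityMeasure ℝ :=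
  ⟨(costProfile o hP hμ ht).measure.map (profile P o t fun _ => 1),
    have := isProbabilityMeasure_costProfile o hP hμ ht
    Measure.isProbabilityMeasure_map (measurable_profile_one o ht).aemeasurable⟩

theorem limitLaw_Iic_of_neg {z : ℝ} (hz : z < 0) :
    (limitLaw o hP hμ ht : Measure ℝ).real (Iic z) = 0 := by
  have h1 : profile P o t (fun _ => 1) ⁻¹' Iic z = ∅ :=
    eq_empty_of_forall_notMem fun τ hτ =>
      (hz.trans_le (profile_one_mem_Icc o ht τ).1).not_ge hτ
  rw [limitLaw, ProbabilityMeasure.coe_mk, measureReal_def,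
    Measure.map_apply (measurable_profile_one o ht) measurableSet_Iic, h1]
  simp

theorem limitLaw_Iic_of_one_le {z : ℝ} (hz : 1 ≤ z) :
    (limitLaw o hP hμ ht : Measure ℝ).real (Iic z) = 1 := by
  have := isProbabilityMeasure_costProfile o hP hμ ht
  have h1 : profile P o t (fun _ => 1) ⁻¹' Iic z = univ :=
    eq_univ_of_forall fun τ => (profile_one_mem_Icc o ht τ).2.trans hz
  rw [limitLaw, ProbabilityMeasure.coe_mk, measureReal_def,
    Measure.map_apply (measurable_profile_one o ht) measurableSet_Iic, h1]
  simp

/-- Strict monotonicity identifies the preimage of the half-line with `Iic τ`. This fails at `τ = t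
+ 1`, since the profile is constant from there on. -/
theorem limitLaw_Iic_profile {τ : ℝ} (hτ : τ ∈ Ico (0 : ℝ) (t + 1)) :
    (limitLaw o hP hμ ht : Measure ℝ).real (Iic (profile P o t (fun _ => 1) τ)) =
      profile P o t (fun x => (x : ℝ) / μ) τ := by
  have hs := strictMonoOn_profile_one o hP hμ ht
  have hg := isWeight_one P
  have h1 : profile P o t (fun _ => 1) ⁻¹' Iic (profile P o t (fun _ => 1) τ) = Iic τ := by
    ext s
    rw [mem_preimage, mem_Iic, mem_Iic]
    refine ⟨fun h => ?_, fun h => hg.monotone_profile o ht h⟩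
    by_contra! hlt
    -- Capping `s` at `t + 1` stays within the interval of strict monotonicity while remaining above
    -- `τ`.
    have h2 := hs ⟨hτ.1, hτ.2.le⟩ (b := min s (t + 1)) ⟨le_min (hτ.1.trans hlt.le)
      (by positivity), min_le_right _ _⟩ (lt_min hlt hτ.2)
    exact (h2.trans_le (hg.monotone_profile o ht (min_le_left _ _))).not_ge h
  rw [limitLaw, ProbabilityMeasure.coe_mk, measureReal_def,
    Measure.map_apply (measurable_profile_one o ht) measurableSet_Iic, h1,
    StieltjesFunction.measure_Iic _ (tendsto_costProfile_atBot o hP hμ ht), sub_zero]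
  refine ENNReal.toReal_ofReal ?_
  rw [← (isWeight_div hP hμ).profile_of_nonpos o (t := t) le_rfl]
  exact (isWeight_div hP hμ).monotone_profile o ht hτ.1

variable {Ω : ℕ → Type u} [∀ n, MeasurableSpace (Ω n)] {ν : ∀ n, Measure (Ω n)}
  [∀ n, IsProbabilityMeasure (ν n)] {w : ∀ n, Ω n → Fin n → ℝ≥0}
  {Y : ∀ n, Fin n → ℝ≥0 → Ω n → ℕ}

/-- Squeeze between spans `s < τ` and `s > τ`. By strict monotonicity of the size profile, the
normalized size of the front set for `s` lies, with probability tending to one, strictly below,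
respectively above, its limit at `τ`; continuity of the cost profile then lets `s` approach `τ`. -/
theorem tendsto_measure_pathCost_div_le
    (hP : ∫⁻ x : ℝ≥0, (x : ℝ≥0∞) ∂(P : Measure ℝ≥0) = μ) (hμ : μ ≠ 0) (ht : 0 < t)
    (hS : ∀ n, IsRequestScheme (ν n) (w n) (Y n)) (h : LLN ν w P μ) (ho : ∀ n, o.Holds (ν n) (w n))
    {τ : ℝ} (hτ : τ ∈ Ico (0 : ℝ) (t + 1)) :
    Tendsto (fun n => (ν n).real {ω | (pathCost (scaledPaths (Y n) (popularity (w n ω)) ω)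
      (n * μ * t) : ℝ) / n ≤ profile P o t (fun _ => 1) τ}) atTop
      (𝓝 (profile P o t (fun x => (x : ℝ) / μ) τ)) := by
  have hg := isWeight_div hP hμ
  have hs := strictMonoOn_profile_one o hP hμ ht
  have hcont := (hg.continuous_profile o ht).continuousAt (x := τ)
  rw [tendsto_order]
  constructor
  · intro a ha
    -- At `τ = 0` there is no smaller span, but the lower bound is trivial because the cost profile
    -- vanishes there.
    rcases hτ.1.eq_or_lt with rfl | hτ0
    · rw [hg.profile_of_nonpos o le_rfl] at ha
      exact Eventually.of_forall fun n => ha.trans_le measureReal_nonneg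
    obtain ⟨s, hs1, hs2⟩ : ∃ s ∈ Ioo 0 τ, a < profile P o t (fun x => (x : ℝ) / μ) s :=
      (((hcont.eventually (lt_mem_nhds ha)).filter_mono nhdsWithin_le_nhds).and
        (Ioo_mem_nhdsLT hτ0)).exists.imp fun s hs => ⟨hs.2, hs.1⟩
    lift s to ℝ≥0 using hs1.1.le
    have hs0 : 0 < s := by exact_mod_cast hs1.1
    have hst : s < t + 1 := by exact_mod_cast hs1.2.trans hτ.2
    have h1 := h.tendsto_measure_pathCost_le_frontCount hS hP hμ ho ht hs0 hst
    have h2 := (tendsto_order.1 (h.tendsto_frontCount hS hμ ho ht hs0 hst)).2 _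
      (hs ⟨hs1.1.le, (hs1.2.trans hτ.2).le⟩ ⟨hτ.1, hτ.2.le⟩ hs1.2)
    rw [eventually_probFilter] at h2
    have h3 := (ENNReal.tendsto_toReal ENNReal.zero_ne_top).comp h2
    have h4 := h1.sub h3
    rw [ENNReal.toReal_zero, sub_zero] at h4
    filter_upwards [(tendsto_order.1 h4).1 a hs2] with n hn
    refine hn.trans_le (sub_le_iff_le_add.2 ((measureReal_mono ?_).trans
      (measureReal_union_le _ _)))
    intro ω hω
    by_cases hc : (frontCount (w n) (Y n) (n * μ * t) (cutInstant μ t n s) (cutIndex t n s) ω : ℝ) /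
        n < profile P o t (fun _ => 1) τ
    · refine Or.inl (le_trans ?_ hc.le)
      exact div_le_div_of_nonneg_right (Nat.cast_le.2 hω) n.cast_nonneg
    · exact Or.inr hc
  · intro a ha
    obtain ⟨s, hs1, hs2⟩ : ∃ s ∈ Ioo τ (t + 1), profile P o t (fun x => (x : ℝ) / μ) s < a :=
      (((hcont.eventually (gt_mem_nhds ha)).filter_mono nhdsWithin_le_nhds).and
        (Ioo_mem_nhdsGT hτ.2)).exists.imp fun s hs => ⟨hs.2, hs.1⟩
    lift s to ℝ≥0 using hτ.1.trans hs1.1.le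
    have hs0 : 0 < s := by exact_mod_cast hτ.1.trans_lt hs1.1
    have hst : s < t + 1 := by exact_mod_cast hs1.2
    have h1 := h.tendsto_measure_pathCost_le_frontCount hS hP hμ ho ht hs0 hst
    have h2 := (tendsto_order.1 (h.tendsto_frontCount hS hμ ho ht hs0 hst)).1 _
      (hs ⟨hτ.1, hτ.2.le⟩ ⟨s.coe_nonneg, hs1.2.le⟩ hs1.1)
    rw [eventually_probFilter] at h2
    have h3 := (ENNReal.tendsto_toReal ENNReal.zero_ne_top).comp h2
    have h4 := h1.add h3
    rw [ENNReal.toReal_zero, add_zero] at h4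
    filter_upwards [(tendsto_order.1 h4).2 a hs2, eventually_gt_atTop 0] with n hn hn0
    refine lt_of_le_of_lt ((measureReal_mono ?_).trans (measureReal_union_le _ _)) hn
    intro ω hω
    have hn0' : (0 : ℝ) < n := by exact_mod_cast hn0
    by_cases hc : profile P o t (fun _ => 1) τ < (frontCount (w n) (Y n) (n * μ * t)
        (cutInstant μ t n s) (cutIndex t n s) ω : ℝ) / n
    · refine Or.inl ?_
      have := (lt_of_le_of_lt hω hc).le
      rw [div_le_div_iff_of_pos_right hn0'] at this
      exact_mod_cast this
    · exact Or.inr hc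

theorem isLimitingSearchCostLaw_limitLaw :
    IsLimitingSearchCostLaw.{u} o P μ t (limitLaw o hP hμ ht) := by
  intro Ω _ ν _ w Y hS h ho
  have hμ' : 0 < μ := pos_iff_ne_zero.2 hμ
  have hT : ∀ n : ℕ, n ≠ 0 → 0 < (n : ℝ≥0) * μ * t := fun n hn => by
    have : (0 : ℝ≥0) < n := by exact_mod_cast pos_iff_ne_zero.2 hn
    positivity
  refine tendstoInDistribution_of_cdf (fun n => ?_) _ fun z => ?_
  · exact (measurable_from_top.comp_aemeasurable
      ((hS n).aemeasurable_randomSearchCost (hT n))).div_const _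
  have hcongr : ∀ᶠ n : ℕ in atTop, (ν n).real {ω | (pathCost (scaledPaths (Y n)
      (popularity (w n ω)) ω) (n * μ * t) : ℝ) / n ≤ z} =
      (ν n).real {ω | (randomSearchCost (w n) (Y n) (n * μ * t) ω : ℝ) / n ≤ z} := by
    filter_upwards [eventually_ne_atTop 0] with n hn
    refine measureReal_congr ?_
    filter_upwards [(hS n).randomSearchCost_ae_eq (hT n hn)] with ω hω
    refine propext (?_ : _ ≤ z ↔ _ ≤ z)
    rw [hω]
  refine Tendsto.congr' hcongr ?_
  rcases lt_or_ge z 0 with hz | hz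
  · rw [limitLaw_Iic_of_neg o hP hμ ht hz]
    refine tendsto_const_nhds.congr fun n => ?_
    have : {ω | (pathCost (scaledPaths (Y n) (popularity (w n ω)) ω) (n * μ * t) : ℝ) / n ≤ z} =
        ∅ := eq_empty_of_forall_notMem fun ω hω => (hz.trans_le (by positivity)).not_ge hω
    rw [this, measureReal_empty]
  rcases lt_or_ge z 1 with hz1 | hz1
  · obtain ⟨τ, hτ, rfl⟩ := exists_profile_one_eq (P := P) o ht ⟨hz, hz1⟩
    rw [limitLaw_Iic_profile o hP hμ ht hτ]
    exact tendsto_measure_pathCost_div_le o hP hμ ht hS h ho hτ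
  · rw [limitLaw_Iic_of_one_le o hP hμ ht hz1]
    refine tendsto_const_nhds.congr fun n => ?_
    have : {ω | (pathCost (scaledPaths (Y n) (popularity (w n ω)) ω) (n * μ * t) : ℝ) / n ≤ z} =
        univ := eq_univ_of_forall fun ω => by
      refine le_trans ?_ hz1
      refine div_le_one_of_le₀ (Nat.cast_le.2 ?_) n.cast_nonneg
      exact pathCost_le (isCountingPath_scaledPaths (hS n).poisson _ ω) _
    rw [this, probReal_univ]

end Convergence

/-! ### Stochastic comparison of the three limit laws. -/

section Comparison

variable {P : ProbabilityMeasure ℝ≥0} {μ t : ℝ≥0}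

/-- Write a level in `[0, 1)` as the size profile of `β` at `τ` and of `α` at `τ'`. If one of the
spans is at most `t`, where profiles ignore the initial order, injectivity gives `τ = τ'` and the
distribution functions agree there. Otherwise equality of the levels is equality of the partial
limits at `τ - t` and `τ' - t`, to which `h` applies. -/
theorem stochLE_limitLaw {α β : InitialOrder}
    (hP : ∫⁻ x : ℝ≥0, (x : ℝ≥0∞) ∂(P : Measure ℝ≥0) = μ) (hμ : μ ≠ 0) (ht : 0 < t)
    (h : ∀ v ∈ Icc (0 : ℝ) 1, ∀ v' ∈ Icc (0 : ℝ) 1,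
      partialLimit P (damped (fun _ => 1) t) β v = partialLimit P (damped (fun _ => 1) t) α v' →
      partialLimit P (damped (fun x => (x : ℝ) / μ) t) β v ≤
        partialLimit P (damped (fun x => (x : ℝ) / μ) t) α v') :
    StochLE (limitLaw α hP hμ ht) (limitLaw β hP hμ ht) := by
  intro z
  rw [← ENNReal.toReal_le_toReal (measure_ne_top _ _) (measure_ne_top _ _)]
  change (limitLaw β hP hμ ht : Measure ℝ).real (Iic z) ≤
    (limitLaw α hP hμ ht : Measure ℝ).real (Iic z)
  rcases lt_or_ge z 0 with hz | hz
  · rw [limitLaw_Iic_of_neg _ hP hμ ht hz, limitLaw_Iic_of_neg _ hP hμ ht hz]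
  rcases lt_or_ge 1 z with hz1 | hz1
  · rw [limitLaw_Iic_of_one_le _ hP hμ ht hz1.le, limitLaw_Iic_of_one_le _ hP hμ ht hz1.le]
  rcases hz1.eq_or_lt with rfl | hz1
  · rw [limitLaw_Iic_of_one_le _ hP hμ ht le_rfl, limitLaw_Iic_of_one_le _ hP hμ ht le_rfl]
  obtain ⟨τ, hτ, rfl⟩ := exists_profile_one_eq (P := P) β ht ⟨hz, hz1⟩
  obtain ⟨τ', hτ', heq⟩ := exists_profile_one_eq (P := P) α ht ⟨hz, hz1⟩
  rw [limitLaw_Iic_profile β hP hμ ht hτ, ← heq, limitLaw_Iic_profile α hP hμ ht hτ']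
  have hα := (strictMonoOn_profile_one α hP hμ ht).injOn
  have hβ := (strictMonoOn_profile_one β hP hμ ht).injOn
  rcases le_total τ t with hle | hge
  · have h1 : profile P α t (fun _ => 1) τ' = profile P α t (fun _ => 1) τ := by
      rw [heq, profile_of_le _ hτ.1 hle, profile_of_le _ hτ.1 hle]
    obtain rfl := hα ⟨hτ'.1, hτ'.2.le⟩ ⟨hτ.1, hτ.2.le⟩ h1
    rw [profile_of_le _ hτ.1 hle, profile_of_le _ hτ.1 hle]
  rcases le_total τ' t with hle' | hge'
  · have h1 : profile P β t (fun _ => 1) τ' = profile P β t (fun _ => 1) τ := by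
      rw [← heq, profile_of_le _ hτ'.1 hle', profile_of_le _ hτ'.1 hle']
    obtain rfl := hβ ⟨hτ'.1, hτ'.2.le⟩ ⟨hτ.1, hτ.2.le⟩ h1
    rw [profile_of_le _ hτ.1 hle', profile_of_le _ hτ.1 hle']
  rw [profile_of_ge _ hge hτ.2.le, profile_of_ge _ hge' hτ'.2.le] at *
  have h1 := h (τ - t) ⟨by linarith, by linarith [hτ.2]⟩ (τ' - t)
    ⟨by linarith, by linarith [hτ'.2]⟩ (by linarith)
  linarith

theorem damped_div (μ : ℝ≥0) (u : ℝ) : damped (fun x => (x : ℝ) / μ) u =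
    fun x : ℝ≥0 => (x : ℝ) / μ * damped (fun _ => 1) u x := by
  ext x
  simp [damped]

theorem partialLimit_damped_mul_le (hP : ∫⁻ x : ℝ≥0, (x : ℝ≥0∞) ∂(P : Measure ℝ≥0) = μ)
    (hμ : μ ≠ 0) (ht : 0 < t) {v : ℝ} (hv : v ∈ Icc (0 : ℝ) 1) :
    partialLimit P (damped (fun x => (x : ℝ) / μ) t) .increasing v *
        ∫ x, damped (fun _ => 1) t x ∂(P : Measure ℝ≥0) ≤
      partialLimit P (damped (fun _ => 1) t) .increasing v *
        ∫ x, damped (fun x => (x : ℝ) / μ) t x ∂(P : Measure ℝ≥0) := by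
  have h1 := isWeight_one P
  have h2 := isWeight_div hP hμ
  obtain ⟨M, hM⟩ := h1.bounded t ht
  obtain ⟨M', hM'⟩ := h2.bounded t ht
  have h3 := h2.continuous_damped t
  rw [damped_div] at h3 hM' ⊢
  exact partialLimit_increasing_mul_le (h1.continuous_damped t) hM (h1.damped_nonneg t)
    (fun a b hab => by gcongr) h3 hM' hv

theorem integral_damped_one_pos (P : ProbabilityMeasure ℝ≥0) (ht : 0 < t) :
    0 < ∫ x, damped (fun _ => 1) t x ∂(P : Measure ℝ≥0) := by
  have hg := isWeight_one P
  obtain ⟨M, hM⟩ := hg.bounded t ht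
  have := strictMonoOn_partialLimit (P := P) (hg.continuous_damped t) hM
    (fun x => by rw [damped_one]; exact Real.exp_pos _) .increasing (left_mem_Icc.2 zero_le_one)
    (right_mem_Icc.2 zero_le_one) zero_lt_one
  rwa [partialLimit_zero, partialLimit_one (hg.continuous_damped t)] at this

/-- The exchangeable order takes the same fraction of both damped integrals. At equal size, the
increasing order takes at most that fraction of the popularity-weighted one, by Chebyshev's
inequality. -/
theorem stochLE_exchangeable_increasing
    (hP : ∫⁻ x : ℝ≥0, (x : ℝ≥0∞) ∂(P : Measure ℝ≥0) = μ) (hμ : μ ≠ 0) (ht : 0 < t) :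
    StochLE (limitLaw .exchangeable hP hμ ht) (limitLaw .increasing hP hμ ht) := by
  refine stochLE_limitLaw hP hμ ht fun v hv v' hv' heq => ?_
  have h1 := partialLimit_damped_mul_le hP hμ ht hv
  rw [heq] at h1
  refine le_of_mul_le_mul_right (h1.trans_eq ?_) (integral_damped_one_pos P ht)
  simp only [partialLimit]
  ring

/-- A front part in decreasing order is the complement of one in increasing order, which carries at
most its proportional share; so the former carries at least its own. -/
theorem stochLE_decreasing_exchangeable
    (hP : ∫⁻ x : ℝ≥0, (x : ℝ≥0∞) ∂(P : Measure ℝ≥0) = μ) (hμ : μ ≠ 0) (ht : 0 < t) :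
    StochLE (limitLaw .decreasing hP hμ ht) (limitLaw .exchangeable hP hμ ht) := by
  refine stochLE_limitLaw hP hμ ht fun v hv v' hv' heq => ?_
  have hg1 := isWeight_one P
  have hg2 := isWeight_div hP hμ
  obtain ⟨M, hM⟩ := hg1.bounded t ht
  obtain ⟨M', hM'⟩ := hg2.bounded t ht
  have h1 := partialLimit_damped_mul_le hP hμ ht (v := 1 - v')
    ⟨by linarith [hv'.2], by linarith [hv'.1]⟩
  rw [partialLimit_decreasing (hg1.continuous_damped t) hM hv'] at heq
  rw [partialLimit_decreasing (hg2.continuous_damped t) hM' hv']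
  refine le_of_mul_le_mul_right ?_ (integral_damped_one_pos P ht)
  have h2 := congrArg (· * ∫ x, damped (fun x => (x : ℝ) / μ) t x ∂(P : Measure ℝ≥0)) heq
  simp only [partialLimit] at h1 h2 ⊢
  linarith

end Comparison

end MtF

theorem mainTheorem6 (P : MeasureTheory.ProbabilityMeasure ℝ≥0) (μ : ℝ≥0)
    (hP : ∫⁻ x : ℝ≥0, (x : ℝ≥0∞) ∂(P : MeasureTheory.Measure ℝ≥0) = μ) (hμ : μ ≠ 0)
    (t : ℝ≥0) (ht : 0 < t) :
    ∃ Lex Lplus Lminus : MeasureTheory.ProbabilityMeasure ℝ,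
      MtF.IsLimitingSearchCostLaw.{u} .exchangeable P μ t Lex ∧
      MtF.IsLimitingSearchCostLaw.{u} .increasing P μ t Lplus ∧
      MtF.IsLimitingSearchCostLaw.{u} .decreasing P μ t Lminus ∧
      MtF.StochLE Lminus Lex ∧ MtF.StochLE Lex Lplus :=
  ⟨MtF.limitLaw .exchangeable hP hμ ht, MtF.limitLaw .increasing hP hμ ht,
    MtF.limitLaw .decreasing hP hμ ht, MtF.isLimitingSearchCostLaw_limitLaw _ hP hμ ht,
    MtF.isLimitingSearchCostLaw_limitLaw _ hP hμ ht,
    MtF.isLimitingSearchCostLaw_limitLaw _ hP hμ ht,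
    MtF.stochLE_decreasing_exchangeable hP hμ ht, MtF.stochLE_exchangeable_increasing hP hμ ht⟩

end
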